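/- Let $\mathbb T=\mathbb R/2\pi\mathbb Z$, $\alpha\in\mathbb R$, and let $Q_0,\dots,Q_{q-1}:\mathbb T\to\mathbb R$ be continuous functions with $\{1,\sin x,\cos x,\sin 2x,\cos 2x\}\subset\mathrm{span}_{\mathbb R}\{Q_0,\dots,Q_{q-1}\}$. For $\psi_0\in L^2(\mathbb T;\mathbb C)$, $T\ge 0$ and a piecewise constant control $u:(0,T)\to\mathbb R^q$, let $R_t(\psi_0,u)$, $t\in[0,T]$, be the value at time $t$ of the weak solution $\psi\in C([0,T];L^2(\mathbb T))$ of $$\partial_t\psi+\partial_x^3\psi-i\alpha\,\partial_x^2\psi=i(u\cdot Q)\psi,\qquad \psi(0)=\psi_0 .$$ A unitary operator $S$ on $L^2(\mathbb T)$ is called $L^2$-STAR if for every $\psi_0\in L^2(\mathbb T)$ with $\|\psi_0\|_{L^2}=1$ and every $\varepsilon>0$ there exist $T\in[0,\varepsilon]$, $\beta\in[0,2\pi)$ and a piecewise constant $u:(0,T)\to\mathbb R^q$ such that $\|R_T(\psi_0,u)-e^{i\beta}S\psi_0\|_{L^2}<\varepsilon$. For smooth $f:\mathbb T\to\mathbb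 R$ let $T_f=f\partial_x+\tfrac12 f'$ with domain $D(T_f)=\{\psi\in L^2(\mathbb T): f\partial_x\psi\in L^2(\mathbb T)\}$ (derivatives of $\psi$ in the sense of distributions), and let $(e^{tT_f})_{t\in\mathbb R}$ be the strongly continuous unitary group on $L^2(\mathbb T)$ generated by $T_f$. Let $G=\{(\varphi')^2:\varphi\in C^\infty(\mathbb T;\mathbb R)\}$ and $$\mathrm{cone}(G)=\Big\{\sum_{j=1}^m\alpha_j g_j:\ m\ge 1,\ g_j\in G,\ \alpha_j\ge 0\Big\}.$$ (i) For every $f\in\mathrm{cone}(G)$, the operator $T_f$ generates a strongly continuous unitary group and $e^{T_f}$ is $L^2$-STAR. (ii) The operator $\partial_x=T_1$ generates the group of translations $(e^{\delta\partial_x}\psi)(x)=\psi(x+\delta)$, and $e^{\delta\partial_x}$ is $L^2$-STAR for every $\delta>0$. -/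

import Mathlib

open Real Set Filter Topology MeasureTheory
open scoped ContDiff

noncomputable section

namespace KdVSch

/-- The torus `ℝ / 2πℤ`. -/
abbrev Torus : Type := AddCircle (2 * π)

instance factTwoPiPos : Fact (0 < 2 * π) := ⟨Real.two_pi_pos⟩

/-- The complex Hilbert space `L²(𝕋)`, with respect to the normalised measure `dx / 2π`. -/
abbrev L2 : Type := Lp ℂ 2 (AddCircle.haarAddCircle : Measure Torus)

/-- Smooth functions on the torus, written as smooth `2π`-periodic functions on the line. -/
def SmoothPeriodic {E : Type*} [NormedAddCommGroup E] [NormedSpace ℝ E] (f : ℝ → E) : Prop :=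
  ContDiff ℝ ∞ f ∧ Function.Periodic f (2 * π)

/-- Piecewise constant controls on `(0, T)`: there is a finite subdivision
`0 = τ 0 ≤ τ 1 ≤ ⋯ ≤ τ n = T` such that `u` is constant on each open interval of it.
(Values at the finitely many subdivision points are irrelevant.) -/
def IsPWC {q : ℕ} (T : ℝ) (u : ℝ → Fin q → ℝ) : Prop :=
  ∃ (n : ℕ) (τ : ℕ → ℝ) (c : ℕ → Fin q → ℝ), Monotone τ ∧ τ 0 = 0 ∧ τ n = T ∧
    ∀ i < n, ∀ s ∈ Ioo (τ i) (τ (i + 1)), u s = c i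

/-- `ψ ∈ C([0,T]; L²(𝕋))` is the (weak) solution of
`∂ₜψ + ∂ₓ³ψ - iα ∂ₓ²ψ = i (u · Q) ψ` on `(0,T) × 𝕋`, `ψ(0) = ψ₀`:
the equation is tested against smooth functions `χ` on the torus, the space derivatives being
moved onto `χ`, and is integrated in time. -/
def IsSolution {q : ℕ} (α : ℝ) (Q : Fin q → ℝ → ℝ) (T : ℝ) (u : ℝ → Fin q → ℝ)
    (ψ₀ : L2) (ψ : ℝ → L2) : Prop :=
  ContinuousOn ψ (Icc 0 T) ∧ ψ 0 = ψ₀ ∧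
  ∀ χ : ℝ → ℂ, SmoothPeriodic χ → ∀ t ∈ Icc 0 T,
    ∫ x in (0)..(2 * π), ψ t (x : Torus) * χ x =
      (∫ x in (0)..(2 * π), ψ₀ (x : Torus) * χ x) +
      ∫ s in (0)..t, ∫ x in (0)..(2 * π), ψ s (x : Torus) *
        (iteratedDeriv 3 χ x + Complex.I * (α : ℂ) * iteratedDeriv 2 χ x +
          Complex.I * ((∑ j, u s j * Q j x : ℝ) : ℂ) * χ x)

/-- A unitary operator `S` of `L²(𝕋)` is `L²`-STAR (small-time approximately reachable) for the
control system with parameter `α` and control profiles `Q`. -/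
def IsSTAR {q : ℕ} (α : ℝ) (Q : Fin q → ℝ → ℝ) (S : L2 ≃ₗᵢ[ℂ] L2) : Prop :=
  ∀ ψ₀ : L2, ‖ψ₀‖ = 1 → ∀ ε > 0,
    ∃ T ∈ Icc 0 ε, ∃ β ∈ Ico 0 (2 * π), ∃ u : ℝ → Fin q → ℝ, IsPWC T u ∧
      ∃ ψ : ℝ → L2, IsSolution α Q T u ψ₀ ψ ∧
        ‖ψ T - Complex.exp (Complex.I * (β : ℂ)) • S ψ₀‖ < ε

/-- `ψ ∈ D(T_f)` and `T_f ψ = g`, for the transport operator `T_f = f ∂ₓ + f'/2` on `L²(𝕋)` with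
its maximal domain `{ψ ∈ L² : f ∂ₓψ ∈ L²}`. Derivatives of `ψ` are taken in the sense of
distributions: `∫ (f ψ' + f' ψ / 2) χ = - ∫ ψ (f χ' + f' χ / 2)`. -/
def TransportRel (f : ℝ → ℝ) (ψ g : L2) : Prop :=
  ∀ χ : ℝ → ℂ, SmoothPeriodic χ →
    ∫ x in (0)..(2 * π), g (x : Torus) * χ x =
      - ∫ x in (0)..(2 * π), ψ (x : Torus) *
          ((f x : ℂ) * deriv χ x + ((deriv f x : ℝ) : ℂ) / 2 * χ x)

/-- `V` is the strongly continuous unitary group `(e^{t T_f})_{t ∈ ℝ}` on `L²(𝕋)` generated by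
`T_f`: its infinitesimal generator is the operator `T_f`, domain included. -/
structure IsTransportGroup (f : ℝ → ℝ) (V : ℝ → L2 ≃ₗᵢ[ℂ] L2) : Prop where
  zero : ∀ ψ, V 0 ψ = ψ
  add : ∀ s t ψ, V (s + t) ψ = V s (V t ψ)
  continuous : ∀ ψ, Continuous fun t => V t ψ
  generator : ∀ ψ g, HasDerivAt (fun t => V t ψ) g 0 ↔ TransportRel f ψ g

/-- `G = {(φ')² : φ ∈ C^∞(𝕋; ℝ)}`. -/
def G : Set (ℝ → ℝ) :=
  {f | ∃ φ : ℝ → ℝ, SmoothPeriodic φ ∧ f = fun x => (deriv φ x) ^ 2}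

/-- The convex cone generated by `G`. -/
def coneG : Set (ℝ → ℝ) :=
  {f | ∃ (m : ℕ) (a : Fin m → ℝ) (g : Fin m → ℝ → ℝ), 0 < m ∧ (∀ j, 0 ≤ a j) ∧ (∀ j, g j ∈ G) ∧
    f = fun x => ∑ j, a j * g j x}

end KdVSch

end

/-! Write `A = -∂ₓ³ + iα∂ₓ²`. Isometries are built as products of short evolutions, and the reaching
time of each factor is kept negligible against the time step `h` of the group to be imitated. Two
facts make this rigorous. Approximately reachable isometries (`AR`) are stable under composition and
strong limits, because isometries do not amplify errors. A Lax-Chernoff argument (`Consistent.ar`)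
shows that if `1 + hL + o(h)` is reachable in time `o(h)`, uniformly on bounded families of smooth
functions, then the group generated by `L` is reachable in time `0`. `Consistent.add` is the
corresponding Trotter formula.

Phases come before transport. A control of size `1/h` applied for time `h²` produces `e^{ihθ}` for
smooth `θ` in the span of `Q` (`consistent_mulI_of_span`). Conjugating the free flow by a reachable
phase changes its generator to `e^{-iφ/k} A e^{iφ/k} = k⁻³ (iφ'³ + k (T_{3φ'²} - iαφ'²) + O(k²))`,
see `scOpA_eq`. Run for time `k⁴`, it is to first order multiplication by `e^{ikφ'³}`, so the phase
`φ'³` becomes reachable (`consistent_cube`). Polarising the cube gives products of three derivatives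
of reachable phases, and addition formulas then climb from frequencies at most `2` to all
frequencies. By density of trigonometric polynomials every continuous phase is reachable
(`PhaseAR.of_continuous`).

Once all phases are available, the same conjugated flow is run for time `k⁶` and its terms `iφ'³`
and `-iαφ'²` are cancelled by explicit phases. What is left is `1 + k⁴ T_{3φ'²} + O(k⁵)`
(`consistent_transp_sq`), with step `h = k⁴` and time `k⁶ = o(h)`. Only squares appear, with
positive coefficients, hence the cone.

The group of `T_f` is constructed explicitly, as composition with the flow of `f` times the square
root of its Jacobian. This formula shows that smooth functions stay in a bounded family for bounded
times, which Chernoff's argument needs, and duality with smooth functions identifies the generator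
with its maximal domain. For translations, `1 = cos² + sin²` lies in the cone. -/

open Real Set Filter Topology MeasureTheory
open scoped ContDiff

noncomputable section

namespace KdVSch

/-! ### Continuous periodic functions in `L²(𝕋)`, multiplication operators and pairings. -/

section

open scoped ComplexConjugate InnerProductSpace ENNReal

/-- The normalised Haar measure of the torus. -/
abbrev haar : Measure Torus := AddCircle.haarAddCircle

/-- Continuous `2π`-periodic functions. -/
def PerCont (g : ℝ → ℂ) : Prop := Continuous g ∧ Function.Periodic g (2 * π)

theorem SmoothPeriodic.perCont {g : ℝ → ℂ} (h : SmoothPeriodic g) : PerCont g :=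
  ⟨h.1.continuous, h.2⟩

namespace PerCont

variable {f g : ℝ → ℂ}

theorem add (hf : PerCont f) (hg : PerCont g) : PerCont (fun x => f x + g x) :=
  ⟨hf.1.add hg.1, fun x => by simp only [hf.2 x, hg.2 x]⟩

theorem mul (hf : PerCont f) (hg : PerCont g) : PerCont (fun x => f x * g x) :=
  ⟨hf.1.mul hg.1, fun x => by simp only [hf.2 x, hg.2 x]⟩

theorem const (c : ℂ) : PerCont (fun _ => c) := ⟨continuous_const, fun _ => rfl⟩

theorem const_mul (c : ℂ) (hf : PerCont f) : PerCont (fun x => c * f x) := (const c).mul hf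

theorem neg (hf : PerCont f) : PerCont (fun x => -f x) :=
  ⟨hf.1.neg, fun x => by simp only [hf.2 x]⟩

theorem sub (hf : PerCont f) (hg : PerCont g) : PerCont (fun x => f x - g x) :=
  ⟨hf.1.sub hg.1, fun x => by simp only [hf.2 x, hg.2 x]⟩

theorem conjugate (hf : PerCont f) : PerCont (fun x => conj (f x)) :=
  ⟨Complex.continuous_conj.comp hf.1, fun x => by simp only [hf.2 x]⟩

end PerCont

open Classical in
/-- The continuous function on the torus defined by a continuous periodic function
(and `0` for any other function). -/
def lift (g : ℝ → ℂ) : C(Torus, ℂ) :=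
  if h : PerCont g then ⟨h.2.lift, h.1.quotient_lift _⟩ else 0

theorem lift_coe {g : ℝ → ℂ} (h : PerCont g) (x : ℝ) : lift g (x : Torus) = g x := by
  rw [lift, dif_pos h]; rfl

theorem ext_lift {a b : C(Torus, ℂ)} (h : ∀ x : ℝ, a (x : Torus) = b (x : Torus)) : a = b := by
  ext x
  obtain ⟨y, rfl⟩ := QuotientAddGroup.mk_surjective x
  exact h y

theorem norm_lift_le {g : ℝ → ℂ} (h : PerCont g) {C : ℝ} (hC : ∀ x, ‖g x‖ ≤ C) : ‖lift g‖ ≤ C := by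
  refine (ContinuousMap.norm_le _ ((norm_nonneg _).trans (hC 0))).2 fun x => ?_
  obtain ⟨y, rfl⟩ := QuotientAddGroup.mk_surjective x
  exact (congrArg norm (lift_coe h y)).trans_le (hC y)

variable {f g a b : ℝ → ℂ}

theorem lift_add (hf : PerCont f) (hg : PerCont g) :
    lift (fun x => f x + g x) = lift f + lift g :=
  ext_lift fun x => by simp [lift_coe, hf, hg, hf.add hg]

theorem lift_sub (hf : PerCont f) (hg : PerCont g) :
    lift (fun x => f x - g x) = lift f - lift g :=
  ext_lift fun x => by simp [lift_coe, hf, hg, hf.sub hg]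

theorem lift_mul (hf : PerCont f) (hg : PerCont g) :
    lift (fun x => f x * g x) = lift f * lift g :=
  ext_lift fun x => by simp [lift_coe, hf, hg, hf.mul hg]

theorem lift_const_mul (c : ℂ) (hf : PerCont f) :
    lift (fun x => c * f x) = c • lift f :=
  ext_lift fun x => by simp [lift_coe, hf, hf.const_mul c]

theorem lift_conj (hf : PerCont f) : lift (fun x => conj (f x)) = star (lift f) :=
  ext_lift fun x => by simp [lift_coe, hf, hf.conjugate]

theorem lift_const (c : ℂ) : lift (fun _ => c) = ContinuousMap.const _ c :=
  ext_lift fun x => by simp [lift_coe, PerCont.const c]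

/-- The class in `L²(𝕋)` of a continuous periodic function. -/
def cl (g : ℝ → ℂ) : L2 := ContinuousMap.toLp 2 haar ℂ (lift g)

theorem coeFn_cl (g : ℝ → ℂ) : cl g =ᵐ[haar] lift g := ContinuousMap.coeFn_toLp haar _

theorem cl_add (hf : PerCont f) (hg : PerCont g) : cl (fun x => f x + g x) = cl f + cl g := by
  rw [cl, lift_add hf hg, map_add, cl, cl]

theorem cl_sub (hf : PerCont f) (hg : PerCont g) : cl (fun x => f x - g x) = cl f - cl g := by
  rw [cl, lift_sub hf hg, map_sub, cl, cl]

theorem cl_const_mul (c : ℂ) (hf : PerCont f) : cl (fun x => c * f x) = c • cl f := by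
  rw [cl, lift_const_mul c hf, map_smul, cl]

theorem cl_neg (hf : PerCont f) : cl (fun x => -f x) = -cl f := by
  have := cl_const_mul (-1) hf
  simpa using this

/-- The constant is one because the measure is normalised. Used with `p = 2` for `cl` and `p = ∞`
for `mulL`. -/
theorem norm_toLp_le (p : ℝ≥0∞) [Fact (1 ≤ p)] (u : C(Torus, ℂ)) :
    ‖ContinuousMap.toLp p haar ℂ u‖ ≤ ‖u‖ := by
  have h := (ContinuousMap.toLp p haar ℂ : C(Torus, ℂ) →L[ℂ] _).le_opNorm u
  refine h.trans ?_
  have h2 := ContinuousMap.toLp_norm_le (α := Torus) (p := p) (μ := haar) (E := ℂ) (𝕜 := ℂ)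
  have h3 : ‖(ContinuousMap.toLp p haar ℂ : C(Torus, ℂ) →L[ℂ] _)‖ ≤ 1 := by
    refine h2.trans ?_
    simp [measureUnivNNReal]
  nlinarith [norm_nonneg u]

theorem norm_cl_le (hg : PerCont g) {C : ℝ} (hC : ∀ x, ‖g x‖ ≤ C) : ‖cl g‖ ≤ C :=
  (norm_toLp_le 2 _).trans (norm_lift_le hg hC)

/-- Multiplication by a continuous periodic function, as a bounded operator of `L²(𝕋)`. -/
def mulL (a : ℝ → ℂ) : L2 →L[ℂ] L2 :=
  (ContinuousLinearMap.mul ℂ ℂ).holderL haar ∞ 2 2 (ContinuousMap.toLp ∞ haar ℂ (lift a))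

theorem coeFn_mulL (a : ℝ → ℂ) (ψ : L2) : mulL a ψ =ᵐ[haar] fun x => lift a x * ψ x := by
  have h1 := (ContinuousLinearMap.mul ℂ ℂ).coeFn_holder (r := 2)
    (ContinuousMap.toLp ∞ haar ℂ (lift a)) ψ
  have h2 := ContinuousMap.coeFn_toLp (p := ∞) (𝕜 := ℂ) haar (lift a)
  filter_upwards [h1, h2] with x hx hx2
  rw [← hx2]
  exact hx

theorem mulL_cl (ha : PerCont a) (hg : PerCont g) : mulL a (cl g) = cl (fun x => a x * g x) := by
  apply Lp.ext
  filter_upwards [coeFn_mulL a (cl g), coeFn_cl g, coeFn_cl (fun x => a x * g x)] with x h1 h2 h3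
  rw [h1, h2, h3, lift_mul ha hg]; rfl

theorem mulL_mulL (ha : PerCont a) (hb : PerCont b) (ψ : L2) :
    mulL a (mulL b ψ) = mulL (fun x => a x * b x) ψ := by
  apply Lp.ext
  filter_upwards [coeFn_mulL a (mulL b ψ), coeFn_mulL b ψ, coeFn_mulL (fun x => a x * b x) ψ]
    with x h1 h2 h3
  rw [h1, h2, h3, lift_mul ha hb, ContinuousMap.mul_apply, mul_assoc]

theorem mulL_one (ψ : L2) : mulL (fun _ => 1) ψ = ψ := by
  apply Lp.ext
  filter_upwards [coeFn_mulL (fun _ => 1) ψ] with x h1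
  rw [h1, lift_const]; simp

theorem mulL_sub (ha : PerCont a) (hb : PerCont b) (ψ : L2) :
    mulL (fun x => a x - b x) ψ = mulL a ψ - mulL b ψ := by
  simp only [mulL, lift_sub ha hb, map_sub, sub_apply]

theorem mulL_const_mul (c : ℂ) (ha : PerCont a) (ψ : L2) :
    mulL (fun x => c * a x) ψ = c • mulL a ψ := by
  simp only [mulL, lift_const_mul c ha, map_smul, smul_apply]

theorem norm_mulL_le (ha : PerCont a) {C : ℝ} (hC : ∀ x, ‖a x‖ ≤ C) (ψ : L2) :
    ‖mulL a ψ‖ ≤ C * ‖ψ‖ := by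
  have h := (ContinuousLinearMap.mul ℂ ℂ).norm_holder_apply_apply_le (r := 2)
    (ContinuousMap.toLp ∞ haar ℂ (lift a)) ψ
  refine h.trans ?_
  gcongr
  refine (mul_le_of_le_one_left (norm_nonneg _)
    (ContinuousLinearMap.opNorm_mul_le ℂ ℂ)).trans ?_
  exact (norm_toLp_le ∞ _).trans (norm_lift_le ha hC)

/-- Multiplication by the conjugate inverts the operator, and both have norm at most one. -/
theorem norm_mulL_of_unimodular (ha : PerCont a) (h1 : ∀ x, ‖a x‖ = 1) (ψ : L2) :
    ‖mulL a ψ‖ = ‖ψ‖ := by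
  apply le_antisymm
  · simpa using norm_mulL_le ha (fun x => (h1 x).le) ψ
  · have h2 : mulL (fun x => conj (a x)) (mulL a ψ) = ψ := by
      rw [mulL_mulL ha.conjugate ha, ← mulL_one ψ]
      congr 2
      · funext x
        rw [← Complex.normSq_eq_conj_mul_self, Complex.normSq_eq_norm_sq, h1]; simp
      · rw [mulL_one]
    calc ‖ψ‖ = ‖mulL (fun x => conj (a x)) (mulL a ψ)‖ := by rw [h2]
      _ ≤ 1 * ‖mulL a ψ‖ := norm_mulL_le ha.conjugate (fun x => by simp [h1 x]) _
      _ = _ := one_mul _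

theorem integral_torus (F : Torus → ℂ) :
    ∫ x in (0)..(2 * π), F (x : Torus) = (2 * π : ℂ) * ∫ y, F y ∂haar := by
  have h := AddCircle.intervalIntegral_preimage (2 * π) 0 F
  rw [zero_add] at h
  rw [h, AddCircle.integral_haarAddCircle, Complex.real_smul]
  have : (π : ℂ) ≠ 0 := by exact_mod_cast Real.pi_ne_zero
  push_cast
  field_simp

/-- The pairing with a test function is bilinear, whereas the inner product is antilinear in its
first slot: hence the conjugate, which recurs in every translation of a weak formulation. -/
theorem pairing_eq (ψ : L2) (hg : PerCont g) :
    ∫ x in (0)..(2 * π), ψ (x : Torus) * g x =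
      (2 * π : ℂ) * ⟪cl (fun x => conj (g x)), ψ⟫_ℂ := by
  have h1 : ∀ x : ℝ, ψ (x : Torus) * g x = (fun y : Torus => ψ y * lift g y) (x : Torus) :=
    fun x => by simp only [lift_coe hg]
  simp_rw [h1]
  rw [integral_torus (fun y : Torus => ψ y * lift g y), L2.inner_def]
  congr 1
  apply integral_congr_ae
  filter_upwards [coeFn_cl (fun x => conj (g x))] with x hx
  rw [hx, lift_conj hg]
  simp

theorem inner_cl_cl (hf : PerCont f) (hg : PerCont g) :
    (2 * π : ℂ) * ⟪cl f, cl g⟫_ℂ = ∫ x in (0)..(2 * π), conj (f x) * g x := by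
  have h1 : ∀ x : ℝ, conj (f x) * g x = (fun y : Torus => conj (lift f y) * lift g y) (x : Torus) :=
    fun x => by simp only [lift_coe hf, lift_coe hg]
  simp_rw [h1]
  rw [integral_torus (fun y : Torus => conj (lift f y) * lift g y), L2.inner_def]
  congr 1
  apply integral_congr_ae
  filter_upwards [coeFn_cl f, coeFn_cl g] with x hx hy
  rw [hx, hy]
  simp [mul_comm]

theorem inner_mulL (ha : PerCont a) (ψ φ : L2) :
    ⟪mulL a ψ, φ⟫_ℂ = ⟪ψ, mulL (fun x => conj (a x)) φ⟫_ℂ := by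
  rw [L2.inner_def, L2.inner_def]
  apply integral_congr_ae
  filter_upwards [coeFn_mulL a ψ, coeFn_mulL (fun x => conj (a x)) φ] with x hx hy
  rw [hx, hy, lift_conj ha]
  simp; ring

/-! ### Smooth periodic functions -/

theorem SmoothPeriodic.add (hf : SmoothPeriodic f) (hg : SmoothPeriodic g) :
    SmoothPeriodic (fun x => f x + g x) := ⟨hf.1.add hg.1, (hf.perCont.add hg.perCont).2⟩

theorem SmoothPeriodic.mul (hf : SmoothPeriodic f) (hg : SmoothPeriodic g) :
    SmoothPeriodic (fun x => f x * g x) := ⟨hf.1.mul hg.1, (hf.perCont.mul hg.perCont).2⟩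

theorem SmoothPeriodic.const {E : Type*} [NormedAddCommGroup E] [NormedSpace ℝ E] (c : E) :
    SmoothPeriodic (fun _ => c) := ⟨contDiff_const, fun _ => rfl⟩

theorem SmoothPeriodic.const_mul (c : ℂ) (hf : SmoothPeriodic f) :
    SmoothPeriodic (fun x => c * f x) := (SmoothPeriodic.const c).mul hf

theorem SmoothPeriodic.ofReal {f : ℝ → ℝ} (hf : SmoothPeriodic f) :
    SmoothPeriodic (fun x => (f x : ℂ)) :=
  ⟨Complex.ofRealCLM.contDiff.comp hf.1, fun x => by simp only [hf.2 x]⟩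

theorem SmoothPeriodic.conjugate (hf : SmoothPeriodic f) : SmoothPeriodic (fun x => conj (f x)) :=
  ⟨Complex.conjCLE.contDiff.comp hf.1, hf.perCont.conjugate.2⟩

theorem SmoothPeriodic.cexp (hf : SmoothPeriodic f) : SmoothPeriodic (fun x => Complex.exp (f x)) :=
  ⟨hf.1.cexp, fun x => by simp only [hf.2 x]⟩

theorem SmoothPeriodic.deriv {E : Type*} [NormedAddCommGroup E] [NormedSpace ℝ E] {f : ℝ → E}
    (hf : SmoothPeriodic f) : SmoothPeriodic (deriv f) := by
  refine ⟨(contDiff_infty_iff_deriv.1 hf.1).2, fun x => ?_⟩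
  rw [← deriv_comp_add_const, show (fun x => f (x + 2 * π)) = f from funext hf.2]

theorem SmoothPeriodic.hasDerivAt {E : Type*} [NormedAddCommGroup E] [NormedSpace ℝ E]
    {f : ℝ → E} (hf : SmoothPeriodic f) (x : ℝ) : HasDerivAt f (_root_.deriv f x) x :=
  ((contDiff_infty_iff_deriv.1 hf.1).1 x).hasDerivAt

theorem inner_deriv (hf : SmoothPeriodic f) (hg : SmoothPeriodic g) :
    ⟪cl (deriv f), cl g⟫_ℂ = -⟪cl f, cl (deriv g)⟫_ℂ := by
  have hpi : (2 * π : ℂ) ≠ 0 := by exact_mod_cast Real.two_pi_pos.ne'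
  apply mul_left_cancel₀ hpi
  rw [mul_neg, inner_cl_cl hf.deriv.perCont hg.perCont, inner_cl_cl hf.perCont hg.deriv.perCont,
    eq_neg_iff_add_eq_zero, ← intervalIntegral.integral_add]
  · have h : ∀ x ∈ uIcc 0 (2 * π), HasDerivAt (fun x => conj (f x) * g x)
        (conj (deriv f x) * g x + conj (f x) * deriv g x) x := fun x _ =>
      (Complex.conjCLE.hasFDerivAt.comp_hasDerivAt x (hf.hasDerivAt x)).mul (hg.hasDerivAt x)
    rw [intervalIntegral.integral_eq_sub_of_hasDerivAt h]
    · have h1 := hf.2 0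
      have h2 := hg.2 0
      rw [zero_add] at h1 h2
      simp [h1, h2]
    · exact ((hf.deriv.conjugate.mul hg).add (hf.conjugate.mul hg.deriv)).1.continuous.intervalIntegrable _ _
  · exact (hf.deriv.conjugate.mul hg).1.continuous.intervalIntegrable _ _
  · exact (hf.conjugate.mul hg.deriv).1.continuous.intervalIntegrable _ _

/-! ### Fourier exponentials and density of smooth functions. -/

/-- The exponential `x ↦ e^{inx}`. -/
def expFun (n : ℤ) (x : ℝ) : ℂ := Complex.exp (Complex.I * n * x)

theorem lift_expFun_aux (n : ℤ) (x : ℝ) : expFun n x = fourier n (x : Torus) := by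
  rw [fourier_coe_apply, expFun]
  congr 1
  have : (π : ℂ) ≠ 0 := by exact_mod_cast Real.pi_ne_zero
  push_cast
  field_simp

theorem smoothPeriodic_expFun (n : ℤ) : SmoothPeriodic (expFun n) := by
  refine ⟨?_, fun x => ?_⟩
  · unfold expFun
    exact (contDiff_const.mul Complex.ofRealCLM.contDiff).cexp
  · rw [lift_expFun_aux, lift_expFun_aux]
    congr 1
    exact AddCircle.coe_add_period (2 * π) x

theorem lift_expFun (n : ℤ) : lift (expFun n) = fourier n :=
  ext_lift fun x => by rw [lift_coe (smoothPeriodic_expFun n).perCont, lift_expFun_aux]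

theorem cl_expFun (n : ℤ) : cl (expFun n) = fourierLp 2 n := by
  rw [cl, lift_expFun]

theorem deriv_expFun (n : ℤ) : deriv (expFun n) = fun x => (Complex.I * n) * expFun n x := by
  funext x
  have h : HasDerivAt (fun x : ℝ => Complex.I * n * (x : ℂ)) (Complex.I * n) x := by
    simpa using (Complex.ofRealCLM.hasDerivAt (x := x)).const_mul (Complex.I * (n : ℂ))
  have := h.cexp.deriv
  unfold expFun
  rw [this, mul_comm]

/-- The subspace of `ℝ → ℂ` of smooth periodic functions. -/
def smoothSubmodule : Submodule ℂ (ℝ → ℂ) where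
  carrier := {f | SmoothPeriodic f}
  add_mem' hf hg := hf.add hg
  zero_mem' := SmoothPeriodic.const 0
  smul_mem' c _ hf := hf.const_mul c

/-- `cl` as a linear map on smooth periodic functions. -/
def clLin : smoothSubmodule →ₗ[ℂ] L2 where
  toFun g := cl g.1
  map_add' f g := cl_add f.2.perCont g.2.perCont
  map_smul' c f := cl_const_mul c f.2.perCont

theorem denseRange_clLin : DenseRange clLin := by
  have h := span_fourierLp_closure_eq_top (T := 2 * π) (p := 2) (by simp)
  have h2 : Submodule.span ℂ (range (fourierLp (T := 2 * π) 2)) ≤ LinearMap.range clLin := by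
    rw [Submodule.span_le]
    rintro _ ⟨n, rfl⟩
    exact ⟨⟨expFun n, smoothPeriodic_expFun n⟩, cl_expFun n⟩
  rw [denseRange_iff_closure_range]
  have h3 := Submodule.topologicalClosure_mono h2
  rw [h, top_le_iff] at h3
  rw [← LinearMap.coe_range, ← Submodule.topologicalClosure_coe, h3]
  rfl

theorem exists_smooth_near (ψ : L2) {ε : ℝ} (hε : 0 < ε) :
    ∃ g, SmoothPeriodic g ∧ ‖ψ - cl g‖ < ε := by
  obtain ⟨g, hg⟩ := denseRange_clLin.exists_dist_lt ψ hε
  exact ⟨g.1, g.2, by rwa [dist_eq_norm] at hg⟩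

/-- An element of `L²` is determined by its pairings with smooth functions. -/
theorem eq_of_inner_smooth {ψ φ : L2} (h : ∀ g, SmoothPeriodic g → ⟪cl g, ψ⟫_ℂ = ⟪cl g, φ⟫_ℂ) :
    ψ = φ := by
  refine ext_inner_left ℂ fun v => ?_
  have hc : (fun v : L2 => ⟪v, ψ⟫_ℂ) = fun v => ⟪v, φ⟫_ℂ :=
    denseRange_clLin.equalizer (by fun_prop) (by fun_prop) (funext fun g => h g.1 g.2)
  exact congrFun hc v

end

section

open scoped ComplexConjugate InnerProductSpace ENNReal

/-! ### The free propagator -/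

/-- The basis vector `e^{inx}` of `L²(𝕋)`. -/
def eb (n : ℤ) : L2 := cl (expFun n)

theorem eb_eq (n : ℤ) : eb n = fourierBasis (T := 2 * π) n := by
  rw [eb, cl_expFun, coe_fourierBasis]

theorem eq_of_coeff {ψ φ : L2} (h : ∀ n, ⟪eb n, ψ⟫_ℂ = ⟪eb n, φ⟫_ℂ) : ψ = φ := by
  apply (fourierBasis (T := 2 * π)).repr.injective
  ext n
  rw [HilbertBasis.repr_apply_apply, HilbertBasis.repr_apply_apply, ← eb_eq, h]

theorem hasSum_norm_sq_coeff (ψ : L2) : HasSum (fun n => ‖⟪eb n, ψ⟫_ℂ‖ ^ 2) (‖ψ‖ ^ 2) := by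
  have h := lp.hasSum_norm (p := 2) (by norm_num) ((fourierBasis (T := 2 * π)).repr ψ)
  simp only [LinearIsometryEquiv.norm_map, HilbertBasis.repr_apply_apply, ← eb_eq] at h
  simpa using h

/-- Parseval. It reduces the estimates on the free propagator to scalar inequalities, one for each
Fourier mode. -/
theorem norm_le_of_coeff_le {ψ φ : L2} {c : ℝ} (hc : 0 ≤ c)
    (h : ∀ n, ‖⟪eb n, ψ⟫_ℂ‖ ≤ c * ‖⟪eb n, φ⟫_ℂ‖) : ‖ψ‖ ≤ c * ‖φ‖ := by
  have h1 := hasSum_norm_sq_coeff ψ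
  have h2 := (hasSum_norm_sq_coeff φ).mul_left (c ^ 2)
  have h3 : ‖ψ‖ ^ 2 ≤ c ^ 2 * ‖φ‖ ^ 2 := hasSum_le (fun n => by
    rw [← mul_pow]; exact pow_le_pow_left₀ (norm_nonneg _) (h n) 2) h1 h2
  rw [← mul_pow] at h3
  exact abs_le_of_sq_le_sq' h3 (by positivity) |>.2

variable (α : ℝ)

/-- The symbol: `-(in)³ + iα (in)² = i (n³ - α n²)`. -/
def symb (n : ℤ) : ℝ := n ^ 3 - α * n ^ 2

/-- The phase `e^{itω}`. -/
def phase (t : ℝ) (n : ℤ) : ℂ := Complex.exp (Complex.I * (t * symb α n : ℝ))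

theorem norm_phase (t : ℝ) (n : ℤ) : ‖phase α t n‖ = 1 := Complex.norm_exp_I_mul_ofReal _

theorem orthonormal_phase (t : ℝ) : Orthonormal ℂ fun n => phase α t n • eb n := by
  have h := (fourierBasis (T := 2 * π)).orthonormal
  refine ⟨fun n => ?_, fun m n hmn => ?_⟩
  · rw [norm_smul, norm_phase, eb_eq, h.1 n, one_mul]
  · beta_reduce
    rw [inner_smul_left, inner_smul_right, eb_eq, eb_eq, h.2 hmn, mul_zero, mul_zero]

theorem span_phase (t : ℝ) :
    ⊤ ≤ (Submodule.span ℂ (range fun n => phase α t n • eb n)).topologicalClosure := by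
  rw [← (fourierBasis (T := 2 * π)).dense_span]
  apply Submodule.topologicalClosure_mono
  rw [Submodule.span_le]
  rintro _ ⟨n, rfl⟩
  have h : phase α t n ≠ 0 := by rw [← norm_ne_zero_iff, norm_phase]; exact one_ne_zero
  have h2 := Submodule.smul_mem (Submodule.span ℂ (range fun n => phase α t n • eb n))
    (phase α t n)⁻¹ (Submodule.subset_span ⟨n, rfl⟩)
  rwa [smul_smul, inv_mul_cancel₀ h, one_smul, eb_eq] at h2

/-- The free propagator `e^{t(-∂ₓ³ + iα∂ₓ²)}`. -/
def prop (t : ℝ) : L2 ≃ₗᵢ[ℂ] L2 :=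
  -- The map carrying the Hilbert basis `eb n` to the Hilbert basis `phase α t n • eb n`: unitarity
  -- is then automatic.
  (fourierBasis (T := 2 * π)).repr.trans
    (HilbertBasis.mk (orthonormal_phase α t) (span_phase α t)).repr.symm

theorem coeff_prop (t : ℝ) (ψ : L2) (n : ℤ) :
    ⟪eb n, prop α t ψ⟫_ℂ = phase α t n * ⟪eb n, ψ⟫_ℂ := by
  set b := HilbertBasis.mk (orthonormal_phase α t) (span_phase α t)
  have h : b.repr (prop α t ψ) n = (fourierBasis (T := 2 * π)).repr ψ n := by
    simp [prop, b]
  rw [HilbertBasis.repr_apply_apply, HilbertBasis.repr_apply_apply, ← eb_eq] at h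
  have h2 : b n = phase α t n • eb n := by simp [b]
  rw [← h, h2, inner_smul_left, ← mul_assoc, Complex.mul_conj, Complex.normSq_eq_norm_sq,
    norm_phase]
  simp

theorem prop_zero (ψ : L2) : prop α 0 ψ = ψ :=
  eq_of_coeff fun n => by rw [coeff_prop]; simp [phase]

theorem prop_add (s t : ℝ) (ψ : L2) : prop α (s + t) ψ = prop α s (prop α t ψ) :=
  eq_of_coeff fun n => by
    rw [coeff_prop, coeff_prop, coeff_prop, ← mul_assoc, phase, phase, phase, ← Complex.exp_add]
    congr 2
    push_cast
    ring

theorem prop_prop_neg (t : ℝ) (ψ : L2) : prop α t (prop α (-t) ψ) = ψ := by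
  rw [← prop_add, add_neg_cancel, prop_zero]

theorem inner_prop (t : ℝ) (ψ φ : L2) : ⟪ψ, prop α t φ⟫_ℂ = ⟪prop α (-t) ψ, φ⟫_ℂ := by
  rw [← LinearIsometryEquiv.inner_map_map (prop α t) (prop α (-t) ψ) φ, prop_prop_neg]

/-- The differential operator `A g = -g''' + iα g''`. -/
def opA (g : ℝ → ℂ) (x : ℝ) : ℂ :=
  -deriv (deriv (deriv g)) x + Complex.I * α * deriv (deriv g) x

variable {f g : ℝ → ℂ}

theorem SmoothPeriodic.opA (hg : SmoothPeriodic g) : SmoothPeriodic (opA α g) := by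
  have h := (hg.deriv.deriv.deriv.const_mul (-1)).add (hg.deriv.deriv.const_mul (Complex.I * α))
  unfold KdVSch.opA
  simpa using h

theorem cl_opA (hg : SmoothPeriodic g) :
    cl (opA α g) = -cl (deriv (deriv (deriv g))) + (Complex.I * α) • cl (deriv (deriv g)) := by
  unfold opA
  rw [cl_add (f := fun x => -deriv (deriv (deriv g)) x) (hg.deriv.deriv.deriv.perCont.neg)
    (hg.deriv.deriv.perCont.const_mul _), cl_const_mul _ hg.deriv.deriv.perCont,
    cl_neg hg.deriv.deriv.deriv.perCont]

theorem coeff_deriv (hg : SmoothPeriodic g) (n : ℤ) :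
    ⟪eb n, cl (deriv g)⟫_ℂ = Complex.I * n * ⟪eb n, cl g⟫_ℂ := by
  have h := inner_deriv (smoothPeriodic_expFun n) hg
  rw [deriv_expFun, cl_const_mul _ (smoothPeriodic_expFun n).perCont, inner_smul_left] at h
  rw [eb, ← neg_eq_iff_eq_neg.2 h]
  simp

theorem coeff_opA (hg : SmoothPeriodic g) (n : ℤ) :
    ⟪eb n, cl (opA α g)⟫_ℂ = Complex.I * symb α n * ⟪eb n, cl g⟫_ℂ := by
  rw [cl_opA α hg, inner_add_right, inner_neg_right, inner_smul_right, coeff_deriv hg.deriv.deriv,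
    coeff_deriv hg.deriv, coeff_deriv hg, symb]
  push_cast
  linear_combination (-(Complex.I * n ^ 3) + Complex.I * α * n ^ 2) * ⟪eb n, cl g⟫_ℂ * Complex.I_sq

theorem norm_prop_sub_le (hg : SmoothPeriodic g) (t : ℝ) :
    ‖prop α t (cl g) - cl g‖ ≤ |t| * ‖cl (opA α g)‖ := by
  refine norm_le_of_coeff_le (abs_nonneg t) fun n => ?_
  rw [inner_sub_right, coeff_prop, coeff_opA α hg, ← sub_one_mul, norm_mul, norm_mul, norm_mul,
    Complex.norm_I, one_mul, ← mul_assoc]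
  gcongr
  have := Real.norm_exp_I_mul_ofReal_sub_one_le (x := t * symb α n)
  rw [phase]
  simpa [abs_mul] using this

/-- Taylor's bound covers `|x| ≤ 1`; beyond, the trivial bound `2|x|` is at most `3x²`. It must hold
for every real `x`, since the symbol is unbounded over the modes. -/
theorem norm_exp_I_sub_one_sub_le (x : ℝ) :
    ‖Complex.exp (Complex.I * x) - 1 - Complex.I * x‖ ≤ 3 * x ^ 2 := by
  rcases le_total |x| 1 with h | h
  · have := Complex.norm_exp_sub_one_sub_id_le (x := Complex.I * x) (by simpa using h)
    refine this.trans ?_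
    simp only [norm_mul, Complex.norm_I, one_mul, Complex.norm_real, Real.norm_eq_abs, sq_abs]
    nlinarith [sq_nonneg x]
  · calc _ ≤ ‖Complex.exp (Complex.I * x) - 1‖ + ‖Complex.I * x‖ := norm_sub_le _ _
      _ ≤ |x| + |x| := by
        gcongr
        · exact Real.norm_exp_I_mul_ofReal_sub_one_le
        · simp
      _ ≤ 3 * x ^ 2 := by rw [← sq_abs x]; nlinarith

theorem norm_prop_sub_sub_le (hg : SmoothPeriodic g) (t : ℝ) :
    ‖prop α t (cl g) - cl g - (t : ℂ) • cl (opA α g)‖ ≤ 3 * t ^ 2 * ‖cl (opA α (opA α g))‖ := by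
  refine norm_le_of_coeff_le (by positivity) fun n => ?_
  rw [inner_sub_right, inner_sub_right, inner_smul_right, coeff_prop, coeff_opA α (hg.opA α),
    coeff_opA α hg]
  have h := norm_exp_I_sub_one_sub_le (t * symb α n)
  calc _ = ‖(phase α t n - 1 - Complex.I * (t * symb α n : ℝ)) * ⟪eb n, cl g⟫_ℂ‖ := by
        congr 1; push_cast; ring
    _ ≤ 3 * (t * symb α n) ^ 2 * ‖⟪eb n, cl g⟫_ℂ‖ := by rw [norm_mul]; gcongr; exact h
    _ = _ := by
      rw [norm_mul, norm_mul, Complex.norm_I, Complex.norm_real, Real.norm_eq_abs, one_mul,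
        norm_mul, norm_mul, Complex.norm_I, Complex.norm_real, Real.norm_eq_abs, one_mul,
        mul_pow, ← sq_abs (symb α n)]
      ring

theorem hasDerivAt_prop (hg : SmoothPeriodic g) (t : ℝ) :
    HasDerivAt (fun t => prop α t (cl g)) (prop α t (cl (opA α g))) t := by
  rw [hasDerivAt_iff_isLittleO]
  have h : (fun s => prop α s (cl g) - prop α t (cl g) - (s - t) • prop α t (cl (opA α g)))
      =O[𝓝 t] fun s => (s - t) ^ 2 := by
    apply Asymptotics.IsBigO.of_bound (3 * ‖cl (opA α (opA α g))‖)
    filter_upwards with s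
    have h1 : prop α s (cl g) - prop α t (cl g) - (s - t) • prop α t (cl (opA α g)) =
        prop α t (prop α (s - t) (cl g) - cl g - ((s - t : ℝ) : ℂ) • cl (opA α g)) := by
      rw [map_sub, map_sub, map_smul, ← prop_add, add_sub_cancel]
      rfl
    rw [h1, LinearIsometryEquiv.norm_map]
    refine (norm_prop_sub_sub_le α hg (s - t)).trans_eq ?_
    simp; ring
  refine h.trans_isLittleO ?_
  have := (Asymptotics.isLittleO_pow_id (𝕜 := ℝ) one_lt_two).comp_tendsto
    (show Tendsto (fun s => s - t) (𝓝 t) (𝓝 0) by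
      have : Tendsto (fun s => s - t) (𝓝 t) (𝓝 (t - t)) :=
        Continuous.tendsto (by fun_prop) t
      simpa using this)
  exact this

/-- An `ε/3` argument: isometries are equicontinuous, so strong continuity may be tested on a dense
set. -/
theorem continuous_of_isometry {V : ℝ → L2 → L2} (hV : ∀ t, Isometry (V t))
    (h : ∀ g, SmoothPeriodic g → Continuous fun t => V t (cl g)) (ψ : L2) :
    Continuous fun t => V t ψ := by
  rw [Metric.continuous_iff]
  intro t ε hε
  obtain ⟨g, hg, hgψ⟩ := exists_smooth_near ψ (show 0 < ε / 3 by positivity)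
  obtain ⟨δ, hδ, h⟩ := Metric.continuousAt_iff.1 (h g hg).continuousAt (ε / 3) (by positivity)
  refine ⟨δ, hδ, fun s hs => ?_⟩
  have h1 := h hs
  have h2 : ∀ r, dist (V r ψ) (V r (cl g)) < ε / 3 := fun r => by
    rwa [(hV r).dist_eq, dist_eq_norm]
  calc _ ≤ dist (V s ψ) (V s (cl g)) + dist (V s (cl g)) (V t (cl g)) +
        dist (V t (cl g)) (V t ψ) := dist_triangle4 _ _ _ _
    _ < ε / 3 + ε / 3 + ε / 3 := by
      have := h2 t
      rw [dist_comm] at this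
      linarith [h2 s]
    _ = ε := by ring

theorem continuous_prop (ψ : L2) : Continuous fun t => prop α t ψ :=
  continuous_of_isometry (V := fun t => prop α t) (fun t => (prop α t).isometry) (fun _ hg =>
    continuous_iff_continuousAt.2 fun t => (hasDerivAt_prop α hg t).continuousAt) ψ

theorem continuous_prop_comp {X : Type*} [TopologicalSpace X] {t : X → ℝ} {ψ : X → L2}
    (ht : Continuous t) (hψ : Continuous ψ) : Continuous fun x => prop α (t x) (ψ x) := by
  rw [continuous_iff_continuousAt]
  intro x
  have h1 : Tendsto (fun y => prop α (t y) (ψ x)) (𝓝 x) (𝓝 (prop α (t x) (ψ x))) :=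
    ((continuous_prop α (ψ x)).comp ht).continuousAt
  have h2 : Tendsto (fun y => prop α (t y) (ψ y) - prop α (t y) (ψ x)) (𝓝 x) (𝓝 0) := by
    rw [tendsto_zero_iff_norm_tendsto_zero]
    simp_rw [← map_sub, LinearIsometryEquiv.norm_map]
    have : Tendsto (fun y => ‖ψ y - ψ x‖) (𝓝 x) (𝓝 ‖ψ x - ψ x‖) :=
      (hψ.continuousAt.sub continuousAt_const).norm
    simpa using this
  have h3 := h2.add h1
  simp only [sub_add_cancel, zero_add] at h3
  exact h3

end

section

open scoped ComplexConjugate InnerProductSpace ENNReal NNReal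

variable {q : ℕ} (α : ℝ) (Q : Fin q → ℝ → ℝ)

/-! ### Implementable maps -/

/-- The right-hand side of the equation at time `s`, tested against `χ`. -/
def weakRHS (u : ℝ → Fin q → ℝ) (ψ : ℝ → L2) (χ : ℝ → ℂ) (s : ℝ) : ℂ :=
  ∫ x in (0)..(2 * π), ψ s (x : Torus) *
    (iteratedDeriv 3 χ x + Complex.I * (α : ℂ) * iteratedDeriv 2 χ x +
      Complex.I * ((∑ j, u s j * Q j x : ℝ) : ℂ) * χ x)

/-- `U` is the solution map, over a time interval of length `T`, for some piecewise constant
control. -/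
def Impl (T : ℝ) (U : L2 → L2) : Prop :=
  ∃ u : ℝ → Fin q → ℝ, IsPWC T u ∧ ∀ ψ₀, ∃ ψ : ℝ → L2, IsSolution α Q T u ψ₀ ψ ∧ ψ T = U ψ₀ ∧
    -- Integrability in time is not part of `IsSolution`. It is carried along because concatenating
    -- two controls splits the time integral.
    ∀ χ, SmoothPeriodic χ → IntervalIntegrable (weakRHS α Q u ψ χ) volume 0 T

theorem IsPWC.nonneg {T : ℝ} {u : ℝ → Fin q → ℝ} (h : IsPWC T u) : 0 ≤ T := by
  obtain ⟨n, τ, c, hm, h0, hn, -⟩ := h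
  rw [← h0, ← hn]
  exact hm (Nat.zero_le n)

theorem IsPWC.concat {T₁ T₂ : ℝ} {u₁ u₂ : ℝ → Fin q → ℝ} (h₁ : IsPWC T₁ u₁) (h₂ : IsPWC T₂ u₂) :
    IsPWC (T₁ + T₂) (fun s => if s ≤ T₁ then u₁ s else u₂ (s - T₁)) := by
  obtain ⟨n, τ, c, hm, h0, hn, h⟩ := h₁
  obtain ⟨m, σ, d, hm', h0', hn', h'⟩ := h₂
  have hσ : ∀ i, 0 ≤ σ i := fun i => h0' ▸ hm' (Nat.zero_le i)
  refine ⟨n + m, fun i => if i ≤ n then τ i else T₁ + σ (i - n),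
    fun i => if i < n then c i else d (i - n), ?_, ?_, ?_, ?_⟩
  · refine monotone_nat_of_le_succ fun i => ?_
    rcases lt_trichotomy i n with hi | hi | hi
    · rw [if_pos hi.le, if_pos (by omega)]
      exact hm (Nat.le_succ i)
    · rw [if_pos hi.le, if_neg (by omega), hi, hn]
      linarith [hσ (n + 1 - n)]
    · rw [if_neg (by omega), if_neg (by omega)]
      have := hm' (show i - n ≤ i + 1 - n by omega)
      linarith
  · simp [h0]
  · rcases Nat.eq_zero_or_pos m with hm0 | hm0
    · subst hm0
      rw [h0'] at hn'
      simp [hn, ← hn']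
    · simp only [show ¬ (n + m ≤ n) by omega, if_false, Nat.add_sub_cancel_left, hn']
  · intro i hi s hs
    rcases lt_or_ge i n with hin | hin
    · simp only [hin.le, Nat.succ_le_of_lt hin, if_true] at hs
      have h1 : s ≤ T₁ := hs.2.le.trans (hn ▸ hm (Nat.succ_le_of_lt hin))
      simp only [h1, hin, if_true]
      exact h i hin s hs
    -- At `i = n` the two formulas for the node agree, since `τ n = T₁` and `σ 0 = 0`.
    · have h2 : (if i ≤ n then τ i else T₁ + σ (i - n)) = T₁ + σ (i - n) := by
        split_ifs with h3
        · obtain rfl : i = n := by omega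
          simp [h0', hn]
        · rfl
      have h4 : i + 1 - n = i - n + 1 := by omega
      simp only [h2, show ¬ (i + 1 ≤ n) by omega, if_false, h4] at hs
      have h5 : ¬ s ≤ T₁ := by have := hs.1; have := hσ (i - n); linarith
      simp only [h5, show ¬ i < n by omega, if_false]
      exact h' (i - n) (by omega) _ ⟨by linarith [hs.1], by linarith [hs.2]⟩

variable {α Q}

theorem Impl.nonneg {T : ℝ} {U : L2 → L2} (h : Impl α Q T U) : 0 ≤ T :=
  let ⟨_, hu, _⟩ := h; hu.nonneg

theorem Impl.comp {T₁ T₂ : ℝ} {U₁ U₂ : L2 → L2} (h₂ : Impl α Q T₂ U₂) (h₁ : Impl α Q T₁ U₁) :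
    Impl α Q (T₁ + T₂) (U₂ ∘ U₁) := by
  have hT₁ := h₁.nonneg
  have hT₂ := h₂.nonneg
  obtain ⟨u₁, hu₁, h₁⟩ := h₁
  obtain ⟨u₂, hu₂, h₂⟩ := h₂
  refine ⟨_, hu₁.concat hu₂, fun ψ₀ => ?_⟩
  obtain ⟨ψ₁, ⟨hc₁, hi₁, hw₁⟩, he₁, hI₁⟩ := h₁ ψ₀
  obtain ⟨ψ₂, ⟨hc₂, hi₂, hw₂⟩, he₂, hI₂⟩ := h₂ (U₁ ψ₀)
  set u : ℝ → Fin q → ℝ := fun s => if s ≤ T₁ then u₁ s else u₂ (s - T₁) with hu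
  set ψ : ℝ → L2 := fun s => if s ≤ T₁ then ψ₁ s else ψ₂ (s - T₁) with hψ
  have hlo : ∀ s, s ≤ T₁ → ψ s = ψ₁ s := fun s hs => if_pos hs
  have hhi : ∀ s, T₁ ≤ s → ψ s = ψ₂ (s - T₁) := fun s hs => by
    rcases hs.eq_or_lt with rfl | hs
    · rw [hlo _ le_rfl, he₁, sub_self, hi₂]
    · exact if_neg hs.not_ge
  have hRlo : ∀ χ, ∀ s, s ≤ T₁ → weakRHS α Q u ψ χ s = weakRHS α Q u₁ ψ₁ χ s := fun χ s hs => by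
    simp only [weakRHS, hlo s hs, hu, hs, if_true]
  have hRhi : ∀ χ, ∀ s, T₁ < s → weakRHS α Q u ψ χ s = weakRHS α Q u₂ ψ₂ χ (s - T₁) :=
    fun χ s hs => by simp only [weakRHS, hhi s hs.le, hu, hs.not_ge, if_false]
  have hIlo : ∀ χ, SmoothPeriodic χ → IntervalIntegrable (weakRHS α Q u ψ χ) volume 0 T₁ :=
    fun χ hχ => (hI₁ χ hχ).congr fun s hs => by
      rw [uIoc_of_le hT₁] at hs
      exact (hRlo χ s hs.2).symm
  have hIhi : ∀ χ, SmoothPeriodic χ →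
      IntervalIntegrable (weakRHS α Q u ψ χ) volume T₁ (T₁ + T₂) := fun χ hχ => by
    have := (hI₂ χ hχ).comp_sub_right T₁
    rw [zero_add, add_comm T₂] at this
    refine this.congr fun s hs => ?_
    rw [uIoc_of_le (by linarith)] at hs
    exact (hRhi χ s hs.1).symm
  refine ⟨ψ, ⟨?_, ?_, fun χ hχ t ht => ?_⟩, ?_, fun χ hχ => (hIlo χ hχ).trans (hIhi χ hχ)⟩
  · have hun : Icc 0 (T₁ + T₂) = Icc 0 T₁ ∪ Icc T₁ (T₁ + T₂) :=
      (Icc_union_Icc_eq_Icc hT₁ (by linarith)).symm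
    rw [hun]
    refine ContinuousOn.union_of_isClosed ?_ ?_ isClosed_Icc isClosed_Icc
    · exact hc₁.congr fun s hs => hlo s hs.2
    · refine ContinuousOn.congr (f := fun s => ψ₂ (s - T₁)) ?_ fun s hs => hhi s hs.1
      refine hc₂.comp (by fun_prop) fun s hs => ?_
      exact ⟨by linarith [hs.1], by linarith [hs.2]⟩
  · rw [hlo 0 hT₁, hi₁]
  · rcases le_or_gt t T₁ with htT | htT
    · rw [hlo t htT, hw₁ χ hχ t ⟨ht.1, htT⟩]
      congr 1
      refine intervalIntegral.integral_congr fun s hs => ?_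
      rw [uIcc_of_le ht.1] at hs
      exact (hRlo χ s (hs.2.trans htT)).symm
    · have hI : IntervalIntegrable (weakRHS α Q u ψ χ) volume T₁ t :=
        (hIhi χ hχ).mono_set (by
          rw [uIcc_of_le htT.le, uIcc_of_le (by linarith)]
          exact Icc_subset_Icc_right ht.2)
      have h3 := hw₂ χ hχ (t - T₁) ⟨by linarith, by linarith [ht.2]⟩
      have h4 := hw₁ χ hχ T₁ ⟨hT₁, le_rfl⟩
      rw [hhi t htT.le, h3, ← he₁, h4, add_assoc]
      congr 1
      change _ = ∫ s in (0)..t, weakRHS α Q u ψ χ s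
      rw [← intervalIntegral.integral_add_adjacent_intervals (hIlo χ hχ) hI]
      congr 1
      · refine intervalIntegral.integral_congr fun s hs => ?_
        rw [uIcc_of_le hT₁] at hs
        exact (hRlo χ s hs.2).symm
      · have h5 : ∫ s in T₁..t, weakRHS α Q u ψ χ s =
            ∫ s in T₁..t, weakRHS α Q u₂ ψ₂ χ (s - T₁) := by
          -- At `s = T₁` the first control is still in force, so the integrands are compared on the
          -- half-open interval only.
          refine intervalIntegral.integral_congr_ae ?_
          refine Eventually.of_forall fun s hs => ?_
          rw [uIoc_of_le htT.le] at hs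
          exact hRhi χ s hs.1
        rw [h5, intervalIntegral.integral_comp_sub_right (fun s => weakRHS α Q u₂ ψ₂ χ s), sub_self]
        rfl
  · rw [hhi _ (by linarith), add_sub_cancel_left, he₂]; rfl

/-! ### Constant controls -/

theorem inner_mulL_skew {a : ℝ → ℂ} (ha : PerCont a) (h : ∀ x, conj (a x) = -a x) (e : L2) :
    ⟪mulL a e, e⟫_ℂ + ⟪e, mulL a e⟫_ℂ = 0 := by
  have h1 : (fun x => conj (a x)) = fun x => (-1) * a x := by funext x; rw [h]; ring
  rw [inner_mulL ha, h1, mulL_const_mul _ ha, inner_smul_right]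
  ring

variable (α) in
/-- The generator in the interaction picture. -/
def intGen (a : ℝ → ℂ) (t : ℝ) : L2 →L[ℂ] L2 :=
  ((prop α (-t)).toContinuousLinearEquiv : L2 →L[ℂ] L2) ∘L mulL a ∘L
    ((prop α t).toContinuousLinearEquiv : L2 →L[ℂ] L2)

theorem intGen_apply (a : ℝ → ℂ) (t : ℝ) (v : L2) :
    intGen α a t v = prop α (-t) (mulL a (prop α t v)) := rfl

theorem norm_intGen_le {a : ℝ → ℂ} (ha : PerCont a) {K : ℝ} (hK : ∀ x, ‖a x‖ ≤ K) (t : ℝ) (v : L2) :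
    ‖intGen α a t v‖ ≤ K * ‖v‖ := by
  rw [intGen_apply, LinearIsometryEquiv.norm_map]
  simpa using norm_mulL_le ha hK (prop α t v)

theorem continuous_intGen (a : ℝ → ℂ) (v : L2) : Continuous fun t => intGen α a t v := by
  simp only [intGen_apply]
  exact continuous_prop_comp α continuous_neg ((mulL a).continuous.comp (continuous_prop α v))

theorem inner_intGen_skew {a : ℝ → ℂ} (ha : PerCont a) (h : ∀ x, conj (a x) = -a x) (t : ℝ)
    (v : L2) : ⟪v, intGen α a t v⟫_ℂ + ⟪intGen α a t v, v⟫_ℂ = 0 := by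
  have h1 := inner_mulL_skew ha h (prop α t v)
  rw [intGen_apply, inner_prop, neg_neg, ← inner_conj_symm (prop α (-t) _) v, inner_prop, neg_neg,
    inner_conj_symm, add_comm]
  exact h1

/-- For `w = e^{-tA} ψ` the unbounded operator disappears: what remains is a linear equation with
bounded, strongly continuous generator, to which Picard-Lindelöf applies. With `K T ≤ 1/2` the
solution, of speed at most `2K‖ψ₀‖`, stays in the ball of radius `‖ψ₀‖` about `ψ₀`. -/
theorem exists_interaction_solution {a : ℝ → ℂ} (ha : PerCont a) {K T : ℝ}
    (hK : ∀ x, ‖a x‖ ≤ K) (hT : 0 ≤ T) (hKT : K * T ≤ 1 / 2) (ψ₀ : L2) :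
    ∃ w : ℝ → L2, w 0 = ψ₀ ∧
      ∀ t ∈ Icc 0 T, HasDerivWithinAt w (intGen α a t (w t)) (Icc 0 T) t := by
  have hK0 : 0 ≤ K := (norm_nonneg _).trans (hK 0)
  have hPL : IsPicardLindelof (fun t v => intGen α a t v) (⟨0, le_rfl, hT⟩ : Icc 0 T) ψ₀
      ‖ψ₀‖₊ 0 (2 * ⟨K, hK0⟩ * ‖ψ₀‖₊) ⟨K, hK0⟩ := by
    refine ⟨fun t _ => ?_, fun v _ => (continuous_intGen a v).continuousOn, fun t _ v hv => ?_, ?_⟩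
    · refine LipschitzWith.lipschitzOnWith (LipschitzWith.of_dist_le_mul fun v w => ?_)
      rw [dist_eq_norm, dist_eq_norm, ← map_sub]
      exact norm_intGen_le ha hK t _
    · refine (norm_intGen_le ha hK t v).trans ?_
      have h1 : ‖v‖ ≤ 2 * ‖ψ₀‖ := by
        have h2 : ‖v - ψ₀‖ ≤ ‖ψ₀‖ := by simpa [dist_eq_norm] using hv
        calc ‖v‖ = ‖(v - ψ₀) + ψ₀‖ := by rw [sub_add_cancel]
          _ ≤ ‖v - ψ₀‖ + ‖ψ₀‖ := norm_add_le _ _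
          _ ≤ _ := by linarith
      calc K * ‖v‖ ≤ K * (2 * ‖ψ₀‖) := by gcongr
        _ = 2 * K * ‖ψ₀‖ := by ring
    · have : max (T - 0) (0 - 0) = T := by simp [hT]
      simp only [this]
      change 2 * K * ‖ψ₀‖ * T ≤ ‖ψ₀‖ - 0
      nlinarith [norm_nonneg ψ₀]
  exact hPL.exists_eq_forall_mem_Icc_hasDerivWithinAt₀

/-- The generator is skew-adjoint, being a unitary conjugate of multiplication by an imaginary
function, so `‖w‖²` has zero derivative. -/
theorem norm_interaction_solution {a : ℝ → ℂ} (ha : PerCont a) (h : ∀ x, conj (a x) = -a x) {T : ℝ}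
    {w : ℝ → L2} (hw : ∀ t ∈ Icc 0 T, HasDerivWithinAt w (intGen α a t (w t)) (Icc 0 T) t) :
    ∀ t ∈ Icc 0 T, ‖w t‖ = ‖w 0‖ := by
  have h1 : ∀ t ∈ Icc 0 T, HasDerivWithinAt (fun t => ⟪w t, w t⟫_ℂ) 0 (Icc 0 T) t := fun t ht => by
    have := (hw t ht).inner ℂ (hw t ht)
    rwa [inner_intGen_skew ha h] at this
  intro t ht
  have h2 := constant_of_has_deriv_right_zero (f := fun t => ⟪w t, w t⟫_ℂ)
    (fun t ht => (h1 t ht).continuousWithinAt)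
    (fun t ht => (h1 t ⟨ht.1, ht.2.le⟩).mono_of_mem_nhdsWithin (Icc_mem_nhdsGE_of_mem ht)) t ht
  rw [inner_self_eq_norm_sq_to_K, inner_self_eq_norm_sq_to_K] at h2
  have h3 : ‖w t‖ ^ 2 = ‖w 0‖ ^ 2 := by exact_mod_cast h2
  exact (pow_left_inj₀ (norm_nonneg _) (norm_nonneg _) two_ne_zero).1 h3

theorem deriv_conj_comp {χ : ℝ → ℂ} (h : SmoothPeriodic χ) :
    deriv (fun x => conj (χ x)) = fun x => conj (deriv χ x) := by
  funext x
  exact (Complex.conjCLE.hasFDerivAt.comp_hasDerivAt x (h.hasDerivAt x)).deriv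

theorem PerCont.ofReal {V : ℝ → ℝ} (hV : Continuous V) (hp : Function.Periodic V (2 * π)) :
    PerCont fun x => (V x : ℂ) :=
  ⟨Complex.continuous_ofReal.comp hV, fun x => by simp only [hp x]⟩

/-- The solution map for a constant control, over a short time interval. -/
theorem exists_impl_const (hQc : ∀ j, Continuous (Q j)) (hQp : ∀ j, Function.Periodic (Q j) (2 * π))
    (c : Fin q → ℝ) {V : ℝ → ℝ} (hV : ∀ x, V x = ∑ j, c j * Q j x) {K T : ℝ} (hK : ∀ x, |V x| ≤ K)
    (hT : 0 ≤ T) (hKT : K * T ≤ 1 / 2) :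
    ∃ U : L2 → L2, Isometry U ∧ Impl α Q T U ∧ ∀ ψ₀, ∃ w : ℝ → L2, w 0 = ψ₀ ∧
      U ψ₀ = prop α T (w T) ∧ ∀ t ∈ Icc 0 T, ‖w t‖ = ‖ψ₀‖ ∧
        HasDerivWithinAt w (intGen α (fun x => Complex.I * V x) t (w t)) (Icc 0 T) t := by
  have hVc : Continuous V := by
    rw [show V = fun x => ∑ j, c j * Q j x from funext hV]
    exact continuous_finsetSum _ fun j _ => continuous_const.mul (hQc j)
  have hVp : Function.Periodic V (2 * π) := fun x => by
    rw [hV, hV]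
    exact Finset.sum_congr rfl fun j _ => by rw [hQp j x]
  have hVr := PerCont.ofReal hVc hVp
  set a : ℝ → ℂ := fun x => Complex.I * V x with ha_def
  have ha : PerCont a := hVr.const_mul _
  have hskew : ∀ x, conj (a x) = -a x := fun x => by simp [a]
  have hKa : ∀ x, ‖a x‖ ≤ K := fun x => by simpa [a] using hK x
  choose w hw0 hw using exists_interaction_solution (α := α) ha hKa hT hKT
  have hTT : T ∈ Icc 0 T := ⟨hT, le_rfl⟩
  refine ⟨fun ψ₀ => prop α T (w ψ₀ T), ?_, ?_, fun ψ₀ => ⟨w ψ₀, hw0 ψ₀, rfl, fun t ht => ⟨?_, hw ψ₀ t ht⟩⟩⟩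
  · refine Isometry.of_dist_eq fun ψ φ => ?_
    rw [LinearIsometryEquiv.dist_map, dist_eq_norm, dist_eq_norm]
    -- The equation is linear: a difference of solutions is a solution, and conservation of its norm
    -- says that the solution map is an isometry.
    have h1 : ∀ t ∈ Icc 0 T, HasDerivWithinAt (w ψ - w φ) (intGen α a t ((w ψ - w φ) t))
        (Icc 0 T) t := fun t ht => by
      rw [Pi.sub_apply, map_sub]
      exact (hw ψ t ht).sub (hw φ t ht)
    have h2 := norm_interaction_solution ha hskew h1 T hTT
    rwa [Pi.sub_apply, Pi.sub_apply, hw0, hw0] at h2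
  · refine ⟨fun _ => c, ⟨1, fun i => if i = 0 then 0 else T, fun _ => c, ?_, rfl, rfl,
      fun _ _ _ _ => rfl⟩, fun ψ₀ => ?_⟩
    · refine monotone_nat_of_le_succ fun i => ?_
      rcases Nat.eq_zero_or_pos i with rfl | hi
      · simpa using hT
      · simp [hi.ne']
    set ψ : ℝ → L2 := fun t => prop α t (w ψ₀ t) with hψ
    have hwc : ContinuousOn (w ψ₀) (Icc 0 T) := fun t ht => (hw ψ₀ t ht).continuousWithinAt
    have hψc : ContinuousOn ψ (Icc 0 T) := by
      rw [continuousOn_iff_continuous_domRestrict]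
      exact continuous_prop_comp α continuous_subtype_val
        (continuousOn_iff_continuous_domRestrict.1 hwc)
    -- The right-hand side in terms of inner products, with `A` moved to the test function; its sign
    -- changes because `A` is skew-symmetric.
    have hR : ∀ χ, SmoothPeriodic χ → ∀ s, weakRHS α Q (fun _ => c) ψ χ s = (2 * π : ℂ) *
        (-⟪cl (opA α (fun x => conj (χ x))), ψ s⟫_ℂ +
          ⟪cl (fun x => conj (χ x)), mulL a (ψ s)⟫_ℂ) := fun χ hχ s => by
      have h3 : iteratedDeriv 3 χ = deriv (deriv (deriv χ)) := by
        simp [iteratedDeriv_succ]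
      have h2 : iteratedDeriv 2 χ = deriv (deriv χ) := by
        simp [iteratedDeriv_succ]
      have hg : PerCont (fun x => deriv (deriv (deriv χ)) x + Complex.I * α * deriv (deriv χ) x +
          a x * χ x) := (hχ.deriv.deriv.deriv.perCont.add (hχ.deriv.deriv.perCont.const_mul _)).add
            (ha.mul hχ.perCont)
      have e1 : weakRHS α Q (fun _ => c) ψ χ s = ∫ x in (0)..(2 * π), ψ s (x : Torus) *
          (deriv (deriv (deriv χ)) x + Complex.I * α * deriv (deriv χ) x + a x * χ x) := by
        simp only [weakRHS, h3, h2, ← hV, a]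
      rw [e1, pairing_eq _ hg]
      congr 1
      have e2 : (fun x => conj (deriv (deriv (deriv χ)) x + Complex.I * α * deriv (deriv χ) x +
          a x * χ x)) = fun x => (-1) * opA α (fun x => conj (χ x)) x +
            conj (a x) * conj (χ x) := by
        funext x
        rw [opA, deriv_conj_comp hχ, deriv_conj_comp hχ.deriv, deriv_conj_comp hχ.deriv.deriv]
        simp [add_comm]
      rw [e2, cl_add ((hχ.conjugate.opA α).perCont.const_mul _)
          (ha.conjugate.mul hχ.conjugate.perCont),
        cl_const_mul _ (hχ.conjugate.opA α).perCont, inner_add_left, inner_smul_left,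
        ← mulL_cl ha.conjugate hχ.conjugate.perCont, inner_mulL ha.conjugate]
      simp
    have hRc : ∀ χ, SmoothPeriodic χ → ContinuousOn (weakRHS α Q (fun _ => c) ψ χ) (Icc 0 T) :=
      fun χ hχ => by
      rw [show weakRHS α Q (fun _ => c) ψ χ = _ from funext (hR χ hχ)]
      fun_prop
    refine ⟨ψ, ⟨hψc, ?_, fun χ hχ t ht => ?_⟩, rfl, fun χ hχ => ?_⟩
    · simp only [hψ, prop_zero, hw0]
    · set η : ℝ → ℂ := fun x => conj (χ x) with hη_def
      have hη : SmoothPeriodic η := hχ.conjugate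
      -- Since `ψ s` need not lie in the domain of `A`, the propagator is moved onto the smooth test
      -- function, where it can be differentiated.
      have hd : ∀ s ∈ Icc 0 T, HasDerivWithinAt (fun s => (2 * π : ℂ) * ⟪cl η, ψ s⟫_ℂ)
          (weakRHS α Q (fun _ => c) ψ χ s) (Icc 0 T) s := fun s hs => by
        have h1 : HasDerivAt (fun s => prop α (-s) (cl η)) (-prop α (-s) (cl (opA α η))) s := by
          have := (hasDerivAt_prop α hη (-s)).scomp s (hasDerivAt_neg s)
          simpa [Function.comp_def] using this
        have h2 := (h1.hasDerivWithinAt.inner ℂ (hw ψ₀ s hs)).const_mul (2 * π : ℂ)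
        have h3 : (fun s => (2 * π : ℂ) * ⟪cl η, ψ s⟫_ℂ) =
            fun s => (2 * π : ℂ) * ⟪prop α (-s) (cl η), w ψ₀ s⟫_ℂ := by
          funext r; rw [hψ]; simp only [inner_prop]
        rw [h3]
        refine h2.congr_deriv ?_
        rw [hR χ hχ s, intGen_apply, inner_prop, neg_neg, prop_prop_neg, inner_neg_left,
          ← inner_prop, add_comm]
      have hsub : Icc 0 t ⊆ Icc 0 T := Icc_subset_Icc_right ht.2
      have hF := intervalIntegral.integral_eq_sub_of_hasDeriv_right_of_le ht.1
        (f := fun s => (2 * π : ℂ) * ⟪cl η, ψ s⟫_ℂ) (f' := weakRHS α Q (fun _ => c) ψ χ)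
        (fun s hs => ((hd s (hsub hs)).continuousWithinAt).mono hsub)
        (fun s hs => (hd s (hsub ⟨hs.1.le, hs.2.le⟩)).mono_of_mem_nhdsWithin
          (mem_of_superset (Ioc_mem_nhdsGT hs.2) fun r hr =>
            ⟨hs.1.le.trans hr.1.le, hr.2.trans ht.2⟩))
        ((hRc χ hχ).mono (by rw [uIcc_of_le ht.1]; exact hsub)).intervalIntegrable
      change _ = _ + ∫ s in (0)..t, weakRHS α Q (fun _ => c) ψ χ s
      rw [hF, pairing_eq _ hχ.perCont, pairing_eq _ hχ.perCont]
      simp only [hψ, prop_zero, hw0, η]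
      ring
    · exact ((hRc χ hχ).mono (by rw [uIcc_of_le hT])).intervalIntegrable
  · rw [norm_interaction_solution ha hskew (hw ψ₀) t ht, hw0]

end

section

open scoped ComplexConjugate InnerProductSpace ENNReal NNReal

variable {q : ℕ} {α : ℝ} {Q : Fin q → ℝ → ℝ}

/-! ### Approximately reachable isometries -/

variable (α Q) in
/-- `F` is an isometry that is approximately reachable in times at most `T`. -/
def AR (T : ℝ) (F : L2 → L2) : Prop :=
  -- The approximation is strong: `U` may depend on `ψ` and `ε`. That `U` is an isometry is recorded
  -- so that errors are not amplified under composition.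
  Isometry F ∧ ∀ ψ, ∀ ε > 0, ∃ T' ≤ T + ε, ∃ U, Isometry U ∧ Impl α Q T' U ∧ ‖U ψ - F ψ‖ < ε

theorem Isometry.norm_sub_eq {F : L2 → L2} (h : Isometry F) (ψ φ : L2) : ‖F ψ - F φ‖ = ‖ψ - φ‖ := by
  rw [← dist_eq_norm, h.dist_eq, dist_eq_norm]

theorem AR.mono {S T : ℝ} {F : L2 → L2} (h : AR α Q S F) (hST : S ≤ T) : AR α Q T F :=
  ⟨h.1, fun ψ ε hε => let ⟨T', hT', H⟩ := h.2 ψ ε hε; ⟨T', by linarith, H⟩⟩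

theorem AR.comp {S T : ℝ} {F G : L2 → L2} (hF : AR α Q S F) (hG : AR α Q T G) :
    AR α Q (S + T) (F ∘ G) := by
  refine ⟨hF.1.comp hG.1, fun ψ ε hε => ?_⟩
  obtain ⟨T₁, hT₁, U₁, hi₁, hU₁, h₁⟩ := hG.2 ψ (ε / 2) (by positivity)
  obtain ⟨T₂, hT₂, U₂, hi₂, hU₂, h₂⟩ := hF.2 (G ψ) (ε / 2) (by positivity)
  refine ⟨T₁ + T₂, by linarith, U₂ ∘ U₁, hi₂.comp hi₁, hU₂.comp hU₁, ?_⟩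
  calc ‖U₂ (U₁ ψ) - F (G ψ)‖ ≤ ‖U₂ (U₁ ψ) - U₂ (G ψ)‖ + ‖U₂ (G ψ) - F (G ψ)‖ :=
        norm_sub_le_norm_sub_add_norm_sub _ _ _
    _ < ε / 2 + ε / 2 := by rw [Isometry.norm_sub_eq hi₂]; exact add_lt_add h₁ h₂
    _ = ε := by ring

theorem AR.comp_zero {F G : L2 → L2} (hF : AR α Q 0 F) (hG : AR α Q 0 G) :
    AR α Q 0 (F ∘ G) := by simpa using hF.comp hG

theorem AR.iterate_succ {T : ℝ} {F : L2 → L2} (hF : AR α Q T F) (n : ℕ) :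
    AR α Q ((n + 1) * T) (F^[n + 1]) := by
  induction n with
  | zero => simpa using hF
  | succ n ih =>
    rw [Function.iterate_succ']
    refine (hF.comp ih).mono (le_of_eq ?_)
    push_cast
    ring

/-- As all maps are isometries, approximation on the dense set of smooth functions suffices; the
time budget may also be exceeded by `ε`. -/
theorem AR.of_limit {T : ℝ} {S : L2 → L2} (hS : Isometry S)
    (h : ∀ g, SmoothPeriodic g → ∀ ε > 0, ∃ F, AR α Q (T + ε) F ∧ ‖F (cl g) - S (cl g)‖ ≤ ε) :
    AR α Q T S := by
  refine ⟨hS, fun ψ ε hε => ?_⟩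
  obtain ⟨g, hg, hgψ⟩ := exists_smooth_near ψ (show 0 < ε / 4 by positivity)
  obtain ⟨F, hF, hFS⟩ := h g hg (ε / 4) (by positivity)
  obtain ⟨T', hT', U, hi, hU, hUF⟩ := hF.2 (cl g) (ε / 4) (by positivity)
  refine ⟨T', by linarith, U, hi, hU, ?_⟩
  have h1 := Isometry.norm_sub_eq hi ψ (cl g)
  have h2 := Isometry.norm_sub_eq hS ψ (cl g)
  have e : U ψ - S ψ = (U ψ - U (cl g)) + (U (cl g) - F (cl g)) + (F (cl g) - S (cl g)) -
      (S ψ - S (cl g)) := by abel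
  have h3 := norm_sub_le ((U ψ - U (cl g)) + (U (cl g) - F (cl g)) + (F (cl g) - S (cl g)))
      (S ψ - S (cl g))
  have h4 := norm_add₃_le (a := U ψ - U (cl g)) (b := U (cl g) - F (cl g)) (c := F (cl g) - S (cl g))
  rw [e]
  linarith

theorem AR.of_impl {T : ℝ} {U : L2 → L2} (hi : Isometry U) (hU : Impl α Q T U) : AR α Q T U :=
  ⟨hi, fun ψ ε hε => ⟨T, by linarith, U, hi, hU, by simpa using hε⟩⟩

/-! ### Bounded families of smooth functions -/

/-- `g` is smooth and periodic, with derivatives bounded by the sequence `C`. -/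
def Bd (C : ℕ → ℝ) (g : ℝ → ℂ) : Prop :=
  SmoothPeriodic g ∧ ∀ k x, ‖iteratedDeriv k g x‖ ≤ C k

theorem Bd.norm_le {C : ℕ → ℝ} {g : ℝ → ℂ} (h : Bd C g) (x : ℝ) : ‖g x‖ ≤ C 0 := by
  simpa using h.2 0 x

theorem Bd.nonneg {C : ℕ → ℝ} {g : ℝ → ℂ} (h : Bd C g) (k : ℕ) : 0 ≤ C k :=
  (norm_nonneg _).trans (h.2 k 0)

theorem Bd.norm_cl_le {C : ℕ → ℝ} {g : ℝ → ℂ} (h : Bd C g) : ‖cl g‖ ≤ C 0 :=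
  KdVSch.norm_cl_le h.1.perCont h.norm_le

theorem exists_bound_of_periodic {E : Type*} [NormedAddCommGroup E] {g : ℝ → E} (hg : Continuous g)
    (hp : Function.Periodic g (2 * π)) : ∃ C, ∀ x, ‖g x‖ ≤ C := by
  obtain ⟨C, hC⟩ := isCompact_Icc.exists_bound_of_continuousOn (s := Icc (0 : ℝ) (2 * π))
    hg.continuousOn
  refine ⟨C, fun x => ?_⟩
  obtain ⟨y, hy, hxy⟩ := hp.exists_mem_Ico₀ Real.two_pi_pos x
  rw [hxy]
  exact hC y ⟨hy.1, hy.2.le⟩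

theorem SmoothPeriodic.iteratedDeriv {E : Type*} [NormedAddCommGroup E] [NormedSpace ℝ E]
    {g : ℝ → E} (h : SmoothPeriodic g) (k : ℕ) : SmoothPeriodic (iteratedDeriv k g) := by
  induction k with
  | zero => simpa using h
  | succ k ih => rw [iteratedDeriv_succ]; exact ih.deriv

theorem SmoothPeriodic.exists_bd {g : ℝ → ℂ} (h : SmoothPeriodic g) : ∃ C, Bd C g := by
  choose C hC using fun k => exists_bound_of_periodic (h.iteratedDeriv k).1.continuous
    (h.iteratedDeriv k).2
  exact ⟨C, h, hC⟩

theorem contDiffAt_nat {g : ℝ → ℂ} (h : ContDiff ℝ ∞ g) (k : ℕ) (x : ℝ) : ContDiffAt ℝ k g x :=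
  (h.of_le (by exact_mod_cast le_top)).contDiffAt

theorem Bd.add {C D : ℕ → ℝ} {f g : ℝ → ℂ} (hf : Bd C f) (hg : Bd D g) :
    Bd (fun k => C k + D k) (fun x => f x + g x) := by
  refine ⟨hf.1.add hg.1, fun k x => ?_⟩
  rw [iteratedDeriv_fun_add (contDiffAt_nat hf.1.1 k x) (contDiffAt_nat hg.1.1 k x)]
  exact norm_add_le_of_le (hf.2 k x) (hg.2 k x)

theorem Bd.mul {C D : ℕ → ℝ} {f g : ℝ → ℂ} (hf : Bd C f) (hg : Bd D g) :
    Bd (fun k => ∑ i ∈ Finset.range (k + 1), k.choose i * C i * D (k - i))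
      (fun x => f x * g x) := by
  refine ⟨hf.1.mul hg.1, fun k x => ?_⟩
  rw [iteratedDeriv_fun_mul (contDiffAt_nat hf.1.1 k x) (contDiffAt_nat hg.1.1 k x)]
  refine (norm_sum_le _ _).trans (Finset.sum_le_sum fun i _ => ?_)
  rw [norm_mul, norm_mul, Complex.norm_natCast]
  have := hf.nonneg i
  gcongr
  · exact hf.2 i x
  · exact hg.2 _ x

theorem Bd.deriv {C : ℕ → ℝ} {g : ℝ → ℂ} (h : Bd C g) : Bd (fun k => C (k + 1)) (deriv g) :=
  ⟨h.1.deriv, fun k x => by rw [← iteratedDeriv_succ']; exact h.2 (k + 1) x⟩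

theorem Bd.const_mul {C : ℕ → ℝ} {g : ℝ → ℂ} (h : Bd C g) {c : ℂ} {M : ℝ} (hc : ‖c‖ ≤ M) :
    Bd (fun k => M * C k) (fun x => c * g x) := by
  refine ⟨h.1.const_mul c, fun k x => ?_⟩
  rw [iteratedDeriv_const_mul_field c g, norm_mul]
  exact mul_le_mul hc (h.2 k x) (norm_nonneg _) ((norm_nonneg c).trans hc)

/-- A family of operators is uniformly bounded on bounded families of smooth functions. -/
def UB {ι : Type*} (T : ι → (ℝ → ℂ) → ℝ → ℂ) : Prop :=
  ∀ C, ∃ C', ∀ i g, Bd C g → Bd C' (T i g)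

namespace UB

variable {ι : Type*} {S T : ι → (ℝ → ℂ) → ℝ → ℂ}

theorem id : UB (fun (_ : ι) g => g) := fun C => ⟨C, fun _ _ h => h⟩

theorem deriv : UB (fun (_ : ι) g => deriv g) := fun _ => ⟨_, fun _ _ h => h.deriv⟩

theorem comp (hS : UB S) (hT : UB T) : UB (fun i g => S i (T i g)) := fun C =>
  let ⟨C', h'⟩ := hT C
  let ⟨C'', h''⟩ := hS C'
  ⟨C'', fun i g hg => h'' i _ (h' i g hg)⟩

theorem add (hS : UB S) (hT : UB T) : UB (fun i g x => S i g x + T i g x) := fun C =>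
  let ⟨_, h'⟩ := hS C
  let ⟨_, h''⟩ := hT C
  ⟨_, fun i g hg => (h' i g hg).add (h'' i g hg)⟩

theorem mul (hS : UB S) {a : ℝ → ℂ} (ha : SmoothPeriodic a) : UB (fun i g x => a x * S i g x) :=
  fun C =>
  let ⟨_, h'⟩ := hS C
  let ⟨_, h''⟩ := ha.exists_bd
  ⟨_, fun i g hg => h''.mul (h' i g hg)⟩

theorem const_mul (hS : UB S) {c : ι → ℂ} {M : ℝ} (hc : ∀ i, ‖c i‖ ≤ M) :
    UB (fun i g x => c i * S i g x) := fun C =>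
  let ⟨_, h'⟩ := hS C
  ⟨_, fun i g hg => (h' i g hg).const_mul (hc i)⟩

theorem fixed_const_mul (hS : UB S) (c : ℂ) : UB (fun i g x => c * S i g x) :=
  hS.const_mul (c := fun _ => c) fun _ => le_rfl

end UB

theorem ub_opA (α : ℝ) {ι : Type*} : UB (fun (_ : ι) g => opA α g) := by
  have h := ((UB.deriv.comp (UB.deriv.comp (UB.deriv (ι := ι)))).fixed_const_mul (-1)).add
    ((UB.deriv.comp (UB.deriv (ι := ι))).fixed_const_mul (Complex.I * α))
  intro C
  obtain ⟨C', hC'⟩ := h C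
  refine ⟨C', fun i g hg => ?_⟩
  have e : opA α g = fun x => -1 * deriv (deriv (deriv g)) x +
      Complex.I * α * deriv (deriv g) x := by
    funext x; rw [opA, neg_one_mul]
  beta_reduce
  rw [e]
  exact hC' i g hg

/-- Multiplication by `e^{isθ}`, on functions. -/
def expI (θ : ℝ → ℝ) (s : ℝ) (x : ℝ) : ℂ := Complex.exp (Complex.I * (s * θ x : ℝ))

theorem norm_expI (θ : ℝ → ℝ) (s x : ℝ) : ‖expI θ s x‖ = 1 := Complex.norm_exp_I_mul_ofReal _

theorem smoothPeriodic_expI {θ : ℝ → ℝ} (hθ : SmoothPeriodic θ) (s : ℝ) :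
    SmoothPeriodic (expI θ s) := by
  have h := ((hθ.ofReal.const_mul s).const_mul Complex.I).cexp
  unfold expI
  simpa using h

theorem perCont_expI {θ : ℝ → ℝ} (hθ : Continuous θ) (hp : Function.Periodic θ (2 * π)) (s : ℝ) :
    PerCont (expI θ s) := by
  unfold expI
  exact ⟨by fun_prop, fun x => by simp only [hp x]⟩

theorem hasDerivAt_expI {θ : ℝ → ℝ} (hθ : SmoothPeriodic θ) (s x : ℝ) :
    HasDerivAt (expI θ s) (expI θ s x * (Complex.I * s * (deriv θ x : ℝ))) x := by
  have h := (((hθ.hasDerivAt x).const_mul s).ofReal_comp.const_mul Complex.I).cexp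
  refine h.congr_deriv ?_
  rw [expI]
  push_cast
  ring

/-- The conjugated derivative `e^{-isθ} ∂ₓ e^{isθ} = ∂ₓ + isθ'`. -/
def conjDeriv (θ : ℝ → ℝ) (s : ℝ) (g : ℝ → ℂ) (x : ℝ) : ℂ :=
  deriv g x + s * (Complex.I * (deriv θ x : ℝ) * g x)

theorem SmoothPeriodic.conjDeriv {θ : ℝ → ℝ} (hθ : SmoothPeriodic θ) (s : ℝ) {g : ℝ → ℂ}
    (hg : SmoothPeriodic g) : SmoothPeriodic (conjDeriv θ s g) :=
  hg.deriv.add (((hθ.deriv.ofReal.const_mul Complex.I).mul hg).const_mul _)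

theorem deriv_expI_mul {θ : ℝ → ℝ} (hθ : SmoothPeriodic θ) (s : ℝ) {g : ℝ → ℂ}
    (hg : SmoothPeriodic g) :
    deriv (fun x => expI θ s x * g x) = fun x => expI θ s x * conjDeriv θ s g x := by
  funext x
  rw [((hasDerivAt_expI hθ s x).fun_mul (hg.hasDerivAt x)).deriv, conjDeriv]
  ring

/-- Each derivative of `e^{itθ} g` is `e^{itθ}` times `conjDeriv θ t g`, and the exponential has
modulus one. The induction on the order of the derivative replaces `g` by another bounded family, so
the bounds `C` must stay quantified. -/
theorem ub_expI {θ : ℝ → ℝ} (hθ : SmoothPeriodic θ) (R : ℝ) :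
    UB (fun (t : Icc (-R) R) g x => expI θ t x * g x) := by
  have hD : UB (fun (t : Icc (-R) R) g => conjDeriv θ t g) := by
    refine UB.deriv.add ((UB.id.mul (hθ.deriv.ofReal.const_mul Complex.I)).const_mul
      (c := fun t : Icc (-R) R => (t.1 : ℂ)) (M := R) fun t => ?_)
    rw [Complex.norm_real]
    exact abs_le.2 t.2
  have key : ∀ k C, ∃ M, ∀ (t : Icc (-R) R) g, Bd C g → ∀ x,
      ‖iteratedDeriv k (fun x => expI θ t x * g x) x‖ ≤ M := by
    intro k
    induction k with
    | zero => exact fun C => ⟨C 0, fun t g hg x => by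
        simpa [norm_expI] using hg.norm_le x⟩
    | succ k ih =>
      intro C
      obtain ⟨C', hC'⟩ := hD C
      obtain ⟨M, hM⟩ := ih C'
      refine ⟨M, fun t g hg x => ?_⟩
      rw [iteratedDeriv_succ', deriv_expI_mul hθ _ hg.1]
      exact hM t _ (hC' t g hg) x
  intro C
  choose M hM using fun k => key k C
  exact ⟨M, fun t g hg => ⟨(smoothPeriodic_expI hθ _).mul hg.1, fun k x => hM k t g hg x⟩⟩

/-! ### Consistency and convergence -/

/-- An operator on smooth functions which is linear and bounded on bounded families. -/
structure SmoothOp (L : (ℝ → ℂ) → ℝ → ℂ) : Prop where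
  ub : UB (fun _ : Unit => L)
  lin : ∀ f g (c : ℂ), SmoothPeriodic f → SmoothPeriodic g →
    L (fun x => f x + c * g x) = fun x => L f x + c * L g x

variable (α Q) in
/-- The operator `L` is the derivative at `h = 0` of approximately reachable isometries, uniformly
on bounded families of smooth functions; the reaching times are `o(h)`. -/
def Consistent (L : (ℝ → ℂ) → ℝ → ℂ) : Prop :=
  -- A single `η` controls both the time and the error: each accumulates over about `T / h` steps to
  -- a total of order `ηT`.
  ∀ C, ∀ η > 0, ∀ᶠ h in 𝓝[>] (0 : ℝ), ∃ F, AR α Q (η * h) F ∧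
    ∀ g, Bd C g → ‖F (cl g) - cl g - (h : ℂ) • cl (L g)‖ ≤ η * h

theorem eventually_small (C : ℝ) {η : ℝ} (hη : 0 < η) :
    ∀ᶠ h in 𝓝[>] (0 : ℝ), 0 < h ∧ h ≤ 1 ∧ C * h ≤ η := by
  have h1 : Tendsto (fun h : ℝ => C * h) (𝓝 0) (𝓝 (C * 0)) := Continuous.tendsto (by fun_prop) 0
  rw [mul_zero] at h1
  have h2 : ∀ᶠ h in 𝓝[>] (0 : ℝ), C * h ≤ η := (h1.eventually_le_const hη).filter_mono nhdsWithin_le_nhds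
  have h3 : ∀ᶠ h in 𝓝[>] (0 : ℝ), h ≤ 1 :=
    (eventually_le_nhds zero_lt_one).filter_mono nhdsWithin_le_nhds
  filter_upwards [self_mem_nhdsWithin, h2, h3] with h a b c using ⟨a, c, b⟩

/-- The isometry for the sum is `F₁ ∘ F₂`. Consistency of `F₁` is used at `g + h L₂ g`, which ranges
over one bounded family because `h ≤ 1`; the cross term `h² L₁ L₂ g` is absorbed in the error. -/
theorem Consistent.add {L₁ L₂ : (ℝ → ℂ) → ℝ → ℂ} (o₁ : SmoothOp L₁) (o₂ : SmoothOp L₂)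
    (h₁ : Consistent α Q L₁) (h₂ : Consistent α Q L₂) :
    Consistent α Q (fun g x => L₁ g x + L₂ g x) := by
  intro C η hη
  obtain ⟨C₂, hC₂⟩ := o₂.ub C
  obtain ⟨C₁₂, hC₁₂⟩ := o₁.ub C₂
  have hη3 : 0 < η / 3 := by positivity
  filter_upwards [h₁ (fun k => C k + 1 * C₂ k) (η / 3) hη3, h₂ C (η / 3) hη3,
    eventually_small (C₁₂ 0) hη3] with h ⟨F₁, hF₁, e₁⟩ ⟨F₂, hF₂, e₂⟩ ⟨h0, h1, hs⟩
  refine ⟨F₁ ∘ F₂, (hF₁.comp hF₂).mono (by nlinarith), fun g hg => ?_⟩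
  have b₂ : Bd C₂ (L₂ g) := hC₂ () g hg
  have b₁₂ : Bd C₁₂ (L₁ (L₂ g)) := hC₁₂ () _ b₂
  have s₁ : SmoothPeriodic (L₁ g) := by
    obtain ⟨C₁, hC₁⟩ := o₁.ub C
    exact (hC₁ () g hg).1
  have bg : Bd (fun k => C k + 1 * C₂ k) (fun x => g x + (h : ℂ) * L₂ g x) :=
    hg.add (b₂.const_mul (by rw [Complex.norm_real, Real.norm_eq_abs, abs_of_pos h0]; exact h1))
  have E₁ := e₁ _ bg
  have E₂ := e₂ g hg
  rw [o₁.lin g (L₂ g) h hg.1 b₂.1, cl_add hg.1.perCont (b₂.1.perCont.const_mul _),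
    cl_const_mul _ b₂.1.perCont, cl_add s₁.perCont (b₁₂.1.perCont.const_mul _),
    cl_const_mul _ b₁₂.1.perCont] at E₁
  rw [cl_add s₁.perCont b₂.1.perCont, Function.comp_apply]
  have E₃ := Isometry.norm_sub_eq hF₁.1 (F₂ (cl g)) (cl g + (h : ℂ) • cl (L₂ g))
  rw [sub_add_eq_sub_sub] at E₃
  have E₄ : ‖((h : ℂ) * h) • cl (L₁ (L₂ g))‖ ≤ η / 3 * h := by
    rw [norm_smul, norm_mul, Complex.norm_real, Real.norm_eq_abs, abs_of_pos h0]
    have := b₁₂.norm_cl_le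
    nlinarith [norm_nonneg (cl (L₁ (L₂ g)))]
  set X := F₁ (cl g + (h : ℂ) • cl (L₂ g))
  have e : F₁ (F₂ (cl g)) - cl g - (h : ℂ) • (cl (L₁ g) + cl (L₂ g)) =
      (F₁ (F₂ (cl g)) - X) + (X - (cl g + (h : ℂ) • cl (L₂ g)) -
        (h : ℂ) • (cl (L₁ g) + (h : ℂ) • cl (L₁ (L₂ g)))) + ((h : ℂ) * h) • cl (L₁ (L₂ g)) := by
    simp only [smul_add, mul_smul]
    abel
  rw [e]
  refine (norm_add₃_le).trans ?_
  linarith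

/-- A group of isometries whose generator is the limit of approximately reachable isometries
consists of approximately reachable isometries (a form of the Lax-Chernoff theorem). -/
theorem Consistent.ar {L : (ℝ → ℂ) → ℝ → ℂ} (hL : Consistent α Q L) {V : ℝ → L2 → L2}
    (hV0 : ∀ ψ, V 0 ψ = ψ) (hVadd : ∀ s t ψ, V (s + t) ψ = V s (V t ψ)) (hVi : ∀ t, Isometry (V t))
    (hVL : ∀ C, ∀ η > 0, ∀ᶠ h in 𝓝[>] (0 : ℝ), ∀ g, Bd C g →
      ‖V h (cl g) - cl g - (h : ℂ) • cl (L g)‖ ≤ η * h)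
    (hVS : ∀ g, SmoothPeriodic g → ∀ T, ∃ C, ∀ t ∈ Icc 0 T, ∃ g', Bd C g' ∧ V t (cl g) = cl g')
    {T : ℝ} (hT : 0 < T) : AR α Q 0 (V T) := by
  refine AR.of_limit (hVi T) fun g hg ε hε => ?_
  obtain ⟨C, hC⟩ := hVS g hg T
  -- Each of the `n + 1` steps of length `h` costs `ηh` for `F` and `ηh` for `V`, in total `2ηT =
  -- ε`; the reaching times add up to `ηT = ε / 2`.
  set η := ε / (2 * T) with hη_def
  have hη : 0 < η := by positivity
  have hn : Tendsto (fun n : ℕ => T / ((n : ℝ) + 1)) atTop (𝓝[>] 0) := by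
    refine tendsto_nhdsWithin_iff.2 ⟨?_, Eventually.of_forall fun n => by
      have : (0 : ℝ) < n + 1 := by positivity
      exact div_pos hT this⟩
    have := (tendsto_one_div_add_atTop_nhds_zero_nat (𝕜 := ℝ)).const_mul T
    simpa [div_eq_mul_inv] using this
  obtain ⟨n, ⟨F, hF, e₁⟩, e₂⟩ := (hn.eventually ((hL C η hη).and (hVL C η hη))).exists
  set h := T / ((n : ℝ) + 1) with hh
  have hpos : (0 : ℝ) < n + 1 := by positivity
  have h0 : 0 < h := div_pos hT hpos
  have hnh : (n + 1) * h = T := by rw [hh]; field_simp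
  refine ⟨F^[n + 1], (hF.iterate_succ n).mono ?_, ?_⟩
  · calc ((n : ℝ) + 1) * (η * h) = η * ((n + 1) * h) := by ring
      _ = ε / 2 := by rw [hnh, hη_def]; field_simp
      _ ≤ 0 + ε := by linarith
  -- Telescoping: `F` propagates the old error without growth, and the new error is made at a point
  -- of the exact orbit, which stays in the one bounded family `C`. That is where uniform
  -- consistency is needed.
  · have key : ∀ k : ℕ, k ≤ n + 1 → ‖F^[k] (cl g) - V (k * h) (cl g)‖ ≤ k * (2 * η * h) := by
      intro k
      induction k with
      | zero => intro _; simp [hV0]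
      | succ k ih =>
        intro hk
        have ih := ih (by omega)
        have hkn : (k : ℝ) ≤ n + 1 := by exact_mod_cast (by omega : k ≤ n + 1)
        obtain ⟨g', hg', hVg'⟩ := hC (k * h) ⟨by positivity, by rw [← hnh]; gcongr⟩
        have E₁ := e₁ g' hg'
        have E₂ := e₂ g' hg'
        rw [Function.iterate_succ_apply', show ((k + 1 : ℕ) : ℝ) * h = h + k * h by push_cast; ring,
          hVadd, hVg']
        rw [hVg', ← Isometry.norm_sub_eq hF.1] at ih
        have e : F (F^[k] (cl g)) - V h (cl g') = (F (F^[k] (cl g)) - F (cl g')) +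
            (F (cl g') - cl g' - (h : ℂ) • cl (L g')) -
            (V h (cl g') - cl g' - (h : ℂ) • cl (L g')) := by abel
        rw [e]
        have h3 := norm_sub_le ((F (F^[k] (cl g)) - F (cl g')) +
            (F (cl g') - cl g' - (h : ℂ) • cl (L g'))) (V h (cl g') - cl g' - (h : ℂ) • cl (L g'))
        have h4 := norm_add_le (F (F^[k] (cl g)) - F (cl g'))
          (F (cl g') - cl g' - (h : ℂ) • cl (L g'))
        push_cast
        linarith
    have := key (n + 1) le_rfl
    push_cast at this
    rw [hnh] at this
    calc _ ≤ ((n : ℝ) + 1) * (2 * η * h) := this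
      _ = 2 * η * ((n + 1) * h) := by ring
      _ = ε := by rw [hnh, hη_def]; field_simp

/-! ### Multiplication operators -/

/-- Multiplication by `iθ`, on functions. -/
def mulI (θ : ℝ → ℝ) (g : ℝ → ℂ) (x : ℝ) : ℂ := Complex.I * θ x * g x

theorem SmoothPeriodic.mulI {θ : ℝ → ℝ} (hθ : SmoothPeriodic θ) {g : ℝ → ℂ}
    (hg : SmoothPeriodic g) : SmoothPeriodic (mulI θ g) :=
  (hθ.ofReal.const_mul Complex.I).mul hg

theorem ub_mulI {θ : ℝ → ℝ} (hθ : SmoothPeriodic θ) {ι : Type*} : UB (fun (_ : ι) g => mulI θ g) :=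
  UB.id.mul (hθ.ofReal.const_mul Complex.I)

theorem expI_zero (θ : ℝ → ℝ) : expI θ 0 = fun _ => 1 := by
  funext x; simp [expI]

theorem expI_mul_expI (θ : ℝ → ℝ) (s t x : ℝ) : expI θ s x * expI θ t x = expI θ (s + t) x := by
  rw [expI, expI, expI, ← Complex.exp_add]
  congr 1
  push_cast
  ring

theorem isometry_mulL_expI {θ : ℝ → ℝ} (hθ : Continuous θ) (hp : Function.Periodic θ (2 * π))
    (s : ℝ) : Isometry (mulL (expI θ s)) :=
  AddMonoidHomClass.isometry_of_norm _
    (norm_mulL_of_unimodular (perCont_expI hθ hp s) (norm_expI θ s))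

theorem norm_expI_taylor_le (θ : ℝ → ℝ) {M : ℝ} (hM : ∀ x, |θ x| ≤ M) (h : ℝ) (x : ℝ) :
    ‖expI θ h x - 1 - Complex.I * (h * θ x : ℝ)‖ ≤ 3 * (h ^ 2 * M ^ 2) := by
  refine (norm_exp_I_sub_one_sub_le _).trans ?_
  rw [mul_pow, ← sq_abs (θ x)]
  have := hM x
  gcongr

theorem norm_mulL_expI_taylor_le {θ : ℝ → ℝ} (hθ : SmoothPeriodic θ) {M : ℝ}
    (hM : ∀ x, |θ x| ≤ M) (h : ℝ) {C : ℕ → ℝ} {g : ℝ → ℂ} (hg : Bd C g) :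
    ‖mulL (expI θ h) (cl g) - cl g - (h : ℂ) • cl (mulI θ g)‖ ≤ 3 * (h ^ 2 * M ^ 2) * C 0 := by
  have he := (smoothPeriodic_expI hθ h).perCont
  have hm := (hθ.mulI hg.1).perCont
  rw [mulL_cl he hg.1.perCont, ← cl_sub (he.mul hg.1.perCont) hg.1.perCont, ← cl_const_mul _ hm,
    ← cl_sub ((he.mul hg.1.perCont).sub hg.1.perCont) (hm.const_mul _)]
  refine norm_cl_le (((he.mul hg.1.perCont).sub hg.1.perCont).sub (hm.const_mul _)) fun x => ?_
  have e : expI θ h x * g x - g x - (h : ℂ) * mulI θ g x =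
      (expI θ h x - 1 - Complex.I * (h * θ x : ℝ)) * g x := by
    rw [mulI]; push_cast; ring
  rw [e, norm_mul]
  exact mul_le_mul (norm_expI_taylor_le θ hM h x) (hg.norm_le x) (norm_nonneg _) (by positivity)

theorem Consistent.ar_expI {θ : ℝ → ℝ} (hθ : SmoothPeriodic θ) (h : Consistent α Q (mulI θ))
    {T : ℝ} (hT : 0 < T) : AR α Q 0 (mulL (expI θ T)) := by
  obtain ⟨M, hM⟩ := exists_bound_of_periodic hθ.1.continuous hθ.2
  refine h.ar (V := fun t => mulL (expI θ t)) (fun ψ => ?_) (fun s t ψ => ?_)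
    (isometry_mulL_expI hθ.1.continuous hθ.2) (fun C η hη => ?_) (fun g hg T => ?_) hT
  · rw [expI_zero, mulL_one]
  · rw [mulL_mulL (smoothPeriodic_expI hθ s).perCont (smoothPeriodic_expI hθ t).perCont]
    simp only [expI_mul_expI]
  · filter_upwards [eventually_small (3 * M ^ 2 * C 0) hη] with h ⟨h0, h1, hs⟩ g hg
    refine (norm_mulL_expI_taylor_le hθ hM h hg).trans ?_
    nlinarith
  · obtain ⟨C, hC⟩ := hg.exists_bd
    obtain ⟨C', hC'⟩ := ub_expI hθ T C
    refine ⟨C', fun t ht => ⟨_, hC' ⟨t, ⟨by linarith [ht.1, ht.2], ht.2⟩⟩ g hC, ?_⟩⟩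
    exact mulL_cl (smoothPeriodic_expI hθ t).perCont hg.perCont

/-! ### Short pulses of large controls -/

variable (Q) in
/-- The standing assumptions on the control profiles. -/
structure Admissible : Prop where
  cont : ∀ j, Continuous (Q j)
  per : ∀ j, Function.Periodic (Q j) (2 * π)

/-- With zero control the interaction solution is constant; as `K = 0`, the time is unrestricted. -/
theorem ar_prop (hQ : Admissible Q) {τ : ℝ} (hτ : 0 ≤ τ) : AR α Q τ (prop α τ) := by
  obtain ⟨U, hi, hU, hw⟩ := exists_impl_const (α := α) hQ.cont hQ.per 0 (V := fun _ => 0) (K := 0)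
    (by simp) (by simp) hτ (by simp)
  convert AR.of_impl hi hU using 1
  funext ψ
  obtain ⟨w, hw0, hwU, hw⟩ := hw ψ
  have h1 : ‖w τ - w 0‖ ≤ 0 * ‖τ - 0‖ :=
    (convex_Icc 0 τ).norm_image_sub_le_of_norm_hasDerivWithin_le
      (fun t ht => (hw t ht).2) (fun t ht => by
        have := norm_intGen_le (α := α) (a := fun _ => Complex.I * ((0 : ℝ) : ℂ))
          (PerCont.const _) (K := 0) (by simp) t (w t)
        simpa using this) ⟨le_rfl, hτ⟩ ⟨hτ, le_rfl⟩
  rw [zero_mul] at h1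
  rw [hwU, ← hw0, sub_eq_zero.1 (norm_le_zero_iff.1 h1)]

theorem ar_id (hQ : Admissible Q) : AR α Q 0 id := by
  convert ar_prop (α := α) hQ le_rfl using 1
  funext ψ
  rw [prop_zero]; rfl

/-- On smooth functions the interaction generator may be frozen at time zero, with an error linear
in `s`. -/
theorem norm_intGen_sub_le {m g : ℝ → ℂ} (hm : SmoothPeriodic m) (hg : SmoothPeriodic g) {M : ℝ}
    (hM : ∀ x, ‖m x‖ ≤ M) {s : ℝ} (hs : 0 ≤ s) :
    ‖intGen α m s (cl g) - cl (fun x => m x * g x)‖ ≤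
      s * (M * ‖cl (opA α g)‖ + ‖cl (opA α (fun x => m x * g x))‖) := by
  have h1 := norm_prop_sub_le α hg s
  have h2 := norm_prop_sub_le α (hm.mul hg) s
  rw [abs_of_nonneg hs] at h1 h2
  have h3 := norm_mulL_le hm.perCont hM (prop α s (cl g) - cl g)
  have hM0 : 0 ≤ M := (norm_nonneg _).trans (hM 0)
  rw [map_sub, mulL_cl hm.perCont hg.perCont] at h3
  rw [intGen_apply, ← (prop α s).norm_map, map_sub, prop_prop_neg]
  calc _ ≤ ‖mulL m (prop α s (cl g)) - cl (fun x => m x * g x)‖ +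
        ‖cl (fun x => m x * g x) - prop α s (cl (fun x => m x * g x))‖ :=
        norm_sub_le_norm_sub_add_norm_sub _ _ _
    _ ≤ M * (s * ‖cl (opA α g)‖) + s * ‖cl (opA α (fun x => m x * g x))‖ := by
        rw [norm_sub_rev (cl (fun x => m x * g x))]
        gcongr
        exact h3.trans (by gcongr)
    _ = _ := by ring

/-- A pulse of size `1/h` and duration `h²` has area `h`, whereas the free evolution acts for time
`h²` only. In the interaction picture `w` moves by `O(h)` and the generator is `h⁻¹` times a frozen
operator up to `O(h)`, so the total error is `O(h²)`. -/
theorem consistent_mulI_of_span (hQ : Admissible Q) {θ : ℝ → ℝ} (hθ : SmoothPeriodic θ)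
    {c : Fin q → ℝ} (hc : ∀ x, θ x = ∑ j, c j * Q j x) : Consistent α Q (mulI θ) := by
  obtain ⟨M, hM⟩ := exists_bound_of_periodic hθ.1.continuous hθ.2
  have hM0 : 0 ≤ M := (norm_nonneg _).trans (hM 0)
  set m : ℝ → ℂ := fun x => Complex.I * θ x with hm_def
  have hm : SmoothPeriodic m := hθ.ofReal.const_mul _
  have hmM : ∀ x, ‖m x‖ ≤ M := fun x => by simpa [m] using hM x
  intro C η hη
  obtain ⟨C₁, hC₁⟩ := ub_opA α (ι := Unit) C
  obtain ⟨C₂, hC₂⟩ := ub_mulI hθ (ι := Unit) C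
  obtain ⟨C₃, hC₃⟩ := ub_opA α (ι := Unit) C₂
  filter_upwards [eventually_small 1 hη, eventually_small M one_half_pos,
    eventually_small (M * (M * C 0) + (M * C₁ 0 + C₃ 0) + (C₁ 0 + C₃ 0)) hη]
    with h ⟨h0, h1, hs⟩ ⟨_, _, hs2⟩ ⟨_, _, hs3⟩
  obtain ⟨U, hi, hU, hw⟩ := exists_impl_const (α := α) hQ.cont hQ.per (fun j => h⁻¹ * c j)
    (V := fun x => h⁻¹ * θ x) (K := h⁻¹ * M) (T := h ^ 2)
    (fun x => by rw [hc, Finset.mul_sum]; exact Finset.sum_congr rfl fun j _ => by ring)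
    (fun x => by rw [abs_mul, abs_of_pos (inv_pos.2 h0)]; gcongr; exact hM x) (by positivity)
    (by calc h⁻¹ * M * h ^ 2 = M * h := by field_simp
          _ ≤ 1 / 2 := hs2)
  refine ⟨U, (AR.of_impl hi hU).mono (by nlinarith), fun g hg => ?_⟩
  obtain ⟨w, hw0, hwU, hw⟩ := hw (cl g)
  have hmg : SmoothPeriodic (mulI θ g) := hθ.mulI hg.1
  have hτ : (0 : ℝ) ≤ h ^ 2 := by positivity
  have hgen : ∀ s v, intGen α (fun x => Complex.I * ((h⁻¹ * θ x : ℝ) : ℂ)) s v =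
      ((h⁻¹ : ℝ) : ℂ) • intGen α m s v := fun s v => by
    have e : (fun x => Complex.I * ((h⁻¹ * θ x : ℝ) : ℂ)) = fun x => ((h⁻¹ : ℝ) : ℂ) * m x := by
      funext x; simp only [m]; push_cast; ring
    rw [intGen_apply, intGen_apply, e, mulL_const_mul _ hm.perCont, map_smul]
  have n0 := hg.norm_cl_le
  have n1 : ‖cl (opA α g)‖ ≤ C₁ 0 := (hC₁ () g hg).norm_cl_le
  have n3 : ‖cl (opA α (mulI θ g))‖ ≤ C₃ 0 := (hC₃ () _ (hC₂ () g hg)).norm_cl_le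
  have hh : ‖((h⁻¹ : ℝ) : ℂ)‖ = h⁻¹ := by
    rw [Complex.norm_real, Real.norm_eq_abs, abs_of_pos (inv_pos.2 h0)]
  have d1 : ∀ s ∈ Icc 0 (h ^ 2), ‖w s - cl g‖ ≤ h * (M * C 0) := fun s hs => by
    have := (convex_Icc 0 (h ^ 2)).norm_image_sub_le_of_norm_hasDerivWithin_le
      (fun t ht => (hw t ht).2) (C := h⁻¹ * (M * C 0)) (fun t ht => by
        rw [hgen, norm_smul, hh]
        gcongr
        refine (norm_intGen_le hm.perCont hmM t (w t)).trans ?_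
        rw [(hw t ht).1]
        gcongr) ⟨le_rfl, hτ⟩ hs
    rw [hw0, sub_zero, Real.norm_eq_abs, abs_of_nonneg hs.1] at this
    have hC0 := hg.nonneg 0
    calc _ ≤ h⁻¹ * (M * C 0) * s := this
      _ ≤ h⁻¹ * (M * C 0) * h ^ 2 := by gcongr; exact hs.2
      _ = _ := by field_simp
  have d2 : ∀ s ∈ Icc 0 (h ^ 2), ‖intGen α m s (w s) - cl (mulI θ g)‖ ≤
      h * (M * (M * C 0) + (M * C₁ 0 + C₃ 0)) := fun s hs => by
    have a1 := norm_intGen_le (α := α) hm.perCont hmM s (w s - cl g)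
    rw [map_sub] at a1
    have a2 := norm_intGen_sub_le (α := α) hm hg.1 hmM hs.1
    have a3 : s ≤ h := hs.2.trans (by nlinarith)
    have a4 : s * (M * ‖cl (opA α g)‖ + ‖cl (opA α (fun x => m x * g x))‖) ≤
        h * (M * C₁ 0 + C₃ 0) := by
      gcongr
      exact n3
    calc _ ≤ ‖intGen α m s (w s) - intGen α m s (cl g)‖ + ‖intGen α m s (cl g) - cl (mulI θ g)‖ :=
          norm_sub_le_norm_sub_add_norm_sub _ _ _
      _ ≤ M * (h * (M * C 0)) + h * (M * C₁ 0 + C₃ 0) := by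
          refine add_le_add (a1.trans ?_) (a2.trans a4)
          gcongr
          exact d1 s hs
      _ = _ := by ring
  -- Mean value inequality after subtracting the linear motion: speed of the remainder `h⁻¹ · O(h)`,
  -- duration `h²`.
  have d3 : ‖w (h ^ 2) - cl g - (h : ℂ) • cl (mulI θ g)‖ ≤
      h ^ 2 * (M * (M * C 0) + (M * C₁ 0 + C₃ 0)) := by
    have := (convex_Icc 0 (h ^ 2)).norm_image_sub_le_of_norm_hasDerivWithin_le
      (f := fun t => w t - (t : ℝ) • (((h⁻¹ : ℝ) : ℂ) • cl (mulI θ g)))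
      (f' := fun t => ((h⁻¹ : ℝ) : ℂ) • (intGen α m t (w t) - cl (mulI θ g)))
      (C := h⁻¹ * (h * (M * (M * C 0) + (M * C₁ 0 + C₃ 0)))) (fun t ht => by
        have b := (hw t ht).2.sub ((hasDerivAt_id t).smul_const
          (((h⁻¹ : ℝ) : ℂ) • cl (mulI θ g))).hasDerivWithinAt
        rw [hgen] at b
        refine b.congr_deriv ?_
        rw [one_smul, smul_sub]) (fun t ht => by
        rw [norm_smul, hh]
        gcongr
        exact d2 t ht) ⟨le_rfl, hτ⟩ ⟨hτ, le_rfl⟩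
    rw [hw0, zero_smul, sub_zero, sub_zero, Real.norm_eq_abs, abs_of_nonneg hτ, sub_right_comm,
      RCLike.real_smul_eq_coe_smul (K := ℂ) (h ^ 2), smul_smul] at this
    have e : ((h ^ 2 : ℝ) : ℂ) * ((h⁻¹ : ℝ) : ℂ) = (h : ℂ) := by
      rw [← Complex.ofReal_mul]; congr 1; field_simp
    change ‖_ - _ - (((h ^ 2 : ℝ) : ℂ) * ((h⁻¹ : ℝ) : ℂ)) • _‖ ≤ _ at this
    rw [e] at this
    refine this.trans_eq ?_
    field_simp
  -- Leaving the interaction picture costs one more free evolution of duration `h²`.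
  have d4 : ‖prop α (h ^ 2) (cl g + (h : ℂ) • cl (mulI θ g)) - (cl g + (h : ℂ) • cl (mulI θ g))‖ ≤
      h ^ 2 * (C₁ 0 + C₃ 0) := by
    have b1 := norm_prop_sub_le α hg.1 (h ^ 2)
    have b2 := norm_prop_sub_le α hmg (h ^ 2)
    rw [abs_of_nonneg hτ] at b1 b2
    have e : prop α (h ^ 2) (cl g + (h : ℂ) • cl (mulI θ g)) - (cl g + (h : ℂ) • cl (mulI θ g)) =
        (prop α (h ^ 2) (cl g) - cl g) +
          (h : ℂ) • (prop α (h ^ 2) (cl (mulI θ g)) - cl (mulI θ g)) := by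
      rw [map_add, map_smul, smul_sub]; abel
    rw [e]
    refine (norm_add_le _ _).trans ?_
    rw [norm_smul, Complex.norm_real, Real.norm_eq_abs, abs_of_pos h0]
    calc _ ≤ h ^ 2 * ‖cl (opA α g)‖ + 1 * (h ^ 2 * ‖cl (opA α (mulI θ g))‖) := by gcongr
      _ ≤ h ^ 2 * C₁ 0 + 1 * (h ^ 2 * C₃ 0) := by gcongr
      _ = _ := by ring
  have e : U (cl g) - cl g - (h : ℂ) • cl (mulI θ g) =
      prop α (h ^ 2) (w (h ^ 2) - cl g - (h : ℂ) • cl (mulI θ g)) +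
      (prop α (h ^ 2) (cl g + (h : ℂ) • cl (mulI θ g)) - (cl g + (h : ℂ) • cl (mulI θ g))) := by
    rw [hwU, map_sub, map_sub, map_add]; abel
  rw [e]
  refine (norm_add_le _ _).trans ?_
  rw [LinearIsometryEquiv.norm_map]
  nlinarith

end

section

open scoped ComplexConjugate InnerProductSpace ENNReal NNReal

variable {q : ℕ} {α : ℝ} {Q : Fin q → ℝ → ℝ}

/-! ### Conjugation of the free propagator by phases -/

variable (α) in
/-- The operator `e^{-isφ} A e^{isφ}`. -/
def conjOpA (φ : ℝ → ℝ) (s : ℝ) (g : ℝ → ℂ) (x : ℝ) : ℂ :=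
  -conjDeriv φ s (conjDeriv φ s (conjDeriv φ s g)) x +
    Complex.I * α * conjDeriv φ s (conjDeriv φ s g) x

theorem SmoothPeriodic.conjOpA {φ : ℝ → ℝ} (hφ : SmoothPeriodic φ) (s : ℝ) {g : ℝ → ℂ}
    (hg : SmoothPeriodic g) : SmoothPeriodic (conjOpA α φ s g) := by
  have h2 := hφ.conjDeriv s (hφ.conjDeriv s hg)
  have h := ((hφ.conjDeriv s h2).const_mul (-1)).add (h2.const_mul (Complex.I * α))
  unfold KdVSch.conjOpA
  simpa using h

theorem opA_expI_mul {φ : ℝ → ℝ} (hφ : SmoothPeriodic φ) (s : ℝ) {g : ℝ → ℂ}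
    (hg : SmoothPeriodic g) :
    opA α (fun x => expI φ s x * g x) = fun x => expI φ s x * conjOpA α φ s g x := by
  funext x
  rw [opA, deriv_expI_mul hφ s hg, deriv_expI_mul hφ s (hφ.conjDeriv s hg),
    deriv_expI_mul hφ s (hφ.conjDeriv s (hφ.conjDeriv s hg)), conjOpA]
  ring

variable (α) in
/-- The conjugated propagator `e^{-isφ} e^{τA} e^{isφ}`. -/
def conjProp (φ : ℝ → ℝ) (s τ : ℝ) : L2 →L[ℂ] L2 :=
  mulL (expI φ (-s)) ∘L ((prop α τ).toContinuousLinearEquiv : L2 →L[ℂ] L2) ∘L mulL (expI φ s)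

theorem conjProp_apply (φ : ℝ → ℝ) (s τ : ℝ) (ψ : L2) :
    conjProp α φ s τ ψ = mulL (expI φ (-s)) (prop α τ (mulL (expI φ s) ψ)) := rfl

theorem mulL_expI_mulL_expI_neg {φ : ℝ → ℝ} (hφ : SmoothPeriodic φ) (s : ℝ) (ψ : L2) :
    mulL (expI φ s) (mulL (expI φ (-s)) ψ) = ψ := by
  rw [mulL_mulL (smoothPeriodic_expI hφ s).perCont (smoothPeriodic_expI hφ (-s)).perCont]
  simp only [expI_mul_expI, add_neg_cancel, expI_zero, mulL_one]

theorem norm_conjProp {φ : ℝ → ℝ} (hφ : SmoothPeriodic φ) (s τ : ℝ) (ψ : L2) :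
    ‖conjProp α φ s τ ψ‖ = ‖ψ‖ := by
  rw [conjProp_apply, norm_mulL_of_unimodular (smoothPeriodic_expI hφ _).perCont (norm_expI φ _),
    LinearIsometryEquiv.norm_map,
    norm_mulL_of_unimodular (smoothPeriodic_expI hφ _).perCont (norm_expI φ _)]

/-- Multiplying back by the unimodular `e^{isφ}` turns the claim into the Taylor estimate for the
free propagator at `e^{isφ} g`. -/
theorem norm_conjProp_sub_sub_le {φ : ℝ → ℝ} (hφ : SmoothPeriodic φ) (s τ : ℝ) {g : ℝ → ℂ}
    (hg : SmoothPeriodic g) {M : ℝ} (hM : ∀ x, ‖conjOpA α φ s (conjOpA α φ s g) x‖ ≤ M) :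
    ‖conjProp α φ s τ (cl g) - cl g - (τ : ℂ) • cl (conjOpA α φ s g)‖ ≤ 3 * τ ^ 2 * M := by
  have he := smoothPeriodic_expI hφ s
  have hA := hφ.conjOpA (α := α) s hg
  rw [← norm_mulL_of_unimodular he.perCont (norm_expI φ s), map_sub, map_sub, map_smul,
    conjProp_apply, mulL_expI_mulL_expI_neg hφ, mulL_cl he.perCont hg.perCont,
    mulL_cl he.perCont hA.perCont, ← opA_expI_mul hφ s hg]
  refine (norm_prop_sub_sub_le α (he.mul hg) τ).trans ?_
  gcongr
  rw [opA_expI_mul hφ s hg, opA_expI_mul hφ s hA]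
  refine norm_cl_le (he.mul (hφ.conjOpA s hA)).perCont fun x => ?_
  rw [norm_mul, norm_expI, one_mul]
  exact hM x

/-- The operator `k e^{-iφ/k} ∂ₓ e^{iφ/k} = k ∂ₓ + iφ'`. -/
def scDeriv (φ : ℝ → ℝ) (k : ℝ) (g : ℝ → ℂ) (x : ℝ) : ℂ :=
  k * deriv g x + Complex.I * (deriv φ x : ℝ) * g x

variable (α) in
/-- The operator `k³ e^{-iφ/k} A e^{iφ/k}`. -/
def scOpA (φ : ℝ → ℝ) (k : ℝ) (g : ℝ → ℂ) (x : ℝ) : ℂ :=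
  -1 * scDeriv φ k (scDeriv φ k (scDeriv φ k g)) x +
    Complex.I * α * (k * scDeriv φ k (scDeriv φ k g) x)

theorem norm_coe_Ioc (k : Ioc (0 : ℝ) 1) : ‖((k : ℝ) : ℂ)‖ ≤ 1 := by
  rw [Complex.norm_real, Real.norm_eq_abs, abs_of_pos k.2.1]
  exact k.2.2

theorem ub_scDeriv {φ : ℝ → ℝ} (hφ : SmoothPeriodic φ) :
    UB (fun (k : Ioc (0 : ℝ) 1) g => scDeriv φ k g) :=
  (UB.deriv.const_mul (c := fun k : Ioc (0 : ℝ) 1 => ((k : ℝ) : ℂ)) norm_coe_Ioc).add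
    (UB.id.mul (hφ.deriv.ofReal.const_mul Complex.I))

theorem ub_scOpA {φ : ℝ → ℝ} (hφ : SmoothPeriodic φ) :
    UB (fun (k : Ioc (0 : ℝ) 1) g => scOpA α φ k g) := by
  have h2 := (ub_scDeriv hφ).comp (ub_scDeriv hφ)
  exact (((ub_scDeriv hφ).comp h2).fixed_const_mul (-1)).add
    ((h2.const_mul (c := fun k : Ioc (0 : ℝ) 1 => ((k : ℝ) : ℂ)) norm_coe_Ioc).fixed_const_mul
      (Complex.I * α))

theorem SmoothPeriodic.scDeriv {φ : ℝ → ℝ} (hφ : SmoothPeriodic φ) (k : ℝ) {g : ℝ → ℂ}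
    (hg : SmoothPeriodic g) : SmoothPeriodic (scDeriv φ k g) :=
  (hg.deriv.const_mul _).add ((hφ.deriv.ofReal.const_mul Complex.I).mul hg)

theorem SmoothPeriodic.scOpA {φ : ℝ → ℝ} (hφ : SmoothPeriodic φ) (k : ℝ) {g : ℝ → ℂ}
    (hg : SmoothPeriodic g) : SmoothPeriodic (scOpA α φ k g) :=
  ((hφ.scDeriv k (hφ.scDeriv k (hφ.scDeriv k hg))).const_mul _).add
    (((hφ.scDeriv k (hφ.scDeriv k hg)).const_mul _).const_mul _)

theorem conjDeriv_const_mul {φ : ℝ → ℝ} (s : ℝ) (c : ℂ) (g : ℝ → ℂ) :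
    conjDeriv φ s (fun x => c * g x) = fun x => c * conjDeriv φ s g x := by
  funext x
  rw [conjDeriv, conjDeriv, deriv_const_mul_field]
  ring

theorem conjDeriv_inv {φ : ℝ → ℝ} {k : ℝ} (hk : k ≠ 0) (g : ℝ → ℂ) :
    conjDeriv φ k⁻¹ g = fun x => (k : ℂ)⁻¹ * scDeriv φ k g x := by
  have hk' : (k : ℂ) ≠ 0 := by exact_mod_cast hk
  funext x
  rw [conjDeriv, scDeriv]
  push_cast
  field_simp

theorem conjOpA_const_mul {φ : ℝ → ℝ} (s : ℝ) (c : ℂ) (g : ℝ → ℂ) :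
    conjOpA α φ s (fun x => c * g x) = fun x => c * conjOpA α φ s g x := by
  funext x
  simp only [conjOpA, conjDeriv_const_mul]
  ring

theorem conjOpA_inv {φ : ℝ → ℝ} {k : ℝ} (hk : k ≠ 0) (g : ℝ → ℂ) :
    conjOpA α φ k⁻¹ g = fun x => ((k : ℂ)⁻¹) ^ 3 * scOpA α φ k g x := by
  have hk' : (k : ℂ) ≠ 0 := by exact_mod_cast hk
  have h2 : conjDeriv φ k⁻¹ (conjDeriv φ k⁻¹ g) =
      fun x => (k : ℂ)⁻¹ ^ 2 * scDeriv φ k (scDeriv φ k g) x := by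
    rw [conjDeriv_inv hk g, conjDeriv_const_mul, conjDeriv_inv hk]
    funext x
    ring
  have h3 : conjDeriv φ k⁻¹ (conjDeriv φ k⁻¹ (conjDeriv φ k⁻¹ g)) =
      fun x => (k : ℂ)⁻¹ ^ 3 * scDeriv φ k (scDeriv φ k (scDeriv φ k g)) x := by
    rw [h2, conjDeriv_const_mul, conjDeriv_inv hk]
    funext x
    ring
  funext x
  rw [conjOpA, h3, h2, scOpA]
  field_simp

/-- The rescaled generator `scOpA` is bounded on bounded families uniformly in `k`, so the quadratic
remainder is of the order of the square of the main factor `τ k⁻³`. -/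
theorem exists_norm_conjProp_le {φ : ℝ → ℝ} (hφ : SmoothPeriodic φ) (C : ℕ → ℝ) :
    ∃ M, 0 ≤ M ∧ ∀ k ∈ Ioc (0 : ℝ) 1, ∀ τ : ℝ, ∀ g, Bd C g →
      ‖conjProp α φ k⁻¹ τ (cl g) - cl g - ((τ : ℂ) * (k : ℂ)⁻¹ ^ 3) • cl (scOpA α φ k g)‖ ≤
        τ ^ 2 * k⁻¹ ^ 6 * M := by
  obtain ⟨C', hC'⟩ := ((ub_scOpA (α := α) hφ).comp (ub_scOpA (α := α) hφ)) C
  refine ⟨3 * |C' 0|, by positivity, fun k hk τ g hg => ?_⟩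
  have hk0 : k ≠ 0 := hk.1.ne'
  have h := norm_conjProp_sub_sub_le (α := α) hφ k⁻¹ τ hg.1 (M := k⁻¹ ^ 6 * |C' 0|) fun x => by
    rw [conjOpA_inv hk0 g, conjOpA_const_mul, conjOpA_inv hk0]
    beta_reduce
    rw [← mul_assoc, norm_mul, ← pow_add, norm_pow, norm_inv, Complex.norm_real, Real.norm_eq_abs, abs_of_pos hk.1]
    have h0 := (hC' ⟨k, hk⟩ g hg).norm_le x
    have hk1 := hk.1
    gcongr
    exact h0.trans (le_abs_self _)
  rw [conjOpA_inv hk0 g, cl_const_mul _ (hφ.scOpA k hg.1).perCont, smul_smul] at h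
  exact h.trans_eq (by ring)

/-- The remainder in the expansion of `scOpA` in powers of `k`. -/
def scRem (α : ℝ) (φ : ℝ → ℝ) (k : ℝ) (g : ℝ → ℂ) (x : ℝ) : ℂ :=
  -1 * (3 * (Complex.I * (deriv φ x : ℝ) * deriv (deriv g) x) +
      3 * (Complex.I * (deriv (deriv φ) x : ℝ) * deriv g x) +
      Complex.I * (deriv (deriv (deriv φ)) x : ℝ) * g x) +
    -1 * (k * deriv (deriv (deriv g)) x) +
    Complex.I * α * (2 * (Complex.I * (deriv φ x : ℝ) * deriv g x) +
      Complex.I * (deriv (deriv φ) x : ℝ) * g x) +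
    Complex.I * α * (k * deriv (deriv g) x)

theorem ub_scRem {φ : ℝ → ℝ} (hφ : SmoothPeriodic φ) :
    UB (fun (k : Ioc (0 : ℝ) 1) g => scRem α φ k g) := by
  have d1 := UB.deriv (ι := Ioc (0 : ℝ) 1)
  have d2 := UB.deriv.comp d1
  have d3 := UB.deriv.comp d2
  have a0 := hφ.deriv.ofReal.const_mul Complex.I
  have a1 := hφ.deriv.deriv.ofReal.const_mul Complex.I
  have a2 := hφ.deriv.deriv.deriv.ofReal.const_mul Complex.I
  exact (((((((d2.mul a0).fixed_const_mul 3).add ((d1.mul a1).fixed_const_mul 3)).add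
    (UB.id.mul a2)).fixed_const_mul (-1)).add
    ((d3.const_mul (c := fun k : Ioc (0 : ℝ) 1 => ((k : ℝ) : ℂ)) norm_coe_Ioc).fixed_const_mul
      (-1))).add
    ((((d1.mul a0).fixed_const_mul 2).add (UB.id.mul a1)).fixed_const_mul (Complex.I * α))).add
    ((d2.const_mul (c := fun k : Ioc (0 : ℝ) 1 => ((k : ℝ) : ℂ)) norm_coe_Ioc).fixed_const_mul
      (Complex.I * α))

/-- The transport operator `T_f = f ∂ₓ + f'/2` on functions. -/
def transp (f : ℝ → ℝ) (g : ℝ → ℂ) (x : ℝ) : ℂ :=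
  f x * deriv g x + ((deriv f x : ℝ) : ℂ) / 2 * g x

theorem SmoothPeriodic.transp {f : ℝ → ℝ} (hf : SmoothPeriodic f) {g : ℝ → ℂ}
    (hg : SmoothPeriodic g) : SmoothPeriodic (transp f g) := by
  have h := (hf.ofReal.mul hg.deriv).add ((hf.deriv.ofReal.const_mul (1 / 2)).mul hg)
  unfold KdVSch.transp
  convert h using 3
  ring

theorem ub_transp {f : ℝ → ℝ} (hf : SmoothPeriodic f) {ι : Type*} :
    UB (fun (_ : ι) g => transp f g) := by
  have h := (UB.deriv.mul hf.ofReal).add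
    ((UB.id (ι := ι)).mul (hf.deriv.ofReal.const_mul (1 / 2)))
  convert h using 4
  rw [transp]
  ring

theorem SmoothPeriodic.pow {f : ℝ → ℝ} (hf : SmoothPeriodic f) (n : ℕ) :
    SmoothPeriodic (fun x => f x ^ n) :=
  ⟨hf.1.pow n, fun x => by simp only [hf.2 x]⟩

theorem SmoothPeriodic.smul {f : ℝ → ℝ} (hf : SmoothPeriodic f) (c : ℝ) :
    SmoothPeriodic (fun x => c * f x) :=
  ⟨contDiff_const.mul hf.1, fun x => by simp only [hf.2 x]⟩

/-- Expansion of `-(k∂ₓ + iφ')³ + iαk (k∂ₓ + iφ')²`. Order zero is `-(iφ')³ = iφ'³`. At order `k`,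
`-3(iφ')²∂ₓ - 3(iφ')(iφ'')` is exactly `T_f` with `f = 3φ'²`, and `iα(iφ')²` is a phase. -/
theorem scOpA_eq {φ : ℝ → ℝ} (hφ : SmoothPeriodic φ) (k : ℝ) {g : ℝ → ℂ} (hg : SmoothPeriodic g)
    (x : ℝ) :
    scOpA α φ k g x = mulI (fun x => deriv φ x ^ 3) g x +
      k * (transp (fun x => 3 * deriv φ x ^ 2) g x + mulI (fun x => -α * deriv φ x ^ 2) g x) +
      (k : ℂ) ^ 2 * scRem α φ k g x := by
  have hg1 := fun x => hg.hasDerivAt x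
  have hg2 := fun x => hg.deriv.hasDerivAt x
  have hg3 := fun x => hg.deriv.deriv.hasDerivAt x
  have hφ1 : ∀ x, HasDerivAt (fun x => Complex.I * ((deriv φ x : ℝ) : ℂ))
      (Complex.I * (deriv (deriv φ) x : ℝ)) x := fun x =>
    (hφ.deriv.hasDerivAt x).ofReal_comp.const_mul _
  have hφ2 : ∀ x, HasDerivAt (fun x => Complex.I * ((deriv (deriv φ) x : ℝ) : ℂ))
      (Complex.I * (deriv (deriv (deriv φ)) x : ℝ)) x := fun x =>
    (hφ.deriv.deriv.hasDerivAt x).ofReal_comp.const_mul _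
  have e2 : scDeriv φ k (scDeriv φ k g) = fun x => (k : ℂ) ^ 2 * deriv (deriv g) x +
      k * (2 * (Complex.I * (deriv φ x : ℝ) * deriv g x) +
        Complex.I * (deriv (deriv φ) x : ℝ) * g x) +
      Complex.I * (deriv φ x : ℝ) * (Complex.I * (deriv φ x : ℝ) * g x) := by
    funext x
    have h : HasDerivAt (scDeriv φ k g) _ x := ((hg2 x).const_mul (k : ℂ)).fun_add
      ((hφ1 x).fun_mul (hg1 x))
    rw [scDeriv, h.deriv, scDeriv]
    ring
  have e3 : scDeriv φ k (scDeriv φ k (scDeriv φ k g)) x = (k : ℂ) ^ 3 * deriv (deriv (deriv g)) x +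
      (k : ℂ) ^ 2 * (3 * (Complex.I * (deriv φ x : ℝ) * deriv (deriv g) x) +
        3 * (Complex.I * (deriv (deriv φ) x : ℝ) * deriv g x) +
        Complex.I * (deriv (deriv (deriv φ)) x : ℝ) * g x) +
      3 * k * ((Complex.I * (deriv φ x : ℝ)) ^ 2 * deriv g x +
        Complex.I * (deriv φ x : ℝ) * (Complex.I * (deriv (deriv φ) x : ℝ)) * g x) +
      (Complex.I * (deriv φ x : ℝ)) ^ 3 * g x := by
    have h := (((hg3 x).const_mul ((k : ℂ) ^ 2)).fun_add
      (((((hφ1 x).fun_mul (hg2 x)).const_mul 2).fun_add ((hφ2 x).fun_mul (hg1 x))).const_mul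
        (k : ℂ))).fun_add ((hφ1 x).fun_mul ((hφ1 x).fun_mul (hg1 x)))
    rw [scDeriv, (congrArg (fun F => deriv F x) e2).trans h.deriv, e2]
    ring
  have hf : deriv (fun x => 3 * deriv φ x ^ 2) x = 6 * deriv φ x * deriv (deriv φ) x := by
    rw [(((hφ.deriv.hasDerivAt x).fun_pow 2).const_mul 3).deriv]
    push_cast
    ring
  rw [scOpA, e3, e2, scRem, mulI, mulI, transp, hf]
  push_cast
  have hI2 := Complex.I_sq
  have hI3 : Complex.I ^ 3 = -Complex.I := by rw [pow_succ, Complex.I_sq]; ring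
  ring_nf
  rw [hI2, hI3]
  ring

/-! ### The phases that are approximately reachable -/

variable (α Q) in
/-- `e^{isθ}` is approximately reachable in arbitrarily small times, for all real `s`. -/
structure PhaseAR (θ : ℝ → ℝ) : Prop where
  cont : Continuous θ
  per : Function.Periodic θ (2 * π)
  ar : ∀ s, AR α Q 0 (mulL (expI θ s))

theorem ar_conjProp (hQ : Admissible Q) {φ : ℝ → ℝ} (hW : PhaseAR α Q φ) (s : ℝ) {τ : ℝ}
    (hτ : 0 ≤ τ) : AR α Q τ (conjProp α φ s τ) := by
  have h := (hW.ar (-s)).comp ((ar_prop (α := α) hQ hτ).comp (hW.ar s))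
  rw [zero_add, add_zero] at h
  exact h

theorem PhaseAR.smul {θ : ℝ → ℝ} (h : PhaseAR α Q θ) (c : ℝ) : PhaseAR α Q (fun x => c * θ x) :=
  ⟨continuous_const.mul h.cont, fun x => by simp only [h.per x], fun s => by
    convert h.ar (s * c) using 2
    congr 1
    funext x
    rw [expI, expI, mul_assoc]⟩

theorem PhaseAR.add {θ₁ θ₂ : ℝ → ℝ} (h₁ : PhaseAR α Q θ₁) (h₂ : PhaseAR α Q θ₂) :
    PhaseAR α Q (fun x => θ₁ x + θ₂ x) := by
  refine ⟨h₁.cont.add h₂.cont, fun x => by simp only [h₁.per x, h₂.per x], fun s => ?_⟩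
  convert (h₁.ar s).comp_zero (h₂.ar s) using 1
  funext ψ
  rw [Function.comp_apply, mulL_mulL (perCont_expI h₁.cont h₁.per s)
    (perCont_expI h₂.cont h₂.per s)]
  congr 2
  funext x
  rw [expI, expI, expI, ← Complex.exp_add]
  congr 1
  push_cast
  ring

theorem PhaseAR.congr {θ θ' : ℝ → ℝ} (h : PhaseAR α Q θ) (e : ∀ x, θ' x = θ x) :
    PhaseAR α Q θ' := by
  rwa [show θ' = θ from funext e]

/-- Uniform approximation of phases suffices, because `|e^{isθ'} - e^{isθ}| ≤ |s| |θ' - θ|`. -/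
theorem PhaseAR.of_limit {θ : ℝ → ℝ} (hc : Continuous θ) (hp : Function.Periodic θ (2 * π))
    (h : ∀ ε > 0, ∃ θ', PhaseAR α Q θ' ∧ ∀ x, |θ' x - θ x| ≤ ε) : PhaseAR α Q θ := by
  refine ⟨hc, hp, fun s => AR.of_limit (isometry_mulL_expI hc hp s) fun g hg ε hε => ?_⟩
  set D := (|s| + 1) * (‖cl g‖ + 1) with hD
  have hD0 : 0 < D := by positivity
  obtain ⟨θ', hθ', hle⟩ := h (ε / D) (by positivity)
  refine ⟨_, (hθ'.ar s).mono (by linarith), ?_⟩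
  have h1 := perCont_expI hθ'.cont hθ'.per s
  have h2 := perCont_expI hc hp s
  rw [← mulL_sub h1 h2]
  refine (norm_mulL_le (h1.sub h2) (C := |s| * (ε / D)) (fun x => ?_) _).trans ?_
  · have e : expI θ' s x - expI θ s x =
        expI θ s x * (Complex.exp (Complex.I * (s * (θ' x - θ x) : ℝ)) - 1) := by
      rw [mul_sub, mul_one, expI, expI, ← Complex.exp_add]
      congr 2
      push_cast
      ring
    rw [e, norm_mul, norm_expI, one_mul]
    refine Real.norm_exp_I_mul_ofReal_sub_one_le.trans ?_
    rw [Real.norm_eq_abs, abs_mul]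
    gcongr
    exact hle x
  · calc |s| * (ε / D) * ‖cl g‖ ≤ (|s| + 1) * (ε / D) * (‖cl g‖ + 1) := by gcongr <;> simp
      _ = ε / D * D := by rw [hD]; ring
      _ = ε := by field_simp

/-- The Chernoff argument only runs forward in time, so negative `s` is obtained from `-θ`. -/
theorem PhaseAR.of_consistent (hQ : Admissible Q) {θ : ℝ → ℝ} (hθ : SmoothPeriodic θ)
    (h : Consistent α Q (mulI θ)) (h' : Consistent α Q (mulI (fun x => -1 * θ x))) :
    PhaseAR α Q θ := by
  refine ⟨hθ.1.continuous, hθ.2, fun s => ?_⟩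
  rcases lt_trichotomy s 0 with hs | rfl | hs
  · convert h'.ar_expI (hθ.smul (-1)) (neg_pos.2 hs) using 2
    congr 1
    funext x
    rw [expI, expI]
    congr 3
    ring
  · convert ar_id (α := α) hQ using 1
    funext ψ
    rw [expI_zero, mulL_one]; rfl
  · exact h.ar_expI hθ hs

theorem PhaseAR.of_span (hQ : Admissible Q) {θ : ℝ → ℝ} (hθ : SmoothPeriodic θ)
    (h : θ ∈ Submodule.span ℝ (range Q)) : PhaseAR α Q θ := by
  obtain ⟨c, rfl⟩ := (Submodule.mem_span_range_iff_exists_fun ℝ).1 h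
  refine PhaseAR.of_consistent hQ hθ (consistent_mulI_of_span hQ hθ (c := c) fun x => by simp)
    (consistent_mulI_of_span hQ (hθ.smul (-1)) (c := fun j => -c j) fun x => by simp)

theorem cl_scOpA {φ : ℝ → ℝ} (hφ : SmoothPeriodic φ) {k : ℝ} (hk : k ∈ Ioc (0 : ℝ) 1) {g : ℝ → ℂ}
    (hg : SmoothPeriodic g) :
    cl (scOpA α φ k g) = cl (mulI (fun x => deriv φ x ^ 3) g) +
      (k : ℂ) • (cl (transp (fun x => 3 * deriv φ x ^ 2) g) +
        cl (mulI (fun x => -α * deriv φ x ^ 2) g)) +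
      ((k : ℂ) ^ 2) • cl (scRem α φ k g) := by
  have h1 := ((hφ.deriv.pow 3).mulI hg).perCont
  have h2 := (((hφ.deriv.pow 2).smul 3).transp hg).perCont
  have h3 := (((hφ.deriv.pow 2).smul (-α)).mulI hg).perCont
  have h4 : PerCont (scRem α φ k g) := by
    obtain ⟨C, hC⟩ := hg.exists_bd
    obtain ⟨C', hC'⟩ := ub_scRem (α := α) hφ C
    exact (hC' ⟨k, hk⟩ g hC).1.perCont
  rw [show scOpA α φ k g = _ from funext (scOpA_eq hφ k hg),
    cl_add (h1.add ((h2.add h3).const_mul _)) (h4.const_mul _),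
    cl_add h1 ((h2.add h3).const_mul _), cl_const_mul _ (h2.add h3), cl_add h2 h3,
    cl_const_mul _ h4]

/-- Conjugation by `e^{iφ/h}` for time `h⁴`: the leading coefficient is `h⁴ · h⁻³ = h`, and both the
lower terms of the expansion and the quadratic remainder are `O(h²)`. -/
theorem consistent_cube (hQ : Admissible Q) {φ : ℝ → ℝ} (hφ : SmoothPeriodic φ)
    (hW : PhaseAR α Q φ) : Consistent α Q (mulI (fun x => deriv φ x ^ 3)) := by
  intro C η hη
  obtain ⟨M, hM0, hM⟩ := exists_norm_conjProp_le (α := α) hφ C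
  obtain ⟨C₁, hC₁⟩ := ub_scRem (α := α) hφ C
  obtain ⟨C₂, hC₂⟩ := ub_transp ((hφ.deriv.pow 2).smul 3) (ι := Unit) C
  obtain ⟨C₃, hC₃⟩ := ub_mulI ((hφ.deriv.pow 2).smul (-α)) (ι := Unit) C
  filter_upwards [eventually_small 1 hη, eventually_small (M + (C₂ 0 + C₃ 0 + C₁ 0)) hη]
    with h ⟨h0, h1, hs⟩ ⟨_, _, hs2⟩
  have hk : h ∈ Ioc (0 : ℝ) 1 := ⟨h0, h1⟩
  have hhC : (h : ℂ) ≠ 0 := by exact_mod_cast h0.ne'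
  have hn : ‖(h : ℂ)‖ = h := by rw [Complex.norm_real, Real.norm_eq_abs, abs_of_pos h0]
  refine ⟨conjProp α φ h⁻¹ (h ^ 4), (ar_conjProp hQ hW _ (by positivity)).mono ?_, fun g hg => ?_⟩
  · have : h ^ 3 ≤ h := pow_le_of_le_one h0.le h1 (by norm_num)
    nlinarith
  have a := hM h hk (h ^ 4) g hg
  have b1 := (hC₁ ⟨h, hk⟩ g hg).norm_cl_le
  have b2 := (hC₂ () g hg).norm_cl_le
  have b3 := (hC₃ () g hg).norm_cl_le
  simp only at b1 b2 b3
  rw [show (((h ^ 4 : ℝ) : ℂ) * (h : ℂ)⁻¹ ^ 3) = h by push_cast; field_simp,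
    show (h ^ 4) ^ 2 * h⁻¹ ^ 6 * M = h ^ 2 * M by field_simp, cl_scOpA hφ hk hg.1] at a
  set X := cl (transp (fun x => 3 * deriv φ x ^ 2) g)
  set Y := cl (mulI (fun x => -α * deriv φ x ^ 2) g)
  set Z := cl (scRem α φ h g)
  set W := cl (mulI (fun x => deriv φ x ^ 3) g)
  set P := conjProp α φ h⁻¹ (h ^ 4) (cl g)
  have e : P - cl g - (h : ℂ) • W = (P - cl g - (h : ℂ) • (W + (h : ℂ) • (X + Y) + (h : ℂ) ^ 2 • Z)) +
      ((h : ℂ) ^ 2) • (X + Y + (h : ℂ) • Z) := by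
    module
  rw [e]
  refine (norm_add_le _ _).trans ?_
  have n1 : ‖X + Y + (h : ℂ) • Z‖ ≤ C₂ 0 + C₃ 0 + 1 * C₁ 0 := by
    refine (norm_add₃_le).trans ?_
    rw [norm_smul, hn]
    gcongr
  rw [norm_smul, norm_pow, hn]
  calc _ ≤ h ^ 2 * M + h ^ 2 * (C₂ 0 + C₃ 0 + 1 * C₁ 0) := by gcongr
    _ = ((M + (C₂ 0 + C₃ 0 + C₁ 0)) * h) * h := by ring
    _ ≤ η * h := by gcongr

end

section

open scoped ComplexConjugate InnerProductSpace ENNReal NNReal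

variable {q : ℕ} {α : ℝ} {Q : Fin q → ℝ → ℝ}

/-! ### All phases are approximately reachable -/

theorem SmoothPeriodic.add_real {f g : ℝ → ℝ} (hf : SmoothPeriodic f) (hg : SmoothPeriodic g) :
    SmoothPeriodic (fun x => f x + g x) := ⟨hf.1.add hg.1, fun x => by simp only [hf.2 x, hg.2 x]⟩

/-- Both signs of `φ'³` are available because the cube is odd: replace `φ` by `-φ`. -/
theorem PhaseAR.cube (hQ : Admissible Q) {φ : ℝ → ℝ} (hφ : SmoothPeriodic φ)
    (hW : PhaseAR α Q φ) : PhaseAR α Q (fun x => deriv φ x ^ 3) := by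
  refine PhaseAR.of_consistent hQ (hφ.deriv.pow 3) (consistent_cube hQ hφ hW) ?_
  convert consistent_cube hQ (hφ.smul (-1)) (hW.smul (-1)) using 3 with x
  rw [deriv_const_mul_field]
  ring

variable (α Q) in
/-- `a` is the derivative of a smooth approximately reachable phase. -/
def IsPhaseDeriv (a : ℝ → ℝ) : Prop :=
  ∃ φ, SmoothPeriodic φ ∧ PhaseAR α Q φ ∧ ∀ x, deriv φ x = a x

theorem PhaseAR.triple (hQ : Admissible Q) {a b c : ℝ → ℝ} (ha : IsPhaseDeriv α Q a)
    (hb : IsPhaseDeriv α Q b) (hc : IsPhaseDeriv α Q c) :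
    PhaseAR α Q (fun x => a x * b x * c x) := by
  obtain ⟨φ, hφ, hφW, hφ'⟩ := ha
  obtain ⟨χ, hχ, hχW, hχ'⟩ := hb
  obtain ⟨ξ, hξ, hξW, hξ'⟩ := hc
  have key : ∀ s t : ℝ, PhaseAR α Q (fun x => (a x + s * b x + t * c x) ^ 3) := fun s t => by
    refine (PhaseAR.cube hQ ((hφ.add_real (hχ.smul s)).add_real (hξ.smul t))
      ((hφW.add (hχW.smul s)).add (hξW.smul t))).congr fun x => ?_
    rw [(((hφ.hasDerivAt x).fun_add ((hχ.hasDerivAt x).const_mul s)).fun_add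
      ((hξ.hasDerivAt x).const_mul t)).deriv, hφ', hχ', hξ']
  -- Polarisation: `24abc = (a+b+c)³ - (a+b-c)³ - (a-b+c)³ + (a-b-c)³`.
  refine (((((key 1 1).add ((key 1 (-1)).smul (-1))).add ((key (-1) 1).smul (-1))).add
    (key (-1) (-1))).smul (1 / 24)).congr fun x => ?_
  ring

theorem smoothPeriodic_cos (n : ℕ) : SmoothPeriodic (fun x => Real.cos (n * x)) :=
  ⟨Real.contDiff_cos.comp (contDiff_const.mul contDiff_id), fun x => by
    beta_reduce
    rw [mul_add, Real.cos_add_nat_mul_two_pi]⟩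

theorem smoothPeriodic_sin (n : ℕ) : SmoothPeriodic (fun x => Real.sin (n * x)) :=
  ⟨Real.contDiff_sin.comp (contDiff_const.mul contDiff_id), fun x => by
    beta_reduce
    rw [mul_add, Real.sin_add_nat_mul_two_pi]⟩

theorem isPhaseDeriv_cos {n : ℕ} (hn : n ≠ 0) (h : PhaseAR α Q (fun x => Real.sin (n * x))) :
    IsPhaseDeriv α Q (fun x => Real.cos (n * x)) := by
  have hn' : (n : ℝ) ≠ 0 := by exact_mod_cast hn
  refine ⟨_, (smoothPeriodic_sin n).smul (n : ℝ)⁻¹, h.smul _, fun x => ?_⟩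
  rw [((((hasDerivAt_id' x).const_mul (n : ℝ)).sin).const_mul (n : ℝ)⁻¹).deriv]
  simp; field_simp

theorem isPhaseDeriv_sin {n : ℕ} (hn : n ≠ 0) (h : PhaseAR α Q (fun x => Real.cos (n * x))) :
    IsPhaseDeriv α Q (fun x => Real.sin (n * x)) := by
  have hn' : (n : ℝ) ≠ 0 := by exact_mod_cast hn
  refine ⟨_, (smoothPeriodic_cos n).smul (-(n : ℝ)⁻¹), h.smul _, fun x => ?_⟩
  rw [((((hasDerivAt_id' x).const_mul (n : ℝ)).cos).const_mul (-(n : ℝ)⁻¹)).deriv]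
  simp; field_simp

/-- The trigonometric polynomials of degree two are combinations of the control profiles. -/
def SpanCond (Q : Fin q → ℝ → ℝ) : Prop :=
  ({fun _ => 1, fun x => Real.sin x, fun x => Real.cos x, fun x => Real.sin (2 * x),
    fun x => Real.cos (2 * x)} : Set (ℝ → ℝ)) ⊆ (Submodule.span ℝ (range Q) : Set (ℝ → ℝ))

/-- Up to frequency two the span hypothesis applies. Then `n + 3 = (n + 2) + 2 - 1`, and the
addition formulas write the new mode as a sum of triple products of modes of nonzero frequency;
these are derivatives of reachable phases, whereas a nonzero constant is not the derivative of a
periodic function. -/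
theorem PhaseAR.trig (hQ : Admissible Q) (hS : SpanCond Q) (n : ℕ) :
    PhaseAR α Q (fun x => Real.cos (n * x)) ∧ PhaseAR α Q (fun x => Real.sin (n * x)) := by
  have h1 : PhaseAR α Q (fun x => Real.cos ((1 : ℕ) * x)) ∧
      PhaseAR α Q (fun x => Real.sin ((1 : ℕ) * x)) :=
    ⟨PhaseAR.of_span hQ (smoothPeriodic_cos 1) (by
      simpa using hS (show (fun x => Real.cos x) ∈ _ by simp)),
    PhaseAR.of_span hQ (smoothPeriodic_sin 1) (by
      simpa using hS (show (fun x => Real.sin x) ∈ _ by simp))⟩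
  have h2 : PhaseAR α Q (fun x => Real.cos ((2 : ℕ) * x)) ∧
      PhaseAR α Q (fun x => Real.sin ((2 : ℕ) * x)) :=
    ⟨PhaseAR.of_span hQ (smoothPeriodic_cos 2) (by
      simpa using hS (show (fun x => Real.cos (2 * x)) ∈ _ by simp)),
    PhaseAR.of_span hQ (smoothPeriodic_sin 2) (by
      simpa using hS (show (fun x => Real.sin (2 * x)) ∈ _ by simp))⟩
  match n with
  | 0 =>
    have h0 : PhaseAR α Q (fun _ => 1) :=
      PhaseAR.of_span hQ (SmoothPeriodic.const 1) (hS (by simp))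
    exact ⟨h0.congr (by simp), (h0.smul 0).congr (by simp)⟩
  | 1 => exact h1
  | 2 => exact h2
  | n + 3 =>
    obtain ⟨hc, hs⟩ := PhaseAR.trig hQ hS (n + 2)
    have ca := isPhaseDeriv_cos (by omega) hs
    have sa := isPhaseDeriv_sin (by omega) hc
    have cb := isPhaseDeriv_cos two_ne_zero h2.2
    have sb := isPhaseDeriv_sin two_ne_zero h2.1
    have cc := isPhaseDeriv_cos one_ne_zero h1.2
    have sc := isPhaseDeriv_sin one_ne_zero h1.1
    have e : ∀ x : ℝ, ((n + 3 : ℕ) : ℝ) * x =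
        (((n + 2 : ℕ) : ℝ) * x + ((2 : ℕ) : ℝ) * x) - ((1 : ℕ) : ℝ) * x := fun x => by
      push_cast; ring
    constructor
    · refine (((PhaseAR.triple hQ ca cb cc).add ((PhaseAR.triple hQ sa sb cc).smul (-1))).add
        ((PhaseAR.triple hQ sa cb sc).add (PhaseAR.triple hQ ca sb sc))).congr fun x => ?_
      rw [e, Real.cos_sub, Real.cos_add, Real.sin_add]
      ring
    · refine (((PhaseAR.triple hQ sa cb cc).add (PhaseAR.triple hQ ca sb cc)).add
        (((PhaseAR.triple hQ ca cb sc).smul (-1)).add (PhaseAR.triple hQ sa sb sc))).congr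
          fun x => ?_
      rw [e, Real.sin_sub, Real.cos_add, Real.sin_add]
      ring

theorem PhaseAR.trig_int (hQ : Admissible Q) (hS : SpanCond Q) (n : ℤ) :
    PhaseAR α Q (fun x => Real.cos (n * x)) ∧ PhaseAR α Q (fun x => Real.sin (n * x)) := by
  obtain ⟨m, rfl | rfl⟩ := n.eq_nat_or_neg
  · simpa using PhaseAR.trig hQ hS m
  · obtain ⟨h1, h2⟩ := PhaseAR.trig (α := α) hQ hS m
    exact ⟨h1.congr fun x => by simp, (h2.smul (-1)).congr fun x => by simp⟩

/-- Continuous functions on the torus whose real and imaginary parts are approximately reachable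
phases. -/
def phaseSubmodule (hQ : Admissible Q) (hS : SpanCond Q) (α : ℝ) : Submodule ℂ C(Torus, ℂ) where
  carrier := {p | PhaseAR α Q (fun x => (p (x : Torus)).re) ∧
    PhaseAR α Q (fun x => (p (x : Torus)).im)}
  add_mem' {p p'} hp hp' := ⟨(hp.1.add hp'.1).congr fun x => by simp,
    (hp.2.add hp'.2).congr fun x => by simp⟩
  zero_mem' := by
    have h0 := (PhaseAR.trig (α := α) hQ hS 0).2
    exact ⟨h0.congr fun x => by simp, h0.congr fun x => by simp⟩
  smul_mem' c p hp := ⟨((hp.1.smul c.re).add (hp.2.smul (-c.im))).congr fun x => by simp; ring,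
    ((hp.2.smul c.re).add (hp.1.smul c.im)).congr fun x => by simp⟩

/-- Trigonometric polynomials are uniformly dense; the real part of an approximant is a reachable
phase close to `θ`. -/
theorem PhaseAR.of_continuous (hQ : Admissible Q) (hS : SpanCond Q) {θ : ℝ → ℝ}
    (hc : Continuous θ) (hp : Function.Periodic θ (2 * π)) : PhaseAR α Q θ := by
  refine PhaseAR.of_limit hc hp fun ε hε => ?_
  have hθ : PerCont fun x => (θ x : ℂ) := PerCont.ofReal hc hp
  have h1 : Submodule.span ℂ (range (fourier (T := 2 * π))) ≤ phaseSubmodule hQ hS α := by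
    rw [Submodule.span_le]
    rintro _ ⟨n, rfl⟩
    obtain ⟨h1, h2⟩ := PhaseAR.trig_int (α := α) hQ hS n
    have e : ∀ x : ℝ, fourier n (x : Torus) = Complex.exp ((n * x : ℝ) * Complex.I) := fun x => by
      rw [← lift_expFun_aux, expFun]
      congr 1
      push_cast
      ring
    exact ⟨h1.congr fun x => by rw [e, Complex.exp_ofReal_mul_I_re],
      h2.congr fun x => by rw [e, Complex.exp_ofReal_mul_I_im]⟩
  have h2 : lift (fun x => (θ x : ℂ)) ∈
      (Submodule.span ℂ (range (fourier (T := 2 * π)))).topologicalClosure := by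
    rw [span_fourier_closure_eq_top]; trivial
  rw [← SetLike.mem_coe, Submodule.topologicalClosure_coe, Metric.mem_closure_iff] at h2
  obtain ⟨p, hpm, hpd⟩ := h2 ε hε
  refine ⟨_, (h1 hpm).1, fun x => ?_⟩
  have h3 := (lift (fun x => (θ x : ℂ)) - p).norm_coe_le_norm (x : Torus)
  rw [← dist_eq_norm] at h3
  rw [ContinuousMap.sub_apply, lift_coe hθ] at h3
  have h4 := Complex.abs_re_le_norm ((θ x : ℂ) - p (x : Torus))
  rw [Complex.sub_re, Complex.ofReal_re, abs_sub_comm] at h4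
  linarith

/-! ### Transport operators -/

theorem smoothOp_transp {f : ℝ → ℝ} (hf : SmoothPeriodic f) : SmoothOp (transp f) :=
  ⟨ub_transp hf, fun g g' c hg hg' => by
    funext x
    rw [transp, transp, transp, ((hg.hasDerivAt x).fun_add ((hg'.hasDerivAt x).const_mul c)).deriv]
    ring⟩

/-- The transport step of size `h` is parametrised by `k = h^{1/4}`. -/
theorem eventually_small_root (C : ℝ) {η : ℝ} (hη : 0 < η) :
    ∀ᶠ h in 𝓝[>] (0 : ℝ), ∃ k ∈ Ioc (0 : ℝ) 1, k ^ 4 = h ∧ C * k ≤ η := by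
  have h1 : Tendsto (fun h : ℝ => √√h) (𝓝[>] 0) (𝓝[>] 0) := by
    refine tendsto_nhdsWithin_iff.2 ⟨?_, ?_⟩
    · have : Tendsto (fun h : ℝ => √√h) (𝓝 0) (𝓝 (√√0)) := Continuous.tendsto (by fun_prop) 0
      simp only [Real.sqrt_zero] at this
      exact this.mono_left nhdsWithin_le_nhds
    · filter_upwards [self_mem_nhdsWithin] with h hh
      exact Real.sqrt_pos.2 (Real.sqrt_pos.2 hh)
  filter_upwards [h1.eventually (eventually_small C hη), self_mem_nhdsWithin] with h ⟨a, b, c⟩ hh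
  refine ⟨_, ⟨a, b⟩, ?_, c⟩
  rw [show (√√h) ^ 4 = ((√√h) ^ 2) ^ 2 by ring, Real.sq_sqrt (Real.sqrt_nonneg _),
    Real.sq_sqrt (le_of_lt hh)]

theorem norm_two_phases_le {u v M N k : ℝ} (hu : |u| ≤ M) (hv : |v| ≤ N) (hk : k ∈ Ioc (0 : ℝ) 1) :
    ‖Complex.exp (Complex.I * (-(k ^ 3) * u : ℝ)) * Complex.exp (Complex.I * (-(k ^ 4) * v : ℝ)) - 1 +
      (k : ℂ) ^ 3 * (Complex.I * (u + k * v))‖ ≤ k ^ 6 * (3 * (M + N) ^ 2) := by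
  have h := norm_exp_I_sub_one_sub_le (-(k ^ 3 * (u + k * v)))
  rw [← Complex.exp_add]
  have e1 : Complex.I * ((-(k ^ 3) * u : ℝ) : ℂ) + Complex.I * ((-(k ^ 4) * v : ℝ) : ℂ) =
      Complex.I * ((-(k ^ 3 * (u + k * v)) : ℝ) : ℂ) := by push_cast; ring
  have e2 : (k : ℂ) ^ 3 * (Complex.I * (u + k * v)) =
      -(Complex.I * ((-(k ^ 3 * (u + k * v)) : ℝ) : ℂ)) := by push_cast; ring
  rw [e1, e2, ← sub_eq_add_neg]
  refine h.trans ?_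
  have h1 : |u + k * v| ≤ M + N := by
    refine (abs_add_le _ _).trans (add_le_add hu ?_)
    rw [abs_mul, abs_of_pos hk.1]
    nlinarith [abs_nonneg v, hk.2, hk.1]
  have h2 : (u + k * v) ^ 2 ≤ (M + N) ^ 2 := by
    rw [← sq_abs]
    gcongr
  have hk6 : (0 : ℝ) ≤ k ^ 6 := by have := hk.1; positivity
  calc 3 * (-(k ^ 3 * (u + k * v))) ^ 2 = k ^ 6 * (3 * (u + k * v) ^ 2) := by ring
    _ ≤ _ := by gcongr

/-- Conjugation by `e^{iφ/k}` for time `k⁶` gives `1 + k³ (iv₁ + k (T_{3φ'²} + iv₂)) + O(k⁵)`. The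
phases `-k³v₁` and `-k⁴v₂`, reachable since every continuous phase is, cancel the multiplication
part; products of two first-order terms are `O(k⁶)`. The term `k⁴ T_{3φ'²}` remains. -/
theorem consistent_transp_sq (hQ : Admissible Q) (hS : SpanCond Q) {φ : ℝ → ℝ}
    (hφ : SmoothPeriodic φ) : Consistent α Q (transp (fun x => 3 * deriv φ x ^ 2)) := by
  have hf : SmoothPeriodic (fun x => 3 * deriv φ x ^ 2) := (hφ.deriv.pow 2).smul 3
  set v₁ : ℝ → ℝ := fun x => deriv φ x ^ 3 with hv₁_def
  set v₂ : ℝ → ℝ := fun x => -α * deriv φ x ^ 2 with hv₂_def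
  have hv₁ : SmoothPeriodic v₁ := hφ.deriv.pow 3
  have hv₂ : SmoothPeriodic v₂ := (hφ.deriv.pow 2).smul _
  have W : ∀ {θ : ℝ → ℝ}, SmoothPeriodic θ → PhaseAR α Q θ := fun hθ =>
    PhaseAR.of_continuous hQ hS hθ.1.continuous hθ.2
  obtain ⟨M₁, hM₁⟩ := exists_bound_of_periodic hv₁.1.continuous hv₁.2
  obtain ⟨M₂, hM₂⟩ := exists_bound_of_periodic hv₂.1.continuous hv₂.2
  intro C η hη
  have ubZ : UB (fun (k : Ioc (0 : ℝ) 1) g x => mulI v₁ g x + k * mulI v₂ g x) :=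
    (ub_mulI hv₁).add ((ub_mulI hv₂).const_mul (c := fun k : Ioc (0 : ℝ) 1 => ((k : ℝ) : ℂ))
      norm_coe_Ioc)
  obtain ⟨Cz, hCz⟩ := ubZ C
  obtain ⟨A, hA0, hA⟩ := exists_norm_conjProp_le (α := α) hφ C
  obtain ⟨B, hB0, hB⟩ := exists_norm_conjProp_le (α := α) hφ Cz
  obtain ⟨CR, hCR⟩ := ub_scRem (α := α) hφ C
  obtain ⟨CS, hCS⟩ := ub_scOpA (α := α) hφ Cz
  -- The summand `1` gives `k ≤ η`, used for the reaching time; the others bound the five error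
  -- terms, each at most `k⁵` times its constant.
  filter_upwards [eventually_small_root (1 + (3 * (M₁ + M₂) ^ 2 * |C 0| + A + B + |CS 0| + |CR 0|))
    hη] with h ⟨k, hk, hkh, hs⟩
  have hk0 := hk.1
  have hk1 := hk.2
  have hkC : (k : ℂ) ≠ 0 := by exact_mod_cast hk0.ne'
  have hn : ‖(k : ℂ)‖ = k := by rw [Complex.norm_real, Real.norm_eq_abs, abs_of_pos hk0]
  refine ⟨conjProp α φ k⁻¹ (k ^ 6) ∘ (mulL (expI v₁ (-(k ^ 3))) ∘ mulL (expI v₂ (-(k ^ 4)))),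
    ?_, fun g hg => ?_⟩
  · have h1 := (ar_conjProp hQ (W hφ) k⁻¹ (show 0 ≤ k ^ 6 by positivity)).comp
      (((W hv₁).ar (-(k ^ 3))).comp_zero ((W hv₂).ar (-(k ^ 4))))
    refine h1.mono ?_
    have h3 : k ≤ η := by
      refine le_trans ?_ hs
      have : 0 ≤ (3 * (M₁ + M₂) ^ 2 * |C 0| + A + B + |CS 0| + |CR 0|) * k := by positivity
      linarith
    rw [add_zero, ← hkh]
    have h2 : k ^ 2 ≤ k := pow_le_of_le_one hk0.le hk1 two_ne_zero
    calc k ^ 6 = k ^ 2 * k ^ 4 := by ring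
      _ ≤ η * k ^ 4 := by gcongr; exact h2.trans h3
  set z : ℝ → ℂ := fun x => mulI v₁ g x + k * mulI v₂ g x with hz_def
  have hz : Bd Cz z := hCz ⟨k, hk⟩ g hg
  have a := hA k hk (k ^ 6) g hg
  have b := hB k hk (k ^ 6) z hz
  have r := (hCR ⟨k, hk⟩ g hg).norm_cl_le
  have s := (hCS ⟨k, hk⟩ z hz).norm_cl_le
  simp only at r s
  have eτ : (((k ^ 6 : ℝ) : ℂ) * (k : ℂ)⁻¹ ^ 3) = (k : ℂ) ^ 3 := by push_cast; field_simp
  have eτ2 : ∀ M : ℝ, (k ^ 6) ^ 2 * k⁻¹ ^ 6 * M = k ^ 6 * M := fun M => by field_simp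
  rw [eτ, eτ2] at a b
  have hgc := hg.1.perCont
  have p1 := (hv₁.mulI hg.1).perCont
  have p2 := (hv₂.mulI hg.1).perCont
  have c1 := (smoothPeriodic_expI hv₁ (-(k ^ 3))).perCont
  have c2 := (smoothPeriodic_expI hv₂ (-(k ^ 4))).perCont
  have clz : cl z = cl (mulI v₁ g) + (k : ℂ) • cl (mulI v₂ g) := by
    rw [hz_def, cl_add p1 (p2.const_mul _), cl_const_mul _ p2]
  have e0 : ‖mulL (expI v₁ (-(k ^ 3))) (mulL (expI v₂ (-(k ^ 4))) (cl g)) -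
      (cl g - ((k : ℂ) ^ 3) • cl z)‖ ≤ k ^ 6 * (3 * (M₁ + M₂) ^ 2 * |C 0|) := by
    rw [mulL_mulL c1 c2, mulL_cl (c1.mul c2) hgc, ← cl_const_mul _ hz.1.perCont,
      ← cl_sub hgc (hz.1.perCont.const_mul _),
      ← cl_sub ((c1.mul c2).mul hgc) (hgc.sub (hz.1.perCont.const_mul _))]
    refine norm_cl_le (((c1.mul c2).mul hgc).sub (hgc.sub (hz.1.perCont.const_mul _))) fun x => ?_
    have e : expI v₁ (-(k ^ 3)) x * expI v₂ (-(k ^ 4)) x * g x - (g x - (k : ℂ) ^ 3 * z x) =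
        (expI v₁ (-(k ^ 3)) x * expI v₂ (-(k ^ 4)) x - 1 +
          (k : ℂ) ^ 3 * (Complex.I * (v₁ x + k * v₂ x))) * g x := by
      simp only [hz_def, mulI]
      ring
    rw [e, norm_mul, ← mul_assoc (k ^ 6)]
    exact mul_le_mul (norm_two_phases_le (hM₁ x) (hM₂ x) hk)
      ((hg.norm_le x).trans (le_abs_self _)) (norm_nonneg _) (by positivity)
  have eS : cl (scOpA α φ k g) = cl z + (k : ℂ) • cl (transp (fun x => 3 * deriv φ x ^ 2) g) +
      ((k : ℂ) ^ 2) • cl (scRem α φ k g) := by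
    rw [cl_scOpA hφ hk hg.1, clz]
    simp only [smul_add]
    abel
  rw [eS] at a
  set P := conjProp α φ k⁻¹ (k ^ 6)
  set m := mulL (expI v₁ (-(k ^ 3))) (mulL (expI v₂ (-(k ^ 4))) (cl g))
  set X := cl (transp (fun x => 3 * deriv φ x ^ 2) g)
  set R := cl (scRem α φ k g)
  set Sz := cl (scOpA α φ k z)
  -- The five errors: replacing the phases by their first order, the expansion of `P` at `g`, the
  -- expansion of `P` at `z`, the product term `Sz`, and the remainder of the conjugated generator.
  have e : P m - cl g - (h : ℂ) • X = P (m - (cl g - ((k : ℂ) ^ 3) • cl z)) +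
      (P (cl g) - cl g - ((k : ℂ) ^ 3) • (cl z + (k : ℂ) • X + ((k : ℂ) ^ 2) • R)) +
      (-((k : ℂ) ^ 3)) • (P (cl z) - cl z - ((k : ℂ) ^ 3) • Sz) +
      (-((k : ℂ) ^ 6)) • Sz + ((k : ℂ) ^ 5) • R := by
    rw [map_sub, map_sub, map_smul, ← hkh]
    push_cast
    module
  change ‖P m - cl g - (h : ℂ) • X‖ ≤ _
  rw [e]
  have k3 : k ^ 3 ≤ 1 := pow_le_one₀ hk0.le hk1
  have k65 : k ^ 6 ≤ k ^ 5 := pow_le_pow_of_le_one hk0.le hk1 (by norm_num)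
  have n1 : ‖P (m - (cl g - ((k : ℂ) ^ 3) • cl z))‖ ≤ k ^ 5 * (3 * (M₁ + M₂) ^ 2 * |C 0|) := by
    rw [norm_conjProp hφ]
    exact e0.trans (by gcongr)
  have n3 : ‖(-((k : ℂ) ^ 3)) • (P (cl z) - cl z - ((k : ℂ) ^ 3) • Sz)‖ ≤ k ^ 5 * B := by
    rw [norm_smul, norm_neg, norm_pow, hn]
    calc _ ≤ 1 * (k ^ 6 * B) := by gcongr
      _ ≤ k ^ 5 * B := by rw [one_mul]; gcongr
  have n4 : ‖(-((k : ℂ) ^ 6)) • Sz‖ ≤ k ^ 5 * |CS 0| := by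
    rw [norm_smul, norm_neg, norm_pow, hn]
    gcongr
    exact s.trans (le_abs_self _)
  have n5 : ‖((k : ℂ) ^ 5) • R‖ ≤ k ^ 5 * |CR 0| := by
    rw [norm_smul, norm_pow, hn]
    gcongr
    exact r.trans (le_abs_self _)
  have n2 := a.trans (show k ^ 6 * A ≤ k ^ 5 * A by gcongr)
  refine (norm_add_le_of_le (norm_add_le_of_le (norm_add_le_of_le (norm_add_le_of_le n1 n2) n3) n4)
    n5).trans ?_
  rw [← hkh]
  have : k ^ 4 * ((1 + (3 * (M₁ + M₂) ^ 2 * |C 0| + A + B + |CS 0| + |CR 0|)) * k) ≤ k ^ 4 * η := by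
    gcongr
  nlinarith [pow_pos hk0 5]

/-! ### Vector fields in the cone. -/

theorem SmoothPeriodic.of_mem_G {g : ℝ → ℝ} (hg : g ∈ G) : SmoothPeriodic g := by
  obtain ⟨φ, hφ, rfl⟩ := hg
  exact hφ.deriv.pow 2

/-- Rescaling the phase by `√(a/3)` absorbs the coefficient; this is where nonnegativity of `a`
enters. -/
theorem consistent_transp_of_mem_G (hQ : Admissible Q) (hS : SpanCond Q) {g : ℝ → ℝ} (hg : g ∈ G)
    {a : ℝ} (ha : 0 ≤ a) : Consistent α Q (transp (fun x => a * g x)) := by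
  obtain ⟨φ, hφ, rfl⟩ := hg
  convert consistent_transp_sq (α := α) hQ hS (hφ.smul (√(a / 3))) using 3 with x
  rw [deriv_const_mul_field, mul_pow, Real.sq_sqrt (by positivity)]
  ring

theorem consistent_transp_cone (hQ : Admissible Q) (hS : SpanCond Q) {f : ℝ → ℝ} (hf : f ∈ coneG) :
    SmoothPeriodic f ∧ Consistent α Q (transp f) := by
  obtain ⟨m, a, g, -, ha, hg, rfl⟩ := hf
  have key : ∀ s : Finset (Fin m), SmoothPeriodic (fun x => ∑ j ∈ s, a j * g j x) ∧
      Consistent α Q (transp (fun x => ∑ j ∈ s, a j * g j x)) := by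
    intro s
    induction s using Finset.induction_on with
    | empty =>
      simp only [Finset.sum_empty]
      refine ⟨SmoothPeriodic.const 0, ?_⟩
      convert consistent_transp_sq (α := α) hQ hS (SmoothPeriodic.const (0 : ℝ)) using 3 with x
      simp
    | insert i s hi ih =>
      have h1 : SmoothPeriodic (fun x => a i * g i x) := (SmoothPeriodic.of_mem_G (hg i)).smul _
      simp only [Finset.sum_insert hi]
      refine ⟨h1.add_real ih.1, ?_⟩
      convert Consistent.add (smoothOp_transp h1) (smoothOp_transp ih.1)
        (consistent_transp_of_mem_G hQ hS (hg i) (ha i)) ih.2 using 3 with u x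
      rw [transp, transp, transp, ((h1.hasDerivAt x).fun_add (ih.1.hasDerivAt x)).deriv]
      push_cast
      ring
  exact key Finset.univ

end

section

/-! ### The flow of a smooth periodic vector field on the line -/

variable {f : ℝ → ℝ}

theorem SmoothPeriodic.lipschitz (hf : SmoothPeriodic f) : ∃ K, LipschitzWith K f := by
  obtain ⟨K, hK⟩ := exists_bound_of_periodic hf.deriv.1.continuous hf.deriv.2
  refine ⟨⟨K, (norm_nonneg _).trans (hK 0)⟩, ?_⟩
  exact lipschitzWith_of_nnnorm_deriv_le (fun x => (hf.hasDerivAt x).differentiableAt) hK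

/-- A field bounded by `M` cannot leave the ball of radius `M (n + 1)` in time `n + 1`, so
Picard-Lindelöf works on the whole interval at once. -/
theorem exists_integral_curve_Icc (hf : SmoothPeriodic f) (x : ℝ) (n : ℕ) :
    ∃ γ : ℝ → ℝ, γ 0 = x ∧ ∀ t ∈ Ioo (-((n : ℝ) + 1)) (n + 1), HasDerivAt γ (f (γ t)) t := by
  obtain ⟨M, hM⟩ := exists_bound_of_periodic hf.1.continuous hf.2
  obtain ⟨K, hK⟩ := hf.lipschitz
  have hM0 : 0 ≤ M := (norm_nonneg _).trans (hM 0)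
  have hn : (0 : ℝ) ≤ n + 1 := by positivity
  have hPL : IsPicardLindelof (fun _ => f)
      (⟨0, by linarith, hn⟩ : Icc (-((n : ℝ) + 1)) (n + 1)) x
      (⟨M, hM0⟩ * ⟨n + 1, hn⟩) 0 ⟨M, hM0⟩ K := by
    refine ⟨fun t _ => hK.lipschitzOnWith, fun _ _ => continuousOn_const, fun _ _ y _ => hM y, ?_⟩
    change M * max ((n : ℝ) + 1 - 0) (0 - -((n : ℝ) + 1)) ≤ M * (n + 1) - 0
    simp
  obtain ⟨γ, h0, h⟩ := hPL.exists_eq_forall_mem_Icc_hasDerivWithinAt₀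
  exact ⟨γ, h0, fun t ht => (h t (Ioo_subset_Icc_self ht)).hasDerivAt (Icc_mem_nhds ht.1 ht.2)⟩

theorem exists_integral_curve (hf : SmoothPeriodic f) (x : ℝ) :
    ∃ γ : ℝ → ℝ, γ 0 = x ∧ ∀ t, HasDerivAt γ (f (γ t)) t := by
  obtain ⟨K, hK⟩ := hf.lipschitz
  choose γ h0 h using exists_integral_curve_Icc hf x
  have hmem : ∀ (n : ℕ) (t : ℝ), t ∈ Ioo (-((n : ℝ) + 1)) (n + 1) ↔ |t| < n + 1 := fun n t =>
    abs_lt.symm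
  have heq : ∀ m n : ℕ, m ≤ n → ∀ t : ℝ, |t| < m + 1 → γ m t = γ n t := fun m n hmn t ht => by
    have hm : (0 : ℝ) < m + 1 := by positivity
    have hmn' : (m : ℝ) ≤ n := by exact_mod_cast hmn
    refine ODE_solution_unique_of_mem_Ioo (v := fun _ => f) (s := fun _ => univ)
      (fun _ _ => hK.lipschitzOnWith) (t₀ := 0) (a := -((m : ℝ) + 1)) (b := m + 1)
      ⟨by linarith, hm⟩ (fun s hs => ⟨h m s hs, trivial⟩)
      (fun s hs => ⟨h n s ⟨by linarith [hs.1], by linarith [hs.2]⟩, trivial⟩) ?_ ((hmem m t).2 ht)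
    rw [h0, h0]
  -- By uniqueness the curves agree where both are defined, so near `t` this glued curve coincides
  -- with a single `γ N`.
  refine ⟨fun t => γ ⌈|t|⌉₊ t, h0 _, fun t => ?_⟩
  have hlt : ∀ s : ℝ, |s| < ⌈|s|⌉₊ + 1 := fun s => (Nat.le_ceil _).trans_lt (lt_add_one _)
  set N := ⌈|t|⌉₊ + 1
  have htN : |t| < N := by simpa [N] using hlt t
  have hev : (fun s => γ ⌈|s|⌉₊ s) =ᶠ[𝓝 t] γ N := by
    filter_upwards [(continuous_abs.tendsto t).eventually_lt_const htN] with s hs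
    exact heq _ _ (Nat.ceil_le.2 hs.le) s (hlt s)
  have h1 := (h N t ((hmem N t).2 (by linarith))).congr_of_eventuallyEq hev
  rwa [← hev.eq_of_nhds] at h1

open Classical in
/-- The flow of a smooth periodic vector field (the identity for any other vector field). -/
def flow (f : ℝ → ℝ) (t x : ℝ) : ℝ :=
  if hf : SmoothPeriodic f then (exists_integral_curve hf x).choose t else x

theorem flow_zero (f : ℝ → ℝ) (x : ℝ) : flow f 0 x = x := by
  by_cases hf : SmoothPeriodic f
  · rw [flow, dif_pos hf]; exact (exists_integral_curve hf x).choose_spec.1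
  · rw [flow, dif_neg hf]

theorem hasDerivAt_flow (hf : SmoothPeriodic f) (x t : ℝ) :
    HasDerivAt (fun t => flow f t x) (f (flow f t x)) t := by
  have := (exists_integral_curve hf x).choose_spec.2 t
  simpa only [flow, dif_pos hf] using this

theorem continuous_flow_time (hf : SmoothPeriodic f) (x : ℝ) : Continuous fun t => flow f t x :=
  continuous_iff_continuousAt.2 fun t => (hasDerivAt_flow hf x t).continuousAt

theorem flow_unique (hf : SmoothPeriodic f) {γ : ℝ → ℝ} (hγ : ∀ t, HasDerivAt γ (f (γ t)) t)
    (t : ℝ) : γ t = flow f t (γ 0) := by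
  obtain ⟨K, hK⟩ := hf.lipschitz
  have := ODE_solution_unique_univ (v := fun _ => f) (s := fun _ => univ) (t₀ := 0)
    (fun _ => hK.lipschitzOnWith) (fun t => ⟨hγ t, trivial⟩)
    (fun t => ⟨hasDerivAt_flow hf (γ 0) t, trivial⟩) (flow_zero f (γ 0)).symm
  exact congrFun this t

theorem flow_add (hf : SmoothPeriodic f) (s t x : ℝ) : flow f (s + t) x = flow f s (flow f t x) := by
  have := flow_unique hf (γ := fun s => flow f (s + t) x)
    (fun s => (hasDerivAt_flow hf x (s + t)).comp_add_const s t) s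
  simpa using this

theorem flow_add_period (hf : SmoothPeriodic f) (t x : ℝ) :
    flow f t (x + 2 * π) = flow f t x + 2 * π := by
  have := flow_unique hf (γ := fun t => flow f t x + 2 * π) (fun t => by
    rw [hf.2]; exact (hasDerivAt_flow hf x t).add_const _) t
  simpa [flow_zero] using this.symm

/-- The divided difference of `f`. -/
def divDiff (f : ℝ → ℝ) (a b : ℝ) : ℝ := ∫ θ in (0 : ℝ)..1, deriv f (a + θ * (b - a))

theorem continuous_divDiff (hf : SmoothPeriodic f) :
    Continuous fun p : ℝ × ℝ => divDiff f p.1 p.2 := by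
  refine intervalIntegral.continuous_parametric_intervalIntegral_of_continuous'
    (f := fun (p : ℝ × ℝ) θ => deriv f (p.1 + θ * (p.2 - p.1))) ?_ 0 1
  exact hf.deriv.1.continuous.comp (by fun_prop)

theorem divDiff_self (f : ℝ → ℝ) (a : ℝ) : divDiff f a a = deriv f a := by simp [divDiff]

theorem sub_eq_mul_divDiff (hf : SmoothPeriodic f) (a b : ℝ) :
    f b - f a = (b - a) * divDiff f a b := by
  have h : ∀ θ ∈ uIcc (0 : ℝ) 1, HasDerivAt (fun θ => f (a + θ * (b - a)))
      ((b - a) * deriv f (a + θ * (b - a))) θ := fun θ _ => by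
    have h1 : HasDerivAt (fun θ => a + θ * (b - a)) (b - a) θ := by
      simpa using ((hasDerivAt_id θ).mul_const (b - a)).const_add a
    have := (hf.hasDerivAt (a + θ * (b - a))).comp θ h1
    rwa [mul_comm] at this
  have h2 := intervalIntegral.integral_eq_sub_of_hasDerivAt h
    (Continuous.intervalIntegrable
      (continuous_const.mul (hf.deriv.1.continuous.comp (by fun_prop))) _ _)
  rw [intervalIntegral.integral_const_mul] at h2
  rw [divDiff, h2]
  simp

theorem abs_divDiff_le {K : ℝ} (hK : ∀ x, |deriv f x| ≤ K) (a b : ℝ) : |divDiff f a b| ≤ K := by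
  have := intervalIntegral.norm_integral_le_of_norm_le_const (a := 0) (b := 1)
    (f := fun θ => deriv f (a + θ * (b - a))) (C := K) fun θ _ => hK _
  simpa [divDiff] using this

/-- The difference of two trajectories solves a scalar linear equation whose coefficient is the
divided difference of `f`; an integrating factor solves it. Letting `y → x` later gives the spatial
derivative without a variational equation. -/
theorem flow_sub_flow (hf : SmoothPeriodic f) (t x y : ℝ) :
    flow f t y - flow f t x =
      (y - x) * Real.exp (∫ s in (0)..t, divDiff f (flow f s x) (flow f s y)) := by
  set d : ℝ → ℝ := fun s => divDiff f (flow f s x) (flow f s y) with hd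
  have hdc : Continuous d :=
    (continuous_divDiff hf).comp ((continuous_flow_time hf x).prodMk (continuous_flow_time hf y))
  have h1 : ∀ s, HasDerivAt (fun s => ∫ r in (0)..s, d r) (d s) s := fun s =>
    hdc.integral_hasStrictDerivAt 0 s |>.hasDerivAt
  have h2 : ∀ s, HasDerivAt (fun s => (flow f s y - flow f s x) *
      Real.exp (-∫ r in (0)..s, d r)) 0 s := fun s => by
    have := ((hasDerivAt_flow hf y s).fun_sub (hasDerivAt_flow hf x s)).fun_mul (h1 s).neg.exp
    refine this.congr_deriv ?_
    rw [sub_eq_mul_divDiff hf]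
    simp only [hd, Pi.neg_apply]
    ring
  have h3 := is_const_of_deriv_eq_zero (fun s => (h2 s).differentiableAt)
    (fun s => (h2 s).deriv) t 0
  simp only [flow_zero, intervalIntegral.integral_same, neg_zero, Real.exp_zero, mul_one] at h3
  rw [← h3, mul_assoc, ← Real.exp_add]
  simp

theorem continuous_flow (hf : SmoothPeriodic f) : Continuous fun p : ℝ × ℝ => flow f p.1 p.2 := by
  obtain ⟨K, hK⟩ := exists_bound_of_periodic hf.deriv.1.continuous hf.deriv.2
  rw [continuous_iff_continuousAt]
  rintro ⟨t, x⟩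
  have h1 : ∀ s y, |flow f s y - flow f s x| ≤ |y - x| * Real.exp (K * |s|) := fun s y => by
    rw [flow_sub_flow hf, abs_mul, Real.abs_exp]
    gcongr
    have := intervalIntegral.norm_integral_le_of_norm_le_const (a := 0) (b := s)
      (f := fun r => divDiff f (flow f r x) (flow f r y)) (C := K) fun r _ => abs_divDiff_le hK _ _
    rw [sub_zero] at this
    exact (le_abs_self _).trans this
  have h2 : Tendsto (fun p : ℝ × ℝ => flow f p.1 p.2 - flow f p.1 x) (𝓝 (t, x)) (𝓝 0) := by
    refine squeeze_zero_norm (fun p => h1 p.1 p.2) ?_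
    have : Tendsto (fun p : ℝ × ℝ => |p.2 - x| * Real.exp (K * |p.1|)) (𝓝 (t, x))
        (𝓝 (|x - x| * Real.exp (K * |t|))) := Continuous.tendsto (by fun_prop) (t, x)
    simpa using this
  have h3 : Tendsto (fun p : ℝ × ℝ => flow f p.1 x) (𝓝 (t, x)) (𝓝 (flow f t x)) :=
    ((continuous_flow_time hf x).comp continuous_fst).tendsto (t, x)
  have h4 := h2.add h3
  simp only [sub_add_cancel, zero_add] at h4
  exact h4

theorem hasDerivAt_flow_space (hf : SmoothPeriodic f) (t x : ℝ) :
    HasDerivAt (flow f t) (Real.exp (∫ s in (0)..t, deriv f (flow f s x))) x := by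
  set H : ℝ → ℝ := fun y => Real.exp (∫ s in (0)..t, divDiff f (flow f s x) (flow f s y)) with hH
  have hHc : Continuous H := by
    refine Real.continuous_exp.comp
      (intervalIntegral.continuous_parametric_intervalIntegral_of_continuous'
        (f := fun y s => divDiff f (flow f s x) (flow f s y)) ?_ 0 t)
    exact (continuous_divDiff hf).comp (((continuous_flow_time hf x).comp continuous_snd).prodMk
      ((continuous_flow hf).comp continuous_swap))
  rw [hasDerivAt_iff_tendsto_slope]
  have h1 : H x = Real.exp (∫ s in (0)..t, deriv f (flow f s x)) := by
    simp only [hH, divDiff_self]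
  rw [← h1]
  refine ((hHc.tendsto x).mono_left nhdsWithin_le_nhds).congr' ?_
  filter_upwards [self_mem_nhdsWithin] with y hy
  have : y - x ≠ 0 := sub_ne_zero.2 hy
  rw [slope_def_field, flow_sub_flow hf, mul_div_cancel_left₀ _ this]

/-! ### Families of functions with locally uniformly bounded derivatives -/

/-- `g t x` is continuous in `t` and bounded for `t` in bounded sets. -/
def LocBdd (g : ℝ → ℝ → ℂ) : Prop :=
  (∀ R, ∃ C, ∀ t, |t| ≤ R → ∀ x, ‖g t x‖ ≤ C) ∧ ∀ x, Continuous fun t => g t x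

/-- `g t x` has `n` derivatives in `x`, which are continuous in `t` and bounded for `t` in bounded
sets. -/
def SmoothFam : ℕ → (ℝ → ℝ → ℂ) → Prop
  | 0, g => LocBdd g
  | n + 1, g => LocBdd g ∧ ∃ g', SmoothFam n g' ∧ ∀ t x, HasDerivAt (g t) (g' t x) x

theorem LocBdd.add {g h : ℝ → ℝ → ℂ} (hg : LocBdd g) (hh : LocBdd h) :
    LocBdd fun t x => g t x + h t x := by
  refine ⟨fun R => ?_, fun x => (hg.2 x).add (hh.2 x)⟩
  obtain ⟨C, hC⟩ := hg.1 R
  obtain ⟨D, hD⟩ := hh.1 R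
  exact ⟨C + D, fun t ht x => norm_add_le_of_le (hC t ht x) (hD t ht x)⟩

theorem LocBdd.mul {g h : ℝ → ℝ → ℂ} (hg : LocBdd g) (hh : LocBdd h) :
    LocBdd fun t x => g t x * h t x := by
  refine ⟨fun R => ?_, fun x => (hg.2 x).mul (hh.2 x)⟩
  obtain ⟨C, hC⟩ := hg.1 R
  obtain ⟨D, hD⟩ := hh.1 R
  exact ⟨C * D, fun t ht x => norm_mul_le_of_le (hC t ht x) (hD t ht x)⟩

theorem LocBdd.cexp {g : ℝ → ℝ → ℂ} (hg : LocBdd g) : LocBdd fun t x => Complex.exp (g t x) := by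
  refine ⟨fun R => ?_, fun x => (hg.2 x).cexp⟩
  obtain ⟨C, hC⟩ := hg.1 R
  exact ⟨Real.exp C, fun t ht x => (Complex.norm_exp_le_exp_norm _).trans
    (Real.exp_le_exp.2 (hC t ht x))⟩

theorem LocBdd.integral {g : ℝ → ℝ → ℂ} (hg : LocBdd g) :
    LocBdd fun t x => ∫ s in (0)..t, g s x := by
  refine ⟨fun R => ?_, fun x => intervalIntegral.continuous_primitive
    (fun a b => (hg.2 x).intervalIntegrable a b) 0⟩
  obtain ⟨C, hC⟩ := hg.1 R
  refine ⟨C * R, fun t ht x => ?_⟩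
  have hC0 : 0 ≤ C := (norm_nonneg _).trans (hC t ht x)
  have := intervalIntegral.norm_integral_le_of_norm_le_const (a := 0) (b := t)
    (f := fun s => g s x) (C := C) fun s hs => hC s (by
      have := abs_sub_left_of_mem_uIcc (uIoc_subset_uIcc hs)
      simp only [sub_zero] at this
      exact this.trans ht) x
  rw [sub_zero] at this
  exact this.trans (by gcongr)

namespace SmoothFam

theorem locBdd {n : ℕ} {g : ℝ → ℝ → ℂ} (hg : SmoothFam n g) : LocBdd g := by
  cases n with
  | zero => exact hg
  | succ n => exact hg.1

theorem pred {n : ℕ} {g : ℝ → ℝ → ℂ} (hg : SmoothFam (n + 1) g) : SmoothFam n g := by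
  induction n generalizing g with
  | zero => exact hg.1
  | succ n ih =>
    obtain ⟨h0, g', hg', hd⟩ := hg
    exact ⟨h0, g', ih hg', hd⟩

theorem add {n : ℕ} {g h : ℝ → ℝ → ℂ} (hg : SmoothFam n g) (hh : SmoothFam n h) :
    SmoothFam n fun t x => g t x + h t x := by
  induction n generalizing g h with
  | zero => exact LocBdd.add hg hh
  | succ n ih =>
    obtain ⟨h0, g', hg', hd⟩ := hg
    obtain ⟨k0, h', hh', kd⟩ := hh
    exact ⟨h0.add k0, _, ih hg' hh', fun t x => (hd t x).fun_add (kd t x)⟩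

theorem mul {n : ℕ} {g h : ℝ → ℝ → ℂ} (hg : SmoothFam n g) (hh : SmoothFam n h) :
    SmoothFam n fun t x => g t x * h t x := by
  induction n generalizing g h with
  | zero => exact LocBdd.mul hg hh
  | succ n ih =>
    have pg := hg.pred
    have ph := hh.pred
    obtain ⟨h0, g', hg', hd⟩ := hg
    obtain ⟨k0, h', hh', kd⟩ := hh
    exact ⟨h0.mul k0, _, (ih hg' ph).add (ih pg hh'), fun t x => (hd t x).fun_mul (kd t x)⟩

theorem cexp {n : ℕ} {g : ℝ → ℝ → ℂ} (hg : SmoothFam n g) :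
    SmoothFam n fun t x => Complex.exp (g t x) := by
  induction n with
  | zero => exact LocBdd.cexp hg
  | succ n ih =>
    have pg := ih hg.pred
    obtain ⟨h0, g', hg', hd⟩ := hg
    exact ⟨h0.cexp, _, pg.mul hg', fun t x => (hd t x).cexp⟩

theorem integral {n : ℕ} {g : ℝ → ℝ → ℂ} (hg : SmoothFam n g) :
    SmoothFam n fun t x => ∫ s in (0)..t, g s x := by
  induction n generalizing g with
  | zero => exact LocBdd.integral hg
  | succ n ih =>
    obtain ⟨h0, g', hg', hd⟩ := hg
    refine ⟨h0.integral, _, ih hg', fun t x => ?_⟩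
    obtain ⟨C, hC⟩ := hg'.locBdd.1 |t|
    refine (intervalIntegral.hasDerivAt_integral_of_dominated_loc_of_deriv_le (μ := volume)
      (a := 0) (b := t) (F := fun x s => g s x) (F' := fun x s => g' s x) (bound := fun _ => C)
      (s := univ) Filter.univ_mem ?_ ?_ ?_ ?_ ?_ ?_).2
    · exact Eventually.of_forall fun y => (h0.2 y).aestronglyMeasurable
    · exact (h0.2 x).intervalIntegrable _ _
    · exact (hg'.locBdd.2 x).aestronglyMeasurable
    · refine Eventually.of_forall fun s hs y _ => hC s ?_ y
      have := abs_sub_left_of_mem_uIcc (uIoc_subset_uIcc hs)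
      simpa using this
    · exact intervalIntegrable_const
    · exact Eventually.of_forall fun s _ y _ => hd s y

theorem norm_iteratedDeriv_le {k n : ℕ} (hk : k ≤ n) {g : ℝ → ℝ → ℂ} (hg : SmoothFam n g) (R : ℝ) :
    ∃ C, ∀ t, |t| ≤ R → ∀ x, ‖iteratedDeriv k (g t) x‖ ≤ C := by
  induction k generalizing n g with
  | zero => simpa using hg.locBdd.1 R
  | succ k ih =>
    obtain ⟨n, rfl⟩ : ∃ m, n = m + 1 := ⟨n - 1, by omega⟩
    obtain ⟨h0, g', hg', hd⟩ := hg
    obtain ⟨C, hC⟩ := ih (by omega) hg'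
    refine ⟨C, fun t ht x => ?_⟩
    rw [iteratedDeriv_succ', show deriv (g t) = g' t from funext fun x => (hd t x).deriv]
    exact hC t ht x

theorem contDiff {n : ℕ} {g : ℝ → ℝ → ℂ} (hg : SmoothFam (n + 1) g) (t : ℝ) :
    ContDiff ℝ n (g t) := by
  induction n generalizing g with
  | zero =>
    obtain ⟨-, g', -, hd⟩ := hg
    exact contDiff_zero.2 (continuous_iff_continuousAt.2 fun x => (hd t x).continuousAt)
  | succ n ih =>
    obtain ⟨h0, g', hg', hd⟩ := hg
    push_cast
    refine contDiff_succ_iff_deriv.2 ⟨fun x => (hd t x).differentiableAt, by simp, ?_⟩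
    rw [show deriv (g t) = g' t from funext fun x => (hd t x).deriv]
    exact ih hg'

theorem exists_bd {g : ℝ → ℝ → ℂ} (hg : ∀ n, SmoothFam n g)
    (hp : ∀ t, Function.Periodic (g t) (2 * π)) (R : ℝ) : ∃ C, ∀ t, |t| ≤ R → Bd C (g t) := by
  choose C hC using fun k => norm_iteratedDeriv_le (le_refl k) (hg k) R
  exact ⟨C, fun t ht => ⟨⟨contDiff_infty.2 fun n => (hg (n + 1)).contDiff t, hp t⟩,
    fun k x => hC k t ht x⟩⟩

end SmoothFam

end

section

open scoped ComplexConjugate InnerProductSpace ENNReal NNReal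

variable {f : ℝ → ℝ}

/-! ### The transport group on smooth functions -/

/-- The square root of the Jacobian of the flow. -/
def sqrtJac (f : ℝ → ℝ) (t x : ℝ) : ℂ :=
  Complex.exp (∫ s in (0)..t, ((deriv f (flow f s x) / 2 : ℝ) : ℂ))

/-- The transport group acting on functions. -/
def trGroup (f : ℝ → ℝ) (t : ℝ) (g : ℝ → ℂ) (x : ℝ) : ℂ := sqrtJac f t x * g (flow f t x)

theorem continuous_deriv_flow (hf : SmoothPeriodic f) (x : ℝ) :
    Continuous fun s => ((deriv f (flow f s x) / 2 : ℝ) : ℂ) :=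
  Complex.continuous_ofReal.comp
    ((hf.deriv.1.continuous.comp (continuous_flow_time hf x)).div_const 2)

theorem sqrtJac_mul_self (f : ℝ → ℝ) (t x : ℝ) :
    sqrtJac f t x * sqrtJac f t x =
      ((Real.exp (∫ s in (0)..t, deriv f (flow f s x)) : ℝ) : ℂ) := by
  rw [sqrtJac, ← Complex.exp_add, Complex.ofReal_exp, intervalIntegral.integral_ofReal,
    ← Complex.ofReal_add, intervalIntegral.integral_div]
  congr 2
  ring

theorem hasDerivAt_comp_flow (hf : SmoothPeriodic f) {h : ℝ → ℂ} (hh : SmoothPeriodic h) (t x : ℝ) :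
    HasDerivAt (fun x => h (flow f t x))
      (sqrtJac f t x * sqrtJac f t x * deriv h (flow f t x)) x := by
  have := (hh.hasDerivAt (flow f t x)).scomp x (hasDerivAt_flow_space hf t x)
  rw [sqrtJac_mul_self]
  refine this.congr_deriv ?_
  rw [Complex.real_smul]

theorem locBdd_comp_flow (hf : SmoothPeriodic f) {h : ℝ → ℂ} (hh : SmoothPeriodic h) :
    LocBdd fun t x => h (flow f t x) := by
  obtain ⟨C, hC⟩ := exists_bound_of_periodic hh.1.continuous hh.2
  exact ⟨fun R => ⟨C, fun t _ x => hC _⟩, fun x => hh.1.continuous.comp (continuous_flow_time hf x)⟩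

theorem smoothFam_comp_flow_succ (hf : SmoothPeriodic f) {n : ℕ} (hJ : SmoothFam n (sqrtJac f))
    {h : ℝ → ℂ} (hh : SmoothPeriodic h) : SmoothFam (n + 1) fun t x => h (flow f t x) := by
  induction n generalizing h with
  | zero =>
    exact ⟨locBdd_comp_flow hf hh, _, (hJ.mul hJ).mul (n := 0) (locBdd_comp_flow hf hh.deriv),
      fun t x => hasDerivAt_comp_flow hf hh t x⟩
  | succ n ih =>
    exact ⟨locBdd_comp_flow hf hh, _, (hJ.mul hJ).mul (ih hJ.pred hh.deriv),
      fun t x => hasDerivAt_comp_flow hf hh t x⟩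

theorem smoothPeriodic_half_deriv (hf : SmoothPeriodic f) :
    SmoothPeriodic (fun x => ((deriv f x / 2 : ℝ) : ℂ)) := by
  simpa [div_eq_inv_mul] using (hf.deriv.smul (1 / 2)).ofReal

/-- Bootstrap: the derivative of `h ∘ flow` is the Jacobian times `h' ∘ flow`, so `n` derivatives of
the Jacobian give `n + 1` of `h ∘ flow`; integrating in time and exponentiating returns them to the
Jacobian. -/
theorem smoothFam_sqrtJac (hf : SmoothPeriodic f) (n : ℕ) : SmoothFam n (sqrtJac f) := by
  have hh := smoothPeriodic_half_deriv hf
  induction n with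
  | zero => exact SmoothFam.cexp (SmoothFam.integral (n := 0) (locBdd_comp_flow hf hh))
  | succ n ih => exact SmoothFam.cexp (SmoothFam.integral (smoothFam_comp_flow_succ hf ih hh))

theorem smoothFam_trGroup (hf : SmoothPeriodic f) {g : ℝ → ℂ} (hg : SmoothPeriodic g) (n : ℕ) :
    SmoothFam n (fun t => trGroup f t g) :=
  (smoothFam_sqrtJac hf n).mul (smoothFam_comp_flow_succ hf (smoothFam_sqrtJac hf n) hg).pred

theorem sqrtJac_add_period (hf : SmoothPeriodic f) (t x : ℝ) :
    sqrtJac f t (x + 2 * π) = sqrtJac f t x := by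
  simp only [sqrtJac, flow_add_period hf, hf.deriv.2 _]

theorem periodic_trGroup (hf : SmoothPeriodic f) {g : ℝ → ℂ} (hg : SmoothPeriodic g) (t : ℝ) :
    Function.Periodic (trGroup f t g) (2 * π) := fun x => by
  rw [trGroup, trGroup, sqrtJac_add_period hf, flow_add_period hf, hg.2]

theorem exists_bd_trGroup (hf : SmoothPeriodic f) {g : ℝ → ℂ} (hg : SmoothPeriodic g) (R : ℝ) :
    ∃ C, ∀ t, |t| ≤ R → Bd C (trGroup f t g) :=
  SmoothFam.exists_bd (smoothFam_trGroup hf hg) (periodic_trGroup hf hg) R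

theorem SmoothPeriodic.trGroup (hf : SmoothPeriodic f) (t : ℝ) {g : ℝ → ℂ} (hg : SmoothPeriodic g) :
    SmoothPeriodic (trGroup f t g) :=
  let ⟨_, hC⟩ := exists_bd_trGroup hf hg |t|
  (hC t le_rfl).1

theorem sqrtJac_zero (f : ℝ → ℝ) (x : ℝ) : sqrtJac f 0 x = 1 := by simp [sqrtJac]

theorem trGroup_zero (f : ℝ → ℝ) (g : ℝ → ℂ) : trGroup f 0 g = g := by
  funext x; rw [trGroup, sqrtJac_zero, flow_zero, one_mul]

/-- The cocycle identity behind the group law. -/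
theorem sqrtJac_add (hf : SmoothPeriodic f) (s t x : ℝ) :
    sqrtJac f (t + s) x = sqrtJac f s x * sqrtJac f t (flow f s x) := by
  have hc := continuous_deriv_flow hf x
  rw [sqrtJac, sqrtJac, sqrtJac, ← Complex.exp_add,
    ← intervalIntegral.integral_add_adjacent_intervals (hc.intervalIntegrable 0 s)
      (hc.intervalIntegrable s (t + s))]
  congr 2
  have := intervalIntegral.integral_comp_add_right (a := 0) (b := t)
    (fun r => ((deriv f (flow f r x) / 2 : ℝ) : ℂ)) s
  rw [zero_add] at this
  rw [← this]
  simp only [flow_add hf]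

theorem trGroup_add (hf : SmoothPeriodic f) (s t : ℝ) (g : ℝ → ℂ) :
    trGroup f (s + t) g = trGroup f s (trGroup f t g) := by
  funext x
  rw [trGroup, trGroup, trGroup, add_comm s t, sqrtJac_add hf, flow_add hf, mul_assoc]

theorem hasDerivAt_trGroup (hf : SmoothPeriodic f) {g : ℝ → ℂ} (hg : SmoothPeriodic g) (t x : ℝ) :
    HasDerivAt (fun t => trGroup f t g x) (trGroup f t (transp f g) x) t := by
  have h1 : HasDerivAt (fun t => ∫ s in (0)..t, ((deriv f (flow f s x) / 2 : ℝ) : ℂ))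
      ((deriv f (flow f t x) / 2 : ℝ) : ℂ) t :=
    ((continuous_deriv_flow hf x).integral_hasStrictDerivAt 0 t).hasDerivAt
  have h2 := (hg.hasDerivAt (flow f t x)).scomp t (hasDerivAt_flow hf x t)
  refine (h1.cexp.fun_mul h2).congr_deriv ?_
  rw [trGroup, transp, Complex.real_smul, sqrtJac, Function.comp_apply]
  push_cast
  ring

theorem exists_norm_trGroup_le (hf : SmoothPeriodic f) :
    ∃ B, 0 ≤ B ∧ ∀ t, |t| ≤ 1 → ∀ g M, (∀ x, ‖g x‖ ≤ M) → ∀ x, ‖trGroup f t g x‖ ≤ B * M := by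
  obtain ⟨B, hB⟩ := (smoothFam_sqrtJac hf 0).locBdd.1 1
  have hB0 : 0 ≤ B := (norm_nonneg _).trans (hB 0 (by simp) 0)
  refine ⟨B, hB0, fun t ht g M hg x => ?_⟩
  rw [trGroup, norm_mul]
  exact mul_le_mul (hB t ht x) (hg _) (norm_nonneg _) hB0

/-- Two mean value inequalities in time, pointwise in `x`, based on `∂ₜ V_t g = V_t T_f g`. -/
theorem exists_trGroup_taylor (hf : SmoothPeriodic f) :
    ∃ B, 0 ≤ B ∧ ∀ h, |h| ≤ 1 → ∀ g, SmoothPeriodic g → ∀ M,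
      (∀ x, ‖transp f (transp f g) x‖ ≤ M) →
      ‖cl (trGroup f h g) - cl g - (h : ℂ) • cl (transp f g)‖ ≤ B * M * h ^ 2 := by
  obtain ⟨B, hB0, hB⟩ := exists_norm_trGroup_le hf
  refine ⟨B, hB0, fun h hh g hg M hM => ?_⟩
  have hT := hf.transp hg
  have p1 := (hf.trGroup h hg).perCont
  rw [← cl_sub p1 hg.perCont, ← cl_const_mul _ hT.perCont,
    ← cl_sub (p1.sub hg.perCont) (hT.perCont.const_mul _)]
  refine norm_cl_le ((p1.sub hg.perCont).sub (hT.perCont.const_mul _)) fun x => ?_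
  have hseg : ∀ s ∈ uIcc 0 h, |s| ≤ |h| := fun s hs => by
    simpa using abs_sub_left_of_mem_uIcc hs
  have hM0 : 0 ≤ M := (norm_nonneg _).trans (hM 0)
  have d1 : ∀ s ∈ uIcc 0 h, ‖trGroup f s (transp f g) x - transp f g x‖ ≤ B * M * |h| :=
    fun s hs => by
    have := (convex_uIcc 0 h).norm_image_sub_le_of_norm_hasDerivWithin_le
      (f := fun t => trGroup f t (transp f g) x) (C := B * M)
      (fun t _ => (hasDerivAt_trGroup hf hT t x).hasDerivWithinAt)
      (fun t ht => hB t ((hseg t ht).trans hh) _ M hM x) left_mem_uIcc hs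
    simp only [trGroup_zero, sub_zero, Real.norm_eq_abs] at this
    exact this.trans (mul_le_mul_of_nonneg_left (hseg s hs) (mul_nonneg hB0 hM0))
  have d2 := (convex_uIcc 0 h).norm_image_sub_le_of_norm_hasDerivWithin_le
    (f := fun t => trGroup f t g x - (t : ℂ) * transp f g x) (C := B * M * |h|)
    (f' := fun t => trGroup f t (transp f g) x - transp f g x)
    (fun t _ => by
      have b := (hasDerivAt_trGroup hf hg t x).fun_sub
        ((Complex.ofRealCLM.hasDerivAt (x := t)).mul_const (transp f g x))
      refine b.hasDerivWithinAt.congr_deriv ?_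
      simp)
    (fun t ht => d1 t ht) left_mem_uIcc right_mem_uIcc
  simp only [trGroup_zero, Complex.ofReal_zero, zero_mul, sub_zero, Real.norm_eq_abs] at d2
  rw [sub_right_comm]
  refine d2.trans_eq ?_
  rw [mul_assoc (B * M), ← sq, sq_abs]

theorem hasDerivAt_cl_trGroup (hf : SmoothPeriodic f) {g : ℝ → ℂ} (hg : SmoothPeriodic g) (t : ℝ) :
    HasDerivAt (fun t => cl (trGroup f t g)) (cl (transp f (trGroup f t g))) t := by
  obtain ⟨B, hB0, hB⟩ := exists_trGroup_taylor hf
  have hgt := hf.trGroup t hg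
  obtain ⟨M, hM⟩ := exists_bound_of_periodic (hf.transp (hf.transp hgt)).1.continuous
    (hf.transp (hf.transp hgt)).2
  rw [hasDerivAt_iff_isLittleO]
  have ht0 : Tendsto (fun s => s - t) (𝓝 t) (𝓝 0) := by
    have : Tendsto (fun s => s - t) (𝓝 t) (𝓝 (t - t)) := Continuous.tendsto (by fun_prop) t
    simpa using this
  have h : (fun s => cl (trGroup f s g) - cl (trGroup f t g) -
      (s - t) • cl (transp f (trGroup f t g))) =O[𝓝 t] fun s => (s - t) ^ 2 := by
    apply Asymptotics.IsBigO.of_bound (B * M)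
    have h1 : ∀ᶠ s in 𝓝 t, |s - t| < 1 := by
      have h2 : Tendsto (fun s => |s - t|) (𝓝 t) (𝓝 |(0 : ℝ)|) := ht0.abs
      rw [abs_zero] at h2
      exact h2.eventually_lt_const one_pos
    filter_upwards [h1] with s hs
    have := hB (s - t) hs.le _ hgt M hM
    rw [← trGroup_add hf, sub_add_cancel] at this
    rw [Real.norm_of_nonneg (sq_nonneg _)]
    exact this
  refine h.trans_isLittleO ?_
  exact (Asymptotics.isLittleO_pow_id (𝕜 := ℝ) one_lt_two).comp_tendsto ht0

/-- Skew-symmetry of `T_f`: integrating `f∂ₓ` by parts produces a term in `f'`, of which `f'/2` is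
exactly half. -/
theorem inner_transp (hf : SmoothPeriodic f) {g χ : ℝ → ℂ} (hg : SmoothPeriodic g)
    (hχ : SmoothPeriodic χ) : ⟪cl (transp f g), cl χ⟫_ℂ = -⟪cl g, cl (transp f χ)⟫_ℂ := by
  have hr := hf.ofReal
  have hh := smoothPeriodic_half_deriv hf
  have e : ∀ {u : ℝ → ℂ}, SmoothPeriodic u → cl (transp f u) =
      cl (fun x => (f x : ℂ) * deriv u x) + cl (fun x => ((deriv f x / 2 : ℝ) : ℂ) * u x) :=
    fun {u} hu => by
    rw [← cl_add (hr.mul hu.deriv).perCont (hh.mul hu).perCont]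
    congr 1
    funext x
    rw [transp]
    push_cast
    ring
  have hc1 : (fun x => conj ((f x : ℝ) : ℂ)) = fun x => ((f x : ℝ) : ℂ) := by funext x; simp
  have hc2 : (fun x => conj ((deriv f x / 2 : ℝ) : ℂ)) = fun x => ((deriv f x / 2 : ℝ) : ℂ) := by
    funext x; rw [Complex.conj_ofReal]
  have e1 : ⟪cl (fun x => (f x : ℂ) * deriv g x), cl χ⟫_ℂ =
      ⟪cl (deriv g), cl (fun x => (f x : ℂ) * χ x)⟫_ℂ := by
    rw [← mulL_cl hr.perCont hg.deriv.perCont, inner_mulL hr.perCont, hc1,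
      mulL_cl hr.perCont hχ.perCont]
  have e2 : ⟪cl (fun x => ((deriv f x / 2 : ℝ) : ℂ) * g x), cl χ⟫_ℂ =
      ⟪cl g, cl (fun x => ((deriv f x / 2 : ℝ) : ℂ) * χ x)⟫_ℂ := by
    rw [← mulL_cl hh.perCont hg.perCont, inner_mulL hh.perCont, hc2, mulL_cl hh.perCont hχ.perCont]
  have e3 : cl (deriv (fun x => (f x : ℂ) * χ x)) = cl (fun x => (f x : ℂ) * deriv χ x) +
      (cl (fun x => ((deriv f x / 2 : ℝ) : ℂ) * χ x) +
        cl (fun x => ((deriv f x / 2 : ℝ) : ℂ) * χ x)) := by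
    rw [← cl_add (hh.mul hχ).perCont (hh.mul hχ).perCont,
      ← cl_add (hr.mul hχ.deriv).perCont ((hh.mul hχ).add (hh.mul hχ)).perCont]
    congr 1
    funext x
    rw [((hf.hasDerivAt x).ofReal_comp.fun_mul (hχ.hasDerivAt x)).deriv]
    push_cast
    ring
  rw [e hg, e hχ, inner_add_left, e1, e2, inner_deriv hg (hr.mul hχ), e3]
  simp only [inner_add_right]
  ring

/-- Skew-symmetry of the generator gives conservation of the norm, with no change of variables in
the integral. -/
theorem norm_cl_trGroup (hf : SmoothPeriodic f) {g : ℝ → ℂ} (hg : SmoothPeriodic g) (t : ℝ) :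
    ‖cl (trGroup f t g)‖ = ‖cl g‖ := by
  have h1 : ∀ s, HasDerivAt (fun s => ⟪cl (trGroup f s g), cl (trGroup f s g)⟫_ℂ) 0 s := fun s => by
    have hd := hasDerivAt_cl_trGroup hf hg s
    refine (hd.inner ℂ hd).congr_deriv ?_
    have hs := hf.trGroup s hg
    rw [inner_transp hf hs hs, add_neg_cancel]
  have h2 := is_const_of_deriv_eq_zero (fun s => (h1 s).differentiableAt) (fun s => (h1 s).deriv) t 0
  simp only [trGroup_zero] at h2
  rw [inner_self_eq_norm_sq_to_K, inner_self_eq_norm_sq_to_K] at h2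
  have h3 : ‖cl (trGroup f t g)‖ ^ 2 = ‖cl g‖ ^ 2 := by exact_mod_cast h2
  exact (pow_left_inj₀ (norm_nonneg _) (norm_nonneg _) two_ne_zero).1 h3

/-! ### The transport group on `L²` -/

/-- The transport group as a linear map on smooth functions, with values in `L²`. -/
def trLin (hf : SmoothPeriodic f) (t : ℝ) : smoothSubmodule →ₗ[ℂ] L2 where
  toFun g := cl (trGroup f t g.1)
  map_add' g h := by
    rw [← cl_add (hf.trGroup t g.2).perCont (hf.trGroup t h.2).perCont]
    congr 1
    funext x
    exact mul_add _ _ _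
  map_smul' c g := by
    rw [RingHom.id_apply, ← cl_const_mul c (hf.trGroup t g.2).perCont]
    congr 1
    funext x
    exact mul_left_comm _ _ _

theorem norm_trLin (hf : SmoothPeriodic f) (t : ℝ) (g : smoothSubmodule) :
    ‖trLin hf t g‖ ≤ 1 * ‖clLin g‖ := by
  rw [one_mul]
  exact (norm_cl_trGroup hf g.2 t).le

/-- The transport group on `L²`, as bounded operators. -/
def trL (hf : SmoothPeriodic f) (t : ℝ) : L2 →L[ℂ] L2 := (trLin hf t).extendOfNorm clLin

theorem trL_cl (hf : SmoothPeriodic f) (t : ℝ) {g : ℝ → ℂ} (hg : SmoothPeriodic g) :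
    trL hf t (cl g) = cl (trGroup f t g) :=
  LinearMap.extendOfNorm_eq denseRange_clLin ⟨1, norm_trLin hf t⟩ ⟨g, hg⟩

theorem eq_of_eq_on_smooth {F H : L2 → L2} (hF : Continuous F) (hH : Continuous H)
    (h : ∀ g, SmoothPeriodic g → F (cl g) = H (cl g)) (ψ : L2) : F ψ = H ψ :=
  congrFun (denseRange_clLin.equalizer hF hH (funext fun g => h g.1 g.2)) ψ

theorem norm_trL (hf : SmoothPeriodic f) (t : ℝ) (ψ : L2) : ‖trL hf t ψ‖ = ‖ψ‖ := by
  have h : (fun ψ : L2 => ‖trL hf t ψ‖) = fun ψ => ‖ψ‖ :=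
    denseRange_clLin.equalizer (by fun_prop) (by fun_prop) (funext fun g => by
      change ‖trL hf t (cl g.1)‖ = ‖cl g.1‖
      rw [trL_cl hf t g.2, norm_cl_trGroup hf g.2])
  exact congrFun h ψ

theorem trL_zero (hf : SmoothPeriodic f) (ψ : L2) : trL hf 0 ψ = ψ :=
  eq_of_eq_on_smooth (H := fun ψ => ψ) (by fun_prop) (by fun_prop)
    (fun g hg => by rw [trL_cl hf 0 hg, trGroup_zero]) ψ

theorem trL_add (hf : SmoothPeriodic f) (s t : ℝ) (ψ : L2) :
    trL hf (s + t) ψ = trL hf s (trL hf t ψ) :=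
  eq_of_eq_on_smooth (H := fun ψ => trL hf s (trL hf t ψ)) (by fun_prop) (by fun_prop)
    (fun g hg => by
      rw [trL_cl hf _ hg, trL_cl hf _ hg, trL_cl hf _ (hf.trGroup t hg), trGroup_add hf]) ψ

/-- The transport group on `L²`, as unitary operators. -/
def trU (hf : SmoothPeriodic f) (t : ℝ) : L2 ≃ₗᵢ[ℂ] L2 where
  toLinearEquiv := LinearEquiv.ofLinearMap (trL hf t).toLinearMap (trL hf (-t)).toLinearMap
    (by ext1 ψ; change trL hf t (trL hf (-t) ψ) = ψ; rw [← trL_add, add_neg_cancel, trL_zero])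
    (by ext1 ψ; change trL hf (-t) (trL hf t ψ) = ψ; rw [← trL_add, neg_add_cancel, trL_zero])
  norm_map' ψ := norm_trL hf t ψ

theorem trU_cl (hf : SmoothPeriodic f) (t : ℝ) {g : ℝ → ℂ} (hg : SmoothPeriodic g) :
    trU hf t (cl g) = cl (trGroup f t g) := trL_cl hf t hg

theorem trU_zero (hf : SmoothPeriodic f) (ψ : L2) : trU hf 0 ψ = ψ := trL_zero hf ψ

theorem trU_add (hf : SmoothPeriodic f) (s t : ℝ) (ψ : L2) :
    trU hf (s + t) ψ = trU hf s (trU hf t ψ) := trL_add hf s t ψ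

theorem continuous_trU (hf : SmoothPeriodic f) (ψ : L2) : Continuous fun t => trU hf t ψ :=
  continuous_of_isometry (V := fun t => trU hf t) (fun t => (trU hf t).isometry) (fun g hg => by
    simp only [trU_cl hf _ hg]
    exact continuous_iff_continuousAt.2 fun t => (hasDerivAt_cl_trGroup hf hg t).continuousAt) ψ

theorem inner_trU (hf : SmoothPeriodic f) (t : ℝ) (ψ φ : L2) :
    ⟪ψ, trU hf t φ⟫_ℂ = ⟪trU hf (-t) ψ, φ⟫_ℂ := by
  rw [← LinearIsometryEquiv.inner_map_map (trU hf t) (trU hf (-t) ψ) φ, ← trU_add, add_neg_cancel,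
    trU_zero]

theorem transportRel_iff (hf : SmoothPeriodic f) (ψ g : L2) :
    TransportRel f ψ g ↔ ∀ η, SmoothPeriodic η → ⟪cl η, g⟫_ℂ = -⟪cl (transp f η), ψ⟫_ℂ := by
  have hpi : (2 * π : ℂ) ≠ 0 := by exact_mod_cast Real.two_pi_pos.ne'
  have key : ∀ χ, SmoothPeriodic χ → ((∫ x in (0)..(2 * π), g (x : Torus) * χ x =
      - ∫ x in (0)..(2 * π), ψ (x : Torus) *
          ((f x : ℂ) * deriv χ x + ((deriv f x : ℝ) : ℂ) / 2 * χ x)) ↔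
      ⟪cl (fun x => conj (χ x)), g⟫_ℂ = -⟪cl (transp f (fun x => conj (χ x))), ψ⟫_ℂ) :=
    fun χ hχ => by
    have e : (fun x => conj (transp f χ x)) = transp f (fun x => conj (χ x)) := by
      funext x
      rw [transp, transp, deriv_conj_comp hχ]
      simp [map_ofNat]
    have e2 := pairing_eq ψ (hf.transp hχ).perCont
    simp only [e] at e2
    change _ = -(∫ x in (0)..(2 * π), ψ (x : Torus) * transp f χ x) ↔ _
    rw [pairing_eq g hχ.perCont, e2, ← mul_neg]
    exact mul_right_inj' hpi
  constructor
  · intro h η hη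
    have := (key _ hη.conjugate).1 (h _ hη.conjugate)
    simpa using this
  · intro h χ hχ
    exact (key χ hχ).2 (h _ hχ.conjugate)

/-- As `ψ` is arbitrary in `L²`, the flow is transferred to the smooth test function before
differentiating. -/
theorem hasDerivAt_inner_trU (hf : SmoothPeriodic f) {η : ℝ → ℂ} (hη : SmoothPeriodic η) (ψ : L2)
    (t : ℝ) : HasDerivAt (fun t => ⟪cl η, trU hf t ψ⟫_ℂ)
      (-⟪cl (transp f (trGroup f (-t) η)), ψ⟫_ℂ) t := by
  have h1 : HasDerivAt (fun t => cl (trGroup f (-t) η)) (-cl (transp f (trGroup f (-t) η))) t := by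
    have := (hasDerivAt_cl_trGroup hf hη (-t)).scomp t (hasDerivAt_neg t)
    simpa [Function.comp_def] using this
  have h2 := h1.inner ℂ (hasDerivAt_const t ψ)
  simp only [inner_trU, trU_cl hf _ hη]
  refine h2.congr_deriv ?_
  rw [inner_zero_right, zero_add, inner_neg_left]

theorem isTransportGroup_trU (hf : SmoothPeriodic f) : IsTransportGroup f (trU hf) where
  zero := trU_zero hf
  add := trU_add hf
  continuous := continuous_trU hf
  generator ψ g := by
    rw [transportRel_iff hf]
    constructor
    · intro h η hη
      have h1 : HasDerivAt (fun t => ⟪cl η, trU hf t ψ⟫_ℂ) ⟪cl η, g⟫_ℂ 0 := by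
        simpa using (hasDerivAt_const (0 : ℝ) (cl η)).inner ℂ h
      have h2 := hasDerivAt_inner_trU hf hη ψ 0
      rw [neg_zero, trGroup_zero] at h2
      exact h1.unique h2
    · intro h
      have hc := continuous_trU hf g
      have hI : ∀ t, HasDerivAt (fun t => ∫ s in (0)..t, trU hf s g) (trU hf t g) t := fun t =>
        (hc.integral_hasStrictDerivAt 0 t).hasDerivAt
      -- If `T_f ψ = g` weakly, then `V_t ψ = ψ + ∫₀ᵗ V_s g`, which is differentiable at zero: the
      -- domain of the generator is thus the maximal one. The identity is checked against smooth
      -- functions.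
      have key : ∀ t, trU hf t ψ = ψ + ∫ s in (0)..t, trU hf s g := fun t => by
        refine eq_of_inner_smooth fun η hη => ?_
        have h1 : ∀ s, HasDerivAt (fun s => ⟪cl η, trU hf s ψ⟫_ℂ -
            ⟪cl η, ψ + ∫ r in (0)..s, trU hf r g⟫_ℂ) 0 s := fun s => by
          have b1 := hasDerivAt_inner_trU hf hη ψ s
          -- The weak relation is applied to the transported test function, which is again smooth
          -- and periodic.
          rw [← h _ (hf.trGroup (-s) hη), ← trU_cl hf _ hη, ← inner_trU] at b1
          have b2 := (hasDerivAt_const s (cl η)).inner ℂ ((hI s).const_add ψ)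
          rw [inner_zero_left, add_zero] at b2
          refine (b1.fun_sub b2).congr_deriv (sub_self _)
        have h2 := is_const_of_deriv_eq_zero (fun s => (h1 s).differentiableAt)
          (fun s => (h1 s).deriv) t 0
        simp only [trU_zero, intervalIntegral.integral_same, add_zero, sub_self] at h2
        exact sub_eq_zero.1 h2
      have h3 := (hI 0).const_add ψ
      rw [trU_zero] at h3
      rwa [show (fun t => trU hf t ψ) = fun t => ψ + ∫ s in (0)..t, trU hf s g from funext key]

/-! ### Reachability of the transport group. -/

theorem ar_trU {q : ℕ} {α : ℝ} {Q : Fin q → ℝ → ℝ} (hf : SmoothPeriodic f)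
    (h : Consistent α Q (transp f)) {T : ℝ} (hT : 0 < T) : AR α Q 0 (trU hf T) := by
  refine h.ar (V := fun t => trU hf t) (trU_zero hf) (trU_add hf) (fun t => (trU hf t).isometry)
    (fun C η hη => ?_) (fun g hg T => ?_) hT
  · obtain ⟨B, hB0, hB⟩ := exists_trGroup_taylor hf
    obtain ⟨C', hC'⟩ := ((ub_transp hf).comp (ub_transp hf (ι := Unit))) C
    filter_upwards [eventually_small (B * C' 0) hη] with h ⟨h0, h1, hs⟩ g hg
    have := hB h (by rwa [abs_of_pos h0]) g hg.1 (C' 0) (hC' () g hg).norm_le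
    rw [trU_cl hf _ hg.1]
    refine this.trans ?_
    nlinarith
  · obtain ⟨C, hC⟩ := exists_bd_trGroup hf hg T
    exact ⟨C, fun t ht => ⟨_, hC t (by rw [abs_of_nonneg ht.1]; exact ht.2), trU_cl hf t hg⟩⟩

theorem AR.isSTAR {q : ℕ} {α : ℝ} {Q : Fin q → ℝ → ℝ} {S : L2 ≃ₗᵢ[ℂ] L2} (h : AR α Q 0 S) :
    IsSTAR α Q S := by
  intro ψ₀ _ ε hε
  obtain ⟨T, hT, U, -, hU, hε'⟩ := h.2 ψ₀ ε hε
  obtain ⟨u, hu, H⟩ := id hU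
  obtain ⟨ψ, hψ, hψT, -⟩ := H ψ₀
  -- No global phase is needed: `β = 0`.
  refine ⟨T, ⟨hU.nonneg, by simpa using hT⟩, 0, ⟨le_rfl, Real.two_pi_pos⟩, u, hu, ψ, hψ, ?_⟩
  rw [hψT]
  simpa using hε'

/-! ### Translations -/

theorem one_mem_coneG : (fun _ => 1 : ℝ → ℝ) ∈ coneG := by
  refine ⟨2, fun _ => 1, ![fun x => deriv Real.sin x ^ 2, fun x => deriv Real.cos x ^ 2],
    two_pos, fun _ => zero_le_one, fun j => ?_, ?_⟩
  · fin_cases j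
    · exact ⟨_, ⟨Real.contDiff_sin, Real.sin_periodic⟩, rfl⟩
    · exact ⟨_, ⟨Real.contDiff_cos, Real.cos_periodic⟩, rfl⟩
  · funext x
    simp

theorem trGroup_one (t : ℝ) (g : ℝ → ℂ) (x : ℝ) : trGroup (fun _ => 1) t g x = g (x + t) := by
  have h := flow_unique (SmoothPeriodic.const (1 : ℝ)) (γ := fun t => x + t)
    (fun t => (hasDerivAt_id' t).const_add x) t
  rw [add_zero] at h
  rw [trGroup, ← h, sqrtJac]
  simp

/-- Both sides are continuous in `ψ`, so the explicit flow `x + δ` need only be compared on smooth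
functions. -/
theorem trU_one (hf : SmoothPeriodic (fun _ : ℝ => (1 : ℝ))) (δ : ℝ) (ψ : L2) :
    trU hf δ ψ =ᵐ[AddCircle.haarAddCircle] fun x => ψ (x + (δ : Torus)) := by
  have hmp : MeasurePreserving (fun x : Torus => x + (δ : Torus)) haar haar :=
    measurePreserving_add_right haar _
  have hL : ∀ φ : L2, Lp.compMeasurePreserving _ hmp φ =ᵐ[haar] fun x => φ (x + (δ : Torus)) :=
    fun φ => Lp.coeFn_compMeasurePreserving φ hmp
  have key : trU hf δ ψ = Lp.compMeasurePreserving _ hmp ψ := by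
    refine eq_of_eq_on_smooth (F := fun ψ => trU hf δ ψ)
      (H := fun ψ => Lp.compMeasurePreserving _ hmp ψ) (trU hf δ).continuous
      (Lp.isometry_compMeasurePreserving hmp).continuous (fun g hg => ?_) ψ
    rw [trU_cl hf δ hg]
    apply Lp.ext
    have h1 := hmp.quasiMeasurePreserving.ae_eq_comp (coeFn_cl g)
    filter_upwards [coeFn_cl (trGroup (fun _ => 1) δ g), hL (cl g), h1] with x a b c
    rw [a, b]
    change _ = (cl g ∘ fun x : Torus => x + (δ : Torus)) x
    rw [c, Function.comp_apply]
    obtain ⟨y, rfl⟩ := QuotientAddGroup.mk_surjective x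
    have e1 := lift_coe (hf.trGroup δ hg).perCont y
    have e2 := lift_coe hg.perCont (y + δ)
    rw [AddCircle.coe_add] at e2
    exact e1.trans ((trGroup_one δ g y).trans e2.symm)
  rw [key]
  exact hL ψ

end

end KdVSch

end

theorem proposition4p7 (q : ℕ) (α : ℝ) (Q : Fin q → ℝ → ℝ)
    (hQcont : ∀ j, Continuous (Q j)) (hQper : ∀ j, Function.Periodic (Q j) (2 * π))
    (hQspan : ({fun _ => 1, fun x => Real.sin x, fun x => Real.cos x,
        fun x => Real.sin (2 * x), fun x => Real.cos (2 * x)} : Set (ℝ → ℝ)) ⊆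
      (Submodule.span ℝ (Set.range Q) : Set (ℝ → ℝ))) :
    -- for every `f` in the cone, `e^{T_f}` is `L²`-STAR
    (∀ f ∈ KdVSch.coneG, ∃ V : ℝ → KdVSch.L2 ≃ₗᵢ[ℂ] KdVSch.L2,
        KdVSch.IsTransportGroup f V ∧ KdVSch.IsSTAR α Q (V 1)) ∧
    -- `∂ₓ = T_1` generates the group of translations, and `e^{δ ∂ₓ}` is `L²`-STAR for `δ > 0`
    (∃ V : ℝ → KdVSch.L2 ≃ₗᵢ[ℂ] KdVSch.L2,
        KdVSch.IsTransportGroup (fun _ => 1) V ∧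
        (∀ (δ : ℝ) (ψ : KdVSch.L2),
          V δ ψ =ᵐ[AddCircle.haarAddCircle] fun x => ψ (x + (δ : KdVSch.Torus))) ∧
        ∀ δ : ℝ, 0 < δ → KdVSch.IsSTAR α Q (V δ)) := by
  have hQ : KdVSch.Admissible Q := ⟨hQcont, hQper⟩
  have hS : KdVSch.SpanCond Q := hQspan
  refine ⟨fun f hf => ?_, ?_⟩
  · obtain ⟨h1, h2⟩ := KdVSch.consistent_transp_cone (α := α) hQ hS hf
    exact ⟨KdVSch.trU h1, KdVSch.isTransportGroup_trU h1, (KdVSch.ar_trU h1 h2 one_pos).isSTAR⟩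
  · obtain ⟨h1, h2⟩ := KdVSch.consistent_transp_cone (α := α) hQ hS KdVSch.one_mem_coneG
    exact ⟨KdVSch.trU h1, KdVSch.isTransportGroup_trU h1, KdVSch.trU_one h1,
      fun δ hδ => (KdVSch.ar_trU h1 h2 hδ).isSTAR⟩
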